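/- Let $\alpha>0$ and let $\mathcal I$ be two-dimensional random interlacements $\mathrm{RI}(\alpha)$ on a probability space $(\Omega,\mathbb P)$. That is: let $(S_k)$ be simple random walk on $\mathbb Z^2$, let $a(x)=\sum_{k\ge 0}\big(\mathbb P_0[S_k=0]-\mathbb P_0[S_k=x]\big)$ be its potential kernel (a conditionally convergent series), and let $\widehat S$ be the walk on $\mathbb Z^2\setminus\{0\}$ that jumps from $x$ to a neighbour $y$ with probability $a(y)/(4a(x))$, with law $\widehat{\mathbb P}_x$ when started at $x$. Consider doubly infinite nearest-neighbour trajectories in $\mathbb Z^2$ that visit every site finitely often, modulo time shift. Let $\nu$ be the $\sigma$-finite measure on this space whose restriction to the trajectories that intersect a finite set $K$ is, for every such $K$, the image of the measure $$Q_K\big[w_0=x,\ (w_k)_{k\ge0}\in F,\ (w_{-k})_{k\ge0}\in G\big]=a(x)^2\,\widehat{\mathbb P}_x[F]\;\widehat{\mathbb P}_x\big[G,\ \widehat S_k\notin K\ \forall k\ge1\big],\qquad x\in K.$$ Then $\mathcal I$ is a Poisson point process of trajectories modulo time shift with intensity $\pi\alpha\,\nu$. Its vacant set $\mathcal V^\alpha$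 is the set of sites of $\mathbb Z^2$ visited by no trajectory of $\mathcal I$. For a finite $K\subset\mathbb Z^2\setminus\{0\}$, each trajectory $\varrho$ of $\mathcal I$ generates *noodles* on $K$: the set $\{k\in\mathbb Z:\varrho(k)\in K\}$ is uniquely a union of nonadjacent integer intervals $I_1,I_2,\dots$, and the noodles are the nearest-neighbour sequences $(\varrho(i),\,i\in I_j)$ (modulo time shift). The noodle configuration $\mathcal I(K)$ is the multiset of all noodles on $K$ generated by all the trajectories of $\mathcal I$. Let $\Lambda_n=\{x\in\mathbb Z^2:n-1<\|x\|\le n\}$ ($\|\cdot\|$ the Euclidean norm) and $\Theta_n=\bigcup_{j\ge n}\Lambda_j$. Let $\mathcal F_n$ be the $\sigma$-algebra generated by all the events $\{\mathcal I(K)\in\mathcal N\}$, where $K$ is a finite subset of $\Theta_n$ and $\mathcal N$ is a set of finite noodle configurations (finite multisets of noodles) on $K$. Let $\mathcal T=\bigcap_{n\ge1}\mathcal F_n$ be the $\sigma$-algebra of tail events. **Theorem.** For every $\alpha>0$ and every $E\in\mathcal T$, $\mathbb P[E]=0$ or $\mathbb P[E]=1$. In particular, for every $\alpha>0$, $\mathbb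 P[|\mathcal V^\alpha|=\infty]\in\{0,1\}$. -/

import Mathlib

open MeasureTheory ProbabilityTheory Set
open scoped ENNReal NNReal

namespace Interlacement

/-! ### The lattice -/

/-- Sites of the square lattice. -/
abbrev Site : Type := ℤ × ℤ

/-- Nearest-neighbor relation on the square lattice. -/
def Adj (x y : Site) : Prop := |x.1 - y.1| + |x.2 - y.2| = 1

instance : DecidableRel Adj := fun x y =>
  inferInstanceAs (Decidable (|x.1 - y.1| + |x.2 - y.2| = 1))

/-- Euclidean norm of a site. -/
noncomputable def euclNorm (x : Site) : ℝ := Real.sqrt ((x.1 : ℝ) ^ 2 + (x.2 : ℝ) ^ 2)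

/-- The annulus `Λ_n = {x : n - 1 < ‖x‖ ≤ n}`. -/
def annulus (n : ℕ) : Set Site := {x | (n : ℝ) - 1 < euclNorm x ∧ euclNorm x ≤ n}

/-- `Θ_n`, the union of the `Λ_j` over `j ≥ n`. -/
def outer (n : ℕ) : Set Site := ⋃ j ≥ n, annulus j

/-! ### Simple random walk, potential kernel, conditioned walk -/

/-- `srwProb k x` is the probability that simple random walk started at `0` is at `x` at time
`k`. -/
noncomputable def srwProb : ℕ → Site → ℝ
  | 0, x => if x = 0 then 1 else 0
  | k + 1, x =>
      (srwProb k (x + (1, 0)) + srwProb k (x - (1, 0)) +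
        srwProb k (x + (0, 1)) + srwProb k (x - (0, 1))) / 4

/-- The potential kernel `a(x) = ∑_{k ≥ 0} (P₀[S_k = 0] - P₀[S_k = x])`. The series converges
only conditionally: it is the limit of the partial sums in the order of increasing `k`. -/
noncomputable def potentialKernel (x : Site) : ℝ :=
  ∑'[SummationFilter.conditional ℕ] k, (srwProb k 0 - srwProb k x)

/-- Transition weights `a(y) / (4 a(x))`, for `y ∼ x`, of the conditioned walk. -/
noncomputable def condWeight (x y : Site) : ℝ≥0∞ :=
  if Adj x y then ENNReal.ofReal (potentialKernel y / (4 * potentialKernel x)) else 0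

open Classical in
/-- One step of the simple random walk conditioned on never hitting the origin (the Doob transform
of simple random walk by `a`): from `x ≠ 0` it goes to `y ∼ x` with probability `a(y) / (4 a(x))`.
These weights sum to one for every `x ≠ 0` since `a` is harmonic and positive off the origin; the
second branch is only met at the origin, which the walk never visits. -/
noncomputable def condStep (x : Site) : PMF Site :=
  if h : HasSum (condWeight x) 1 then ⟨condWeight x, h⟩ else PMF.pure x

/-- The one-step transition kernel of the conditioned walk. -/
noncomputable def condKernel : Kernel Site Site :=
  Kernel.ofFunOfCountable fun x => (condStep x).toMeasure

instance : IsMarkovKernel condKernel :=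
  ⟨fun x => inferInstanceAs (IsProbabilityMeasure (condStep x).toMeasure)⟩

/-- The conditioned-walk transition kernel seen as a kernel from the history up to time `n` to the
position at time `n + 1`. -/
noncomputable def condHistoryKernel (n : ℕ) : Kernel (Finset.Iic n → Site) Site :=
  condKernel.comap (fun h => h ⟨n, Finset.mem_Iic.2 le_rfl⟩) (measurable_pi_apply _)

instance (n : ℕ) : IsMarkovKernel (condHistoryKernel n) :=
  inferInstanceAs (IsMarkovKernel (condKernel.comap _ _))

/-- The law of the conditioned walk `(Ŝ_k)_{k ≥ 0}` started at `x`. -/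
noncomputable def condWalk (x : Site) : Measure (ℕ → Site) :=
  Kernel.traj (X := fun _ => Site) condHistoryKernel 0 (fun _ => x)

/-! ### Doubly infinite trajectories modulo time shift -/

/-- Doubly infinite nearest-neighbor trajectories visiting every site finitely many times. -/
def trajSet : Set (ℤ → Site) :=
  {w | (∀ k, Adj (w k) (w (k + 1))) ∧ ∀ x, {k | w k = x}.Finite}

/-- The space of doubly infinite trajectories, with the sigma-algebra generated by coordinates. -/
abbrev Traj : Type := trajSet

/-- Two trajectories are identified when they differ by a time shift. -/
def shiftSetoid : Setoid Traj where
  r w w' := ∃ m : ℤ, ∀ k, w'.1 k = w.1 (k + m)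
  iseqv :=
    { refl := fun _ => ⟨0, fun k => by simp⟩
      symm := fun ⟨m, h⟩ => ⟨-m, fun k => by simp [h]⟩
      trans := fun ⟨m, h⟩ ⟨m', h'⟩ => ⟨m' + m, fun k => by rw [h', h, add_assoc]⟩ }

/-- Trajectories modulo time shift, with the quotient sigma-algebra. -/
abbrev TrajMod : Type := Quotient shiftSetoid

/-- The set of sites visited by a trajectory modulo time shift. -/
def TrajMod.sites : TrajMod → Set Site :=
  Quotient.lift (fun w : Traj => Set.range w.1) (by
    rintro w w' ⟨m, h⟩
    ext x
    constructor
    · rintro ⟨k, rfl⟩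
      exact ⟨k - m, by simp [h]⟩
    · rintro ⟨k, rfl⟩
      exact ⟨k + m, (h k).symm⟩)

/-! ### Two-dimensional random interlacements -/

/-- Glue a future `f` (times `0, 1, 2, …`) and a past `g` (times `0, -1, -2, …`). -/
def glue (p : (ℕ → Site) × (ℕ → Site)) : ℤ → Site :=
  fun k => if 0 ≤ k then p.1 k.toNat else p.2 (-k).toNat

/-- Paths that do not visit `K` at any time `k ≥ 1`. -/
def neverReturn (K : Finset Site) : Set (ℕ → Site) := {g | ∀ k, 1 ≤ k → g k ∉ K}

/-- The finite measure `Q_K` on doubly infinite trajectories entering `K` for the first time at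
time `0`:
`Q_K[w₀ = x, (w_k)_{k ≥ 0} ∈ F, (w_{-k})_{k ≥ 0} ∈ G] = a(x)² P̂_x[F] P̂_x[G, never return to K]`
for `x ∈ K`. The total mass at `x` is `ê_K(x) = a(x)² P̂_x[never return to K]`, the equilibrium
measure of `K` for the conditioned walk with its reversible measure `a²`. -/
noncomputable def hittingMeasure (K : Finset Site) : Measure Traj :=
  (∑ x ∈ K, ENNReal.ofReal (potentialKernel x ^ 2) •
    ((condWalk x).prod ((condWalk x).restrict (neverReturn K))).map glue).comap Subtype.val

/-- The intensity measure of random interlacements on trajectories modulo time shift. Its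
restriction to the trajectories that intersect a finite set `K` is the image of `Q_K`; it is the
increasing limit of these restrictions as `K` grows to the whole lattice. -/
noncomputable def intensity : Measure TrajMod :=
  ⨆ K : Finset Site, (hittingMeasure K).map (Quotient.mk shiftSetoid)

/-- `I` is a (simple) Poisson point process on `X` with the intensity `μ`: counts of measurable
sets of finite intensity are Poisson, and counts of disjoint sets are independent. -/
structure IsPoissonPointProcess {Ω X : Type*} [MeasurableSpace Ω] [MeasurableSpace X]
    (μ : Measure X) (P : Measure Ω) (I : Ω → Set X) : Prop where
  measurable_count : ∀ B : Set X, MeasurableSet B → Measurable fun ω => (I ω ∩ B).encard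
  law_count : ∀ B : Set X, MeasurableSet B → μ B ≠ ∞ →
    P.map (fun ω => (I ω ∩ B).encard) =
      (poissonMeasure (μ B).toNNReal).map (fun k : ℕ => (k : ℕ∞))
  indep_count : ∀ (n : ℕ) (B : Fin n → Set X), (∀ i, MeasurableSet (B i)) →
    Pairwise (fun i j => Disjoint (B i) (B j)) →
    iIndepFun (fun i ω => (I ω ∩ B i).encard) P

/-- `I` is (the random set of trajectories of) two-dimensional random interlacements `RI(α)`: the
Poisson point process of trajectories modulo time shift with intensity `π α` times
`intensity`. -/
def IsRandomInterlacement {Ω : Type*} [MeasurableSpace Ω] (α : ℝ) (P : Measure Ω)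
    (I : Ω → Set TrajMod) : Prop :=
  IsPoissonPointProcess (ENNReal.ofReal (Real.pi * α) • intensity) P I

/-- The vacant set: the sites visited by no trajectory. -/
def vacantSet (I : Set TrajMod) : Set Site := {x | ∀ w ∈ I, x ∉ w.sites}

/-! ### Noodles and tail events -/

/-- Noodles on a finite set `K`: nonempty nearest-neighbor sequences of sites of `K`. Since
trajectories spend only a finite time in `K`, they only generate finite noodles on `K`; as
trajectories are taken modulo time shift, so are noodles, and they are recorded as lists. -/
abbrev Noodle (K : Finset Site) : Type :=
  {l : List Site // l ≠ [] ∧ l.IsChain Adj ∧ ∀ x ∈ l, x ∈ K}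

/-- `{s, …, t}` is one of the maximal intervals of which `{k : w k ∈ K}` is composed. -/
def IsVisit (K : Finset Site) (w : ℤ → Site) (s t : ℤ) : Prop :=
  s ≤ t ∧ (∀ k, s ≤ k → k ≤ t → w k ∈ K) ∧ w (s - 1) ∉ K ∧ w (t + 1) ∉ K

/-- The sequence `w s, w (s + 1), …, w t`. -/
def segment (w : ℤ → Site) (s t : ℤ) : List Site :=
  (List.range (t + 1 - s).toNat).map fun j : ℕ => w (s + (j : ℤ))

/-- The intervals `{s, …, t}` on which `w` generates the noodle `l` on `K`. -/
def visits (K : Finset Site) (l : Noodle K) (w : ℤ → Site) : Set (ℤ × ℤ) :=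
  {p | IsVisit K w p.1 p.2 ∧ segment w p.1 p.2 = l.1}

theorem visits_shift (K : Finset Site) (l : Noodle K) (w w' : ℤ → Site) (m : ℤ)
    (h : ∀ k, w' k = w (k + m)) :
    visits K l w = (fun p : ℤ × ℤ => (p.1 + m, p.2 + m)) '' visits K l w' := by
  ext ⟨s, t⟩
  simp only [visits, IsVisit, segment, h, mem_image, mem_ofPred_eq, Prod.mk.injEq, Prod.exists]
  constructor
  · rintro ⟨⟨h1, h2, h3, h4⟩, h5⟩
    refine ⟨s - m, t - m, ⟨⟨by omega, fun k hk hk' => h2 _ (by omega) (by omega), ?_, ?_⟩, ?_⟩,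
      by omega, by omega⟩
    · rwa [show s - m - 1 + m = s - 1 by ring]
    · rwa [show t - m + 1 + m = t + 1 by ring]
    · rw [← h5, show t - m + 1 - (s - m) = t + 1 - s by ring]
      refine List.map_congr_left fun j _ => ?_
      rw [show s - m + (j : ℤ) + m = s + j by ring]
  · rintro ⟨s', t', ⟨⟨h1, h2, h3, h4⟩, h5⟩, rfl, rfl⟩
    refine ⟨⟨by omega, fun k hk hk' => ?_, ?_, ?_⟩, ?_⟩
    · have := h2 (k - m) (by omega) (by omega)
      rwa [sub_add_cancel] at this
    · rwa [show s' + m - 1 = s' - 1 + m by ring]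
    · rwa [show t' + m + 1 = t' + 1 + m by ring]
    · rw [← h5, show t' + m + 1 - (s' + m) = t' + 1 - s' by ring]
      refine List.map_congr_left fun j _ => ?_
      rw [show s' + m + (j : ℤ) = s' + j + m by ring]

/-- The number of times a trajectory generates the noodle `l` on `K`. -/
noncomputable def TrajMod.noodleCount (K : Finset Site) (l : Noodle K) : TrajMod → ℕ∞ :=
  Quotient.lift (fun w : Traj => (visits K l w.1).encard) (by
    rintro w w' ⟨m, h⟩
    have hinj : Function.Injective fun p : ℤ × ℤ => (p.1 + m, p.2 + m) := by
      rintro ⟨a, b⟩ ⟨c, d⟩ hp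
      simpa using hp
    simp only [visits_shift K l w.1 w'.1 m h, hinj.encard_image])

/-- The interlacement (noodle) configuration of `I` on `K`, as the multiset of all noodles on `K`
generated by the trajectories of `I`, given by multiplicities. -/
noncomputable def noodleConfig (I : Set TrajMod) (K : Finset Site) (l : Noodle K) : ℝ≥0∞ :=
  ∑' w : I, ((w.1.noodleCount K l : ℕ∞) : ℝ≥0∞)

/-- The event that the noodle configuration on `K` belongs to a set `N` of finite noodle
configurations on `K`. -/
def cylinderEvent {Ω : Type*} (I : Ω → Set TrajMod) (K : Finset Site)
    (N : Set (Multiset (Noodle K))) : Set Ω :=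
  {ω | ∃ η ∈ N, ∀ l, noodleConfig (I ω) K l = (η.count l : ℝ≥0∞)}

/-- The sigma-algebra `ℱ_n` on `Ω`, generated by the cylinder events on finite subsets of `Θ_n`. -/
abbrev outerSigma {Ω : Type*} (I : Ω → Set TrajMod) (n : ℕ) : MeasurableSpace Ω :=
  MeasurableSpace.generateFrom
    {E | ∃ K : Finset Site, (K : Set Site) ⊆ outer n ∧
      ∃ N : Set (Multiset (Noodle K)), E = cylinderEvent I K N}

/-- The tail sigma-algebra `𝒯 = ⋂_{n ≥ 1} ℱ_n`. -/
abbrev tailSigma {Ω : Type*} (I : Ω → Set TrajMod) : MeasurableSpace Ω :=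
  ⨅ n : ℕ, ⨅ _ : 1 ≤ n, outerSigma I n

end Interlacement

/-!
# The zero-one law for tail events of two-dimensional random interlacements

The noodle configuration on a finite subset of `Θ_{n+1}` is a function of the number of visits
that the trajectories pay to it, noodle by noodle. Hence the events of `ℱ_{n+1}` are expressed by
countably many counts `(I ω ∩ A).encard`, where membership of a trajectory in `A` depends only on
its noodles outside a large ball. The theorem combines a zero-one law for one trajectory with a
zero-one law for Poisson processes of infinite intensity.

*One trajectory.* Almost every trajectory leaves each finite set in both directions of time. If
two trajectories coincide, up to separate shifts of their two ends, outside a finite stretch of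
time, then they generate the same noodles far away from the origin
(`TailEq.exists_encard_visits_eq`). A tail set of trajectories is therefore invariant under
finite modifications, and for fixed past the conditional probability of such a set, given an
initial segment of the walk, is a bounded function of the endpoint that is harmonic for the
conditioned walk `Ŝ`. Multiplied by the potential kernel `a` it becomes a function on `ℤ²` that
grows no faster than a small power of the distance and is harmonic off the origin; the Liouville
theorem for such functions shows that the bounded harmonic functions of `Ŝ` are constant
(`exists_const_of_condHarmonic`). So future and past are tail trivial, and a tail set of
trajectories is null or conull for the intensity (`intensity_zero_one`). Here the intensity is
the image of a shift-invariant measure on two-sided paths (`stationaryMeasure_shiftBy`), which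
also gives the consistency of the measures `Q_K`.

*Many trajectories.* Let `E` be a tail event of the process, and let `D` be an event that is
determined by the counts of finitely many sets. By the Mecke equation
(`IsPoissonPointProcess.lintegral_count_inter`), the probability that `E` and `D` hold after one
trajectory `ρ` has been added in the description of `E` is a function of `ρ` that does not depend,
up to null sets, on the level `n` at which `E` is described. It is thus measurable with respect
to the tail of one trajectory, hence constant (`exists_const_of_tail`). The intensity has infinite
total mass, since the capacities of the level sets of `a` tend to infinity
(`tendsto_intensity_level`); adding one trajectory out of infinitely many does not change the law
of the process asymptotically, so that the constant is `P[E ∩ D]`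
(`IsPoissonPointProcess.eq_measure_of_lintegral_count`). The Mecke equation then becomes a
recursion for the conditional law of a count given `E`, whose solution is the Poisson law: `E` is
independent of all counts. Being expressed by counts itself, it is independent of itself
(`IsPoissonPointProcess.zero_one`).

Finite changes of a set of sites do not affect its infinitude, and each site outside a ball is
vacant if and only if there is no noodle on it; so the infinitude of the vacant set is a tail event
(`measurableSet_infinite_vacantSet`).
-/

namespace Interlacement

/-! ### The averaging operator and binomial weights -/

/-- The average of a function over the four neighbors of a site. -/
noncomputable def nbrAvg (f : Site → ℝ) (x : Site) : ℝ :=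
  (f (x + (1, 0)) + f (x - (1, 0)) + f (x + (0, 1)) + f (x - (0, 1))) / 4

theorem srwProb_succ (k : ℕ) : srwProb (k + 1) = nbrAvg (srwProb k) := rfl

theorem srwProb_eq_iterate (k : ℕ) : srwProb k = nbrAvg^[k] (srwProb 0) := by
  induction k with
  | zero => rfl
  | succ k ih => rw [Function.iterate_succ_apply', ← ih, srwProb_succ]

theorem sum_choose_succ_mul_real (n : ℕ) (g : ℕ → ℝ) :
    ∑ k ∈ Finset.range (n + 2), ((n + 1).choose k : ℝ) * g k =
      ∑ k ∈ Finset.range (n + 1), (n.choose k : ℝ) * (g k + g (k + 1)) := by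
  have h1 : ∑ k ∈ Finset.range (n + 1), (n.choose (k + 1) : ℝ) * g (k + 1) + g 0 =
      ∑ k ∈ Finset.range (n + 1), (n.choose k : ℝ) * g k := by
    have := Finset.sum_range_succ' (fun k => (n.choose k : ℝ) * g k) (n + 1)
    rw [Finset.sum_range_succ] at this
    simpa using this.symm
  rw [Finset.sum_range_succ']
  simp only [Nat.choose_succ_succ, Nat.cast_add, add_mul, mul_add, Finset.sum_add_distrib]
  simp only [Nat.succ_eq_add_one, Nat.choose_zero_right, Nat.cast_one, one_mul]
  linarith

/-- In the coordinates `x.1 + x.2` and `x.1 - x.2`, simple random walk is a pair of independent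
one-dimensional walks, so that its transition probabilities are products of binomial weights. -/
theorem nbrAvg_iterate (n : ℕ) (f : Site → ℝ) (x : Site) :
    nbrAvg^[n] f x = (∑ k ∈ Finset.range (n + 1), (n.choose k : ℝ) *
      ∑ l ∈ Finset.range (n + 1), (n.choose l : ℝ) *
        f (x.1 + k + l - n, x.2 + k - l)) / 4 ^ n := by
  induction n generalizing f with
  | zero => simp
  | succ n ih =>
    rw [Function.iterate_succ_apply, ih, sum_choose_succ_mul_real n (fun k =>
      ∑ l ∈ Finset.range (n + 2), ((n + 1).choose l : ℝ) *
        f (x.1 + k + l - (n + 1 : ℕ), x.2 + k - l)), pow_succ', ← div_div]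
    congr 1
    rw [Finset.sum_div]
    refine Finset.sum_congr rfl fun k _ => ?_
    rw [mul_div_assoc]
    congr 1
    rw [sum_choose_succ_mul_real n (fun l =>
        f (x.1 + k + l - (n + 1 : ℕ), x.2 + k - l)),
      sum_choose_succ_mul_real n (fun l =>
        f (x.1 + (k + 1 : ℕ) + l - (n + 1 : ℕ), x.2 + (k + 1 : ℕ) - l)), ← Finset.sum_add_distrib,
        Finset.sum_div]
    refine Finset.sum_congr rfl fun l _ => ?_
    rw [← mul_add, mul_div_assoc]
    congr 1
    rw [nbrAvg]
    congr 1
    push_cast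
    have e1 : ((x.1 + k + l - n, x.2 + k - l) : Site) + (1, 0) =
      (x.1 + (k + 1) + (l + 1) - (n + 1), x.2 + (k + 1) - (l + 1)) := by
      ext <;> simp <;> ring
    have e2 : ((x.1 + k + l - n, x.2 + k - l) : Site) - (1, 0) =
      (x.1 + k + l - (n + 1), x.2 + k - l) := by
      ext <;> simp <;> ring
    have e3 : ((x.1 + k + l - n, x.2 + k - l) : Site) + (0, 1) =
      (x.1 + (k + 1) + l - (n + 1), x.2 + (k + 1) - l) := by
      ext <;> simp <;> ring
    have e4 : ((x.1 + k + l - n, x.2 + k - l) : Site) - (0, 1) =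
      (x.1 + k + (l + 1) - (n + 1), x.2 + k - (l + 1)) := by
      ext <;> simp <;> ring
    rw [e1, e2, e3, e4]
    ring

/-- The probability that one-dimensional simple random walk is at `2 i` at time `2 m`. -/
noncomputable def binomMass (m : ℕ) (i : ℤ) : ℝ := ((2 * m).choose (m + i.natAbs) : ℝ) / 4 ^ m

theorem binomMass_nonneg (m : ℕ) (i : ℤ) : 0 ≤ binomMass m i := by unfold binomMass; positivity

theorem binomMass_le (m : ℕ) (i : ℤ) : binomMass m i ≤ binomMass m 0 := by
  unfold binomMass
  gcongr
  simpa [Nat.centralBinom] using Nat.choose_le_centralBinom (m + i.natAbs) m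

theorem binomMass_eq_zero (m : ℕ) (i : ℤ) (h : m < i.natAbs) : binomMass m i = 0 := by
  unfold binomMass
  rw [Nat.choose_eq_zero_of_lt (by omega)]
  simp

theorem choose_eq_binomMass (m k : ℕ) (hk : k ≤ 2 * m) (i : ℤ) (hi : (k : ℤ) = m - i) :
    ((2 * m).choose k : ℝ) = binomMass m i * 4 ^ m := by
  unfold binomMass
  rw [div_mul_cancel₀ _ (by positivity)]
  rcases le_total 0 i with h | h
  · rw [← Nat.choose_symm hk]
    congr 2
    omega
  · congr 2
    omega

theorem srwProb_two_mul (m : ℕ) (i j : ℤ) :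
    srwProb (2 * m) (i + j, i - j) = binomMass m i * binomMass m j := by
  rw [srwProb_eq_iterate, nbrAvg_iterate]
  rcases lt_or_ge m i.natAbs with hi | hi
  · rw [binomMass_eq_zero m i hi, zero_mul]
    rw [div_eq_zero_iff]
    left
    refine Finset.sum_eq_zero fun k hk => ?_
    rw [Finset.sum_eq_zero, mul_zero]
    intro l hl
    rw [Finset.mem_range] at hk hl
    simp only [srwProb, Prod.ext_iff, Prod.fst_zero, Prod.snd_zero]
    rw [if_neg, mul_zero]
    push_cast
    omega
  rcases lt_or_ge m j.natAbs with hj | hj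
  · rw [binomMass_eq_zero m j hj, mul_zero]
    rw [div_eq_zero_iff]
    left
    refine Finset.sum_eq_zero fun k hk => ?_
    rw [Finset.sum_eq_zero, mul_zero]
    intro l hl
    rw [Finset.mem_range] at hk hl
    simp only [srwProb, Prod.ext_iff, Prod.fst_zero, Prod.snd_zero]
    rw [if_neg, mul_zero]
    push_cast
    omega
  obtain ⟨k, hk⟩ : ∃ k : ℕ, (k : ℤ) = m - i := ⟨(m - i).toNat, by omega⟩
  obtain ⟨l, hl⟩ : ∃ k : ℕ, (k : ℤ) = m - j := ⟨(m - j).toNat, by omega⟩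
  rw [Finset.sum_eq_single k, Finset.sum_eq_single l]
  · rw [choose_eq_binomMass m k (by omega) i hk, choose_eq_binomMass m l (by omega) j hl]
    simp only [srwProb, Prod.ext_iff, Prod.fst_zero, Prod.snd_zero]
    rw [if_pos (by push_cast; omega), mul_one, pow_mul, show (4 : ℝ) ^ 2 = 4 * 4 by norm_num, mul_pow]
    field_simp
  · intro l' _ hne
    simp only [srwProb, Prod.ext_iff, Prod.fst_zero, Prod.snd_zero]
    rw [if_neg, mul_zero]
    push_cast
    omega
  · intro h
    rw [Finset.mem_range] at h
    omega
  · intro k' _ hne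
    rw [Finset.sum_eq_zero, mul_zero]
    intro l' _
    simp only [srwProb, Prod.ext_iff, Prod.fst_zero, Prod.snd_zero]
    rw [if_neg, mul_zero]
    push_cast
    omega
  · intro h
    rw [Finset.mem_range] at h
    omega

theorem binomMass_zero_succ (m : ℕ) :
    binomMass (m + 1) 0 * (2 * m + 2) = binomMass m 0 * (2 * m + 1) := by
  have h := Nat.succ_mul_centralBinom_succ m
  have h' : ((m : ℝ) + 1) * (Nat.centralBinom (m + 1) : ℝ) =
      2 * (2 * m + 1) * (Nat.centralBinom m : ℝ) := by exact_mod_cast h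
  simp only [Nat.centralBinom] at h'
  simp only [binomMass, Int.natAbs_zero, add_zero, pow_succ]
  field_simp
  linarith

theorem binomMass_zero_pos (m : ℕ) : 0 < binomMass m 0 := by
  unfold binomMass
  have := Nat.centralBinom_pos m
  simp only [Nat.centralBinom] at this
  have : (0 : ℝ) < ((2 * m).choose m : ℝ) := by exact_mod_cast this
  simp only [Int.natAbs_zero, add_zero]
  positivity

theorem binomMass_sq_le (m : ℕ) : binomMass m 0 ^ 2 * (2 * m + 1) ≤ 1 := by
  induction m with
  | zero => simp [binomMass]
  | succ m ih =>
    have h := binomMass_zero_succ m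
    have h2 : binomMass (m + 1) 0 = binomMass m 0 * (2 * m + 1) / (2 * m + 2) := by
      rw [← h]; field_simp
    rw [h2]
    refine le_trans ?_ ih
    rw [div_pow, div_mul_eq_mul_div, div_le_iff₀ (by positivity)]
    have := sq_nonneg (binomMass m 0)
    push_cast
    have h3 : (0 : ℝ) ≤ binomMass m 0 ^ 2 * (2 * m + 1) := by positivity
    nlinarith

theorem le_binomMass_sq (m : ℕ) (hm : 1 ≤ m) : 1 ≤ binomMass m 0 ^ 2 * (4 * m) := by
  induction m, hm using Nat.le_induction with
  | base => norm_num [binomMass, Nat.choose]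
  | succ m hm ih =>
    have h := binomMass_zero_succ m
    have h2 : binomMass (m + 1) 0 = binomMass m 0 * (2 * m + 1) / (2 * m + 2) := by
      rw [← h]; field_simp
    rw [h2]
    refine le_trans ih ?_
    rw [div_pow, div_mul_eq_mul_div, le_div_iff₀ (by positivity)]
    have := sq_nonneg (binomMass m 0)
    push_cast
    nlinarith

/-- The central binomial weight dominates, with a quadratic error. -/
theorem binomMass_ge (m : ℕ) (i : ℤ) :
    binomMass m 0 * (1 - (i : ℝ) ^ 2 / (m + 1)) ≤ binomMass m i := by
  have key : ∀ n : ℕ, binomMass m 0 * (1 - (n : ℝ) ^ 2 / (m + 1)) ≤ binomMass m n := by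
    intro n
    induction n with
    | zero => simp
    | succ n ih =>
      rcases lt_or_ge m (n + 1) with h | h
      · refine le_trans ?_ (binomMass_nonneg _ _)
        refine mul_nonpos_of_nonneg_of_nonpos (binomMass_nonneg _ _) ?_
        rw [sub_nonpos, le_div_iff₀ (by positivity), one_mul]
        have : (m : ℝ) + 1 ≤ n + 1 := by exact_mod_cast h
        push_cast
        nlinarith [(Nat.cast_nonneg m : (0 : ℝ) ≤ m)]
      have hc := Nat.choose_succ_right_eq (2 * m) (m + n)
      have hc' : binomMass m ((n + 1 : ℕ) : ℤ) * (m + n + 1) = binomMass m (n : ℤ) * (m - n) := by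
        have h3 : (((2 * m).choose (m + n + 1) * (m + n + 1) : ℕ) : ℝ) =
            ((2 * m).choose (m + n) * (2 * m - (m + n)) : ℕ) := by exact_mod_cast hc
        rw [Nat.cast_mul, Nat.cast_mul, Nat.cast_sub (by omega)] at h3
        push_cast at h3
        simp only [binomMass, Int.natAbs_natCast, ← add_assoc]
        field_simp
        linarith
      have hle := binomMass_le m n
      have h0 := binomMass_nonneg m n
      have h4 : binomMass m ((n + 1 : ℕ) : ℤ) =
          binomMass m (n : ℤ) - binomMass m (n : ℤ) * ((2 * n + 1) / (m + n + 1)) := by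
        field_simp
        linarith
      have h5 : binomMass m (n : ℤ) * ((2 * n + 1) / (m + n + 1)) ≤
          binomMass m 0 * ((2 * n + 1) / (m + 1)) := by
        have hn0 : (0 : ℝ) ≤ n := Nat.cast_nonneg n
        exact mul_le_mul hle (div_le_div_of_nonneg_left (by positivity) (by positivity)
          (by linarith)) (by positivity) (h0.trans hle)
      rw [h4]
      have h6 : binomMass m 0 * (1 - ((n + 1 : ℕ) : ℝ) ^ 2 / (m + 1)) =
          binomMass m 0 * (1 - (n : ℝ) ^ 2 / (m + 1)) -
          binomMass m 0 * ((2 * n + 1) / (m + 1)) := by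
        push_cast
        field_simp
        ring
      linarith
  have h := key i.natAbs
  rcases Int.natAbs_eq i with h' | h'
  · rw [h']
    simpa using h
  · rw [h']
    simpa [binomMass] using h

theorem srwProb_nonneg (k : ℕ) (x : Site) : 0 ≤ srwProb k x := by
  induction k generalizing x with
  | zero => simp only [srwProb]; split_ifs <;> norm_num
  | succ k ih =>
    rw [srwProb_succ, nbrAvg]
    have := ih (x + (1, 0)); have := ih (x - (1, 0)); have := ih (x + (0, 1))
    have := ih (x - (0, 1))
    positivity

/-- Parity of the walk: a site is only visited at times of its own parity. -/
theorem srwProb_eq_zero_of_odd (k : ℕ) (x : Site) (h : Odd (x.1 + x.2 + k)) :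
    srwProb k x = 0 := by
  induction k generalizing x with
  | zero =>
    simp only [srwProb]
    rw [if_neg]
    rintro rfl
    simp at h
  | succ k ih =>
    have h' : ∀ y : Site, (y.1 + y.2) = x.1 + x.2 + 1 ∨ (y.1 + y.2) = x.1 + x.2 - 1 →
        srwProb k y = 0 := by
      intro y hy
      apply ih
      push_cast at h
      rw [Int.odd_iff] at h ⊢
      omega
    rw [srwProb_succ, nbrAvg, h', h', h', h'] <;> simp <;> omega

theorem srwProb_eq_zero_of_lt (k : ℕ) (x : Site) (h : (k : ℤ) < |x.1| + |x.2|) :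
    srwProb k x = 0 := by
  induction k generalizing x with
  | zero =>
    simp only [srwProb]
    rw [if_neg]
    rintro rfl
    simp at h
  | succ k ih =>
    have h' : ∀ y : Site, |x.1| + |x.2| ≤ |y.1| + |y.2| + 1 → srwProb k y = 0 := by
      intro y hy
      apply ih
      push_cast at h
      omega
    simp only [Int.abs_eq_natAbs] at h h'
    rw [srwProb_succ, nbrAvg, h', h', h', h'] <;> simp only [Prod.fst_add, Prod.snd_add, Prod.fst_sub, Prod.snd_sub, add_zero,
      sub_zero, zero_div] <;> omega

theorem exists_even_coords (x : Site) (hx : Even (x.1 + x.2)) : ∃ i j : ℤ, x = (i + j, i - j) := by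
  obtain ⟨r, hr⟩ := hx
  exact ⟨r, x.1 - r, by ext <;> grind⟩

theorem srwProb_zero_two_mul (m : ℕ) : srwProb (2 * m) 0 = binomMass m 0 ^ 2 := by
  have := srwProb_two_mul m 0 0
  rw [show ((0 + 0, 0 - 0) : Site) = 0 from rfl] at this
  rw [this, sq]

theorem srwProb_two_mul_le (m : ℕ) (x : Site) : srwProb (2 * m) x ≤ binomMass m 0 ^ 2 := by
  rcases Int.even_or_odd (x.1 + x.2) with h | h
  · obtain ⟨i, j, rfl⟩ := exists_even_coords x h
    rw [srwProb_two_mul, sq]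
    exact mul_le_mul (binomMass_le _ _) (binomMass_le _ _) (binomMass_nonneg _ _)
      (binomMass_nonneg _ _)
  · rw [srwProb_eq_zero_of_odd]
    · positivity
    · push_cast
      rw [Int.odd_iff] at h ⊢
      omega

theorem srwProb_mul_le (k : ℕ) (x : Site) : srwProb k x * k ≤ 1 := by
  have key : ∀ (m : ℕ) (x : Site), srwProb (2 * m) x * (2 * m + 1) ≤ 1 := fun m x =>
    le_trans (mul_le_mul_of_nonneg_right (srwProb_two_mul_le m x) (by positivity))
      (binomMass_sq_le m)
  obtain ⟨m, rfl | rfl⟩ := Nat.even_or_odd' k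
  · have := key m x
    have := srwProb_nonneg (2 * m) x
    push_cast
    linarith
  · rw [srwProb_succ, nbrAvg]
    push_cast
    linarith [key m (x + (1, 0)), key m (x - (1, 0)), key m (x + (0, 1)), key m (x - (0, 1))]

theorem tendsto_srwProb (x : Site) : Filter.Tendsto (fun k => srwProb k x) Filter.atTop (nhds 0) := by
  refine tendsto_of_tendsto_of_tendsto_of_le_of_le' tendsto_const_nhds
    (tendsto_one_div_atTop_nhds_zero_nat (𝕜 := ℝ))
    (Filter.Eventually.of_forall fun k => srwProb_nonneg k x) ?_
  filter_upwards [Filter.eventually_gt_atTop 0] with k hk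
  rw [le_div_iff₀ (by exact_mod_cast hk)]
  exact srwProb_mul_le k x

/-! ### The potential kernel -/

/-- The partial sums of the potential kernel. -/
noncomputable def potentialSum (n : ℕ) (x : Site) : ℝ :=
  ∑ k ∈ Finset.range n, (srwProb k 0 - srwProb k x)

theorem nbrAvg_potentialSum (n : ℕ) (x : Site) :
    nbrAvg (potentialSum n) x = potentialSum n x + srwProb 0 x - srwProb n x := by
  have h : nbrAvg (potentialSum n) x = ∑ k ∈ Finset.range n, (srwProb k 0 - srwProb (k + 1) x) := by
    simp only [nbrAvg, potentialSum, srwProb_succ]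
    rw [← Finset.sum_add_distrib, ← Finset.sum_add_distrib, ← Finset.sum_add_distrib,
      Finset.sum_div]
    exact Finset.sum_congr rfl fun k _ => by ring
  have h2 := Finset.sum_range_sub' (fun k => srwProb k x) n
  rw [h, add_sub_assoc, ← h2, potentialSum, ← Finset.sum_add_distrib]
  exact Finset.sum_congr rfl fun k _ => by ring

/-- At even sites the series defining the potential kernel has nonnegative terms. -/
theorem srwProb_zero_sub_nonneg (k : ℕ) (x : Site) (hx : Even (x.1 + x.2)) :
    0 ≤ srwProb k 0 - srwProb k x := by
  obtain ⟨m, rfl | rfl⟩ := Nat.even_or_odd' k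
  · rw [srwProb_zero_two_mul, sub_nonneg]
    exact srwProb_two_mul_le m x
  · rw [srwProb_eq_zero_of_odd, srwProb_eq_zero_of_odd _ x, sub_zero]
    · push_cast
      rw [Int.even_iff] at hx
      rw [Int.odd_iff]
      omega
    · simp

/-- At even sites the terms of the series defining the potential kernel are summable, with a bound
of slow growth in `x`. The bound interpolates between the estimates `O(1 / k)` and `O(|x|² / k²)`;
any growth exponent below `1 / 2` suffices for the Liouville theorem, and any power of `k` beyond
the first suffices for summability. -/
theorem srwProb_zero_sub_le (k : ℕ) (x : Site) (hx : Even (x.1 + x.2)) :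
    srwProb k 0 - srwProb k x ≤
      4 * (1 + |(x.1 : ℝ)| + |(x.2 : ℝ)|) ^ (1 / 8 : ℝ) * (1 / ((k : ℝ) + 1) ^ (17 / 16 : ℝ)) := by
  obtain ⟨m, rfl | rfl⟩ := Nat.even_or_odd' k
  · rw [srwProb_zero_two_mul]
    obtain ⟨i, j, rfl⟩ := exists_even_coords x hx
    rw [srwProb_two_mul]
    set b := binomMass m 0
    have hb : 0 < b := binomMass_zero_pos m
    have hb2 : b ^ 2 * (2 * m + 1) ≤ 1 := binomMass_sq_le m
    have hi := binomMass_ge m i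
    have hj := binomMass_ge m j
    have hi0 := binomMass_nonneg m i
    have hj0 := binomMass_nonneg m j
    have hi1 : binomMass m i ≤ b := binomMass_le m i
    have hj1 : binomMass m j ≤ b := binomMass_le m j
    set t : ℝ := ((i : ℝ) ^ 2 + (j : ℝ) ^ 2) / (m + 1) with ht
    have ht0 : 0 ≤ t := by positivity
    have h1 : b ^ 2 - binomMass m i * binomMass m j ≤ b ^ 2 * t := by
      have e : b ^ 2 * t = b * (b * ((i : ℝ) ^ 2 / (m + 1))) + b * (b * ((j : ℝ) ^ 2 / (m + 1))) := by
        rw [ht]; ring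
      have h2 : b * (b - binomMass m i) ≤ b * (b * ((i : ℝ) ^ 2 / (m + 1))) := by
        gcongr; linarith
      have h3 : binomMass m i * (b - binomMass m j) ≤ b * (b * ((j : ℝ) ^ 2 / (m + 1))) := by
        apply mul_le_mul hi1 (by linarith) (by linarith) hb.le
      rw [e]
      nlinarith
    have h2 : b ^ 2 - binomMass m i * binomMass m j ≤ b ^ 2 := by
      have := mul_nonneg hi0 hj0
      linarith
    -- Interpolate between the two bounds.
    have h3 : b ^ 2 - binomMass m i * binomMass m j ≤ b ^ 2 * t ^ (1 / 16 : ℝ) := by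
      rcases le_total t 1 with h | h
      · refine h1.trans ?_
        gcongr
        calc t = t ^ (1 : ℝ) := (Real.rpow_one t).symm
          _ ≤ t ^ (1 / 16 : ℝ) := Real.rpow_le_rpow_of_exponent_ge' ht0 h (by norm_num) (by norm_num)
      · refine h2.trans ?_
        have := Real.one_le_rpow h (by norm_num : (0 : ℝ) ≤ 1 / 16)
        nlinarith [sq_nonneg b]
    refine h3.trans ?_
    have h4 : b ^ 2 ≤ 1 / (2 * m + 1) := by
      rw [le_div_iff₀ (by positivity)]
      exact hb2
    set L : ℝ := 1 + |((i + j : ℤ) : ℝ)| + |((i - j : ℤ) : ℝ)| with hL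
    have hL1 : 1 ≤ L := by rw [hL]; linarith [abs_nonneg ((i + j : ℤ) : ℝ), abs_nonneg ((i - j : ℤ) : ℝ)]
    have h5 : (i : ℝ) ^ 2 + (j : ℝ) ^ 2 ≤ L ^ 2 := by
      have e1 := sq_abs ((i + j : ℤ) : ℝ)
      have e2 := sq_abs ((i - j : ℤ) : ℝ)
      have := abs_nonneg ((i + j : ℤ) : ℝ)
      have := abs_nonneg ((i - j : ℤ) : ℝ)
      have e3 : (i : ℝ) ^ 2 + (j : ℝ) ^ 2 ≤ ((i + j : ℤ) : ℝ) ^ 2 + ((i - j : ℤ) : ℝ) ^ 2 := by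
        push_cast
        nlinarith [sq_nonneg (i : ℝ), sq_nonneg (j : ℝ)]
      rw [hL]
      nlinarith
    have h6 : t ≤ L ^ 2 / (m + 1) := by rw [ht]; gcongr
    have h7 : t ^ (1 / 16 : ℝ) ≤ L ^ (1 / 8 : ℝ) / ((m : ℝ) + 1) ^ (1 / 16 : ℝ) := by
      refine (Real.rpow_le_rpow ht0 h6 (by norm_num)).trans_eq ?_
      rw [Real.div_rpow (by positivity) (by positivity), ← Real.rpow_natCast,
        ← Real.rpow_mul (by linarith)]
      norm_num
    have h8 : (((2 * m : ℕ) : ℝ) + 1) ^ (17 / 16 : ℝ) = (2 * m + 1) * (2 * m + 1 : ℝ) ^ (1 / 16 : ℝ) := by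
      rw [show (17 / 16 : ℝ) = 1 + 1 / 16 by norm_num, Real.rpow_add (by positivity), Real.rpow_one]
      push_cast
      ring
    have h9 : (2 * m + 1 : ℝ) ^ (1 / 16 : ℝ) ≤ 4 * ((m : ℝ) + 1) ^ (1 / 16 : ℝ) := by
      calc (2 * m + 1 : ℝ) ^ (1 / 16 : ℝ) ≤ (4 * ((m : ℝ) + 1)) ^ (1 / 16 : ℝ) := by
            gcongr; linarith [(Nat.cast_nonneg m : (0 : ℝ) ≤ m)]
        _ = 4 ^ (1 / 16 : ℝ) * ((m : ℝ) + 1) ^ (1 / 16 : ℝ) := by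
            rw [Real.mul_rpow (by norm_num) (by positivity)]
        _ ≤ 4 ^ (1 : ℝ) * ((m : ℝ) + 1) ^ (1 / 16 : ℝ) := by
            gcongr <;> norm_num
        _ = _ := by norm_num
    have hp1 : 0 < (2 * m + 1 : ℝ) ^ (1 / 16 : ℝ) := by positivity
    have hp2 : 0 < ((m : ℝ) + 1) ^ (1 / 16 : ℝ) := by positivity
    have hp3 : 0 < L ^ (1 / 8 : ℝ) := by positivity
    rw [h8]
    calc b ^ 2 * t ^ (1 / 16 : ℝ)
        ≤ 1 / (2 * m + 1) * (L ^ (1 / 8 : ℝ) / ((m : ℝ) + 1) ^ (1 / 16 : ℝ)) := by gcongr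
      _ = L ^ (1 / 8 : ℝ) * (1 / ((2 * m + 1) * ((m : ℝ) + 1) ^ (1 / 16 : ℝ))) := by
          field_simp
      _ ≤ L ^ (1 / 8 : ℝ) * (4 / ((2 * m + 1) * (2 * m + 1 : ℝ) ^ (1 / 16 : ℝ))) := by
          gcongr ?_ * ?_
          rw [div_le_div_iff₀ (by positivity) (by positivity)]
          have : (0 : ℝ) < 2 * m + 1 := by positivity
          nlinarith
      _ = _ := by ring
  · rw [srwProb_eq_zero_of_odd _ 0, srwProb_eq_zero_of_odd _ x, sub_zero]
    · positivity
    · push_cast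
      rw [Int.even_iff] at hx
      rw [Int.odd_iff]
      omega
    · simp

theorem summable_one_div_succ_rpow : Summable fun k : ℕ => 1 / ((k : ℝ) + 1) ^ (17 / 16 : ℝ) := by
  have := (summable_nat_add_iff 1).2
    (Real.summable_one_div_nat_rpow (p := 17 / 16) |>.2 (by norm_num))
  simpa using this

/-- The summation constant in the upper bound of the potential kernel. -/
noncomputable def potentialConst : ℝ := 4 * ∑' k : ℕ, 1 / ((k : ℝ) + 1) ^ (17 / 16 : ℝ)

theorem potentialConst_nonneg : 0 ≤ potentialConst :=
  mul_nonneg (by norm_num) (tsum_nonneg fun k => by positivity)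

theorem summable_of_even (x : Site) (hx : Even (x.1 + x.2)) :
    Summable fun k => srwProb k 0 - srwProb k x :=
  Summable.of_nonneg_of_le (fun k => srwProb_zero_sub_nonneg k x hx)
    (fun k => srwProb_zero_sub_le k x hx) (summable_one_div_succ_rpow.mul_left _)

/-- The neighbors of an odd site are even. -/
theorem even_or_nbr_even (x : Site) (hx : ¬ Even (x.1 + x.2)) :
    (Even ((x + (1, 0)).1 + (x + (1, 0)).2) ∧ Even ((x - (1, 0)).1 + (x - (1, 0)).2) ∧
    Even ((x + (0, 1)).1 + (x + (0, 1)).2) ∧ Even ((x - (0, 1)).1 + (x - (0, 1)).2)) ∧ x ≠ 0 := by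
  simp only [Prod.fst_add, Prod.snd_add, Prod.fst_sub, Prod.snd_sub]
  refine ⟨⟨?_, ?_, ?_, ?_⟩, ?_⟩
  on_goal 5 => rintro rfl; simp at hx
  all_goals
    rw [Int.even_iff] at hx ⊢
    omega

/-- Harmonicity transfers statements about even sites to odd sites. -/
theorem potentialSum_odd (n : ℕ) (x : Site) (hx : ¬ Even (x.1 + x.2)) :
    potentialSum n x = nbrAvg (potentialSum n) x + srwProb n x := by
  rw [nbrAvg_potentialSum]
  simp [srwProb, (even_or_nbr_even x hx).2]

theorem exists_tendsto_potentialSum (x : Site) :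
    ∃ c, Filter.Tendsto (fun n => potentialSum n x) Filter.atTop (nhds c) := by
  have key : ∀ x : Site, Even (x.1 + x.2) →
      ∃ c, Filter.Tendsto (fun n => potentialSum n x) Filter.atTop (nhds c) :=
    fun x hx => ⟨_, (summable_of_even x hx).hasSum.tendsto_sum_nat⟩
  by_cases hx : Even (x.1 + x.2)
  · exact key x hx
  · obtain ⟨⟨h1, h2, h3, h4⟩, -⟩ := even_or_nbr_even x hx
    obtain ⟨c1, h1⟩ := key _ h1
    obtain ⟨c2, h2⟩ := key _ h2
    obtain ⟨c3, h3⟩ := key _ h3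
    obtain ⟨c4, h4⟩ := key _ h4
    refine ⟨(c1 + c2 + c3 + c4) / 4 + 0, ?_⟩
    simp_rw [potentialSum_odd _ x hx, nbrAvg]
    exact ((((h1.add h2).add h3).add h4).div_const 4).add (tendsto_srwProb x)

/-- The series defining the potential kernel converges. -/
theorem tendsto_potentialSum (x : Site) :
    Filter.Tendsto (fun n => potentialSum n x) Filter.atTop (nhds (potentialKernel x)) := by
  obtain ⟨c, hc⟩ := exists_tendsto_potentialSum x
  have h : HasSum (fun k => srwProb k 0 - srwProb k x) c (SummationFilter.conditional ℕ) := by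
    rw [HasSum, SummationFilter.conditional_filter_eq_map_range, Filter.tendsto_map'_iff]
    exact hc
  rw [potentialKernel, h.tsum_eq]
  exact hc

/-- The potential kernel is harmonic except at the origin, where its Laplacian is one. -/
theorem nbrAvg_potentialKernel (x : Site) :
    nbrAvg potentialKernel x = potentialKernel x + if x = 0 then 1 else 0 := by
  have h1 : Filter.Tendsto (fun n => nbrAvg (potentialSum n) x) Filter.atTop
      (nhds (nbrAvg potentialKernel x)) := by
    simp only [nbrAvg]
    exact ((((tendsto_potentialSum _).add (tendsto_potentialSum _)).add
      (tendsto_potentialSum _)).add (tendsto_potentialSum _)).div_const 4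
  have h2 : Filter.Tendsto (fun n => potentialSum n x + srwProb 0 x - srwProb n x) Filter.atTop
      (nhds (potentialKernel x + srwProb 0 x - 0)) :=
    ((tendsto_potentialSum x).add tendsto_const_nhds).sub (tendsto_srwProb x)
  simp_rw [nbrAvg_potentialSum] at h1
  rw [tendsto_nhds_unique h1 h2, sub_zero]
  simp [srwProb]

@[simp]
theorem potentialKernel_zero : potentialKernel 0 = 0 := by
  refine tendsto_nhds_unique (tendsto_potentialSum 0) ?_
  simp [potentialSum]

theorem nbrAvg_potentialKernel_of_ne {x : Site} (hx : x ≠ 0) :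
    nbrAvg potentialKernel x = potentialKernel x := by
  rw [nbrAvg_potentialKernel, if_neg hx, add_zero]

theorem potentialKernel_even_ge (n : ℕ) (x : Site) (hx : Even (x.1 + x.2)) :
    potentialSum n x ≤ potentialKernel x := by
  have h := (summable_of_even x hx)
  have h2 := h.sum_le_tsum (Finset.range n) (fun k _ => srwProb_zero_sub_nonneg k x hx)
  rwa [tendsto_nhds_unique h.hasSum.tendsto_sum_nat (tendsto_potentialSum x)] at h2

theorem potentialKernel_even_le (x : Site) (hx : Even (x.1 + x.2)) :
    potentialKernel x ≤ potentialConst * (1 + |(x.1 : ℝ)| + |(x.2 : ℝ)|) ^ (1 / 8 : ℝ) := by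
  have h := (summable_of_even x hx)
  rw [← tendsto_nhds_unique h.hasSum.tendsto_sum_nat (tendsto_potentialSum x)]
  refine (h.tsum_le_tsum (fun k => srwProb_zero_sub_le k x hx)
    (summable_one_div_succ_rpow.mul_left _)).trans_eq ?_
  rw [tsum_mul_left, potentialConst]
  ring

/-- A polynomial upper bound of small degree for the potential kernel. -/
theorem potentialKernel_le (x : Site) :
    potentialKernel x ≤ potentialConst * (2 + |(x.1 : ℝ)| + |(x.2 : ℝ)|) ^ (1 / 8 : ℝ) := by
  have key : ∀ y : Site, Even (y.1 + y.2) → |(y.1 : ℝ)| + |(y.2 : ℝ)| ≤ |(x.1 : ℝ)| + |(x.2 : ℝ)| + 1 →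
      potentialKernel y ≤ potentialConst * (2 + |(x.1 : ℝ)| + |(x.2 : ℝ)|) ^ (1 / 8 : ℝ) := by
    intro y hy hxy
    refine (potentialKernel_even_le y hy).trans ?_
    have := potentialConst_nonneg
    exact mul_le_mul_of_nonneg_left
      (Real.rpow_le_rpow (by positivity) (by linarith) (by norm_num)) this
  by_cases hx : Even (x.1 + x.2)
  · exact key x hx (by linarith)
  · obtain ⟨⟨h1, h2, h3, h4⟩, h0⟩ := even_or_nbr_even x hx
    rw [← nbrAvg_potentialKernel_of_ne h0, nbrAvg]
    have h1 := key _ h1 (by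
      have := abs_add_le (x.1 : ℝ) 1
      simp at this ⊢; linarith)
    have h2 := key _ h2 (by
      have := abs_sub (x.1 : ℝ) 1
      simp at this ⊢; linarith)
    have h3 := key _ h3 (by
      have := abs_add_le (x.2 : ℝ) 1
      simp at this ⊢; linarith)
    have h4 := key _ h4 (by
      have := abs_sub (x.2 : ℝ) 1
      simp at this ⊢; linarith)
    linarith

theorem potentialKernel_even_pos (x : Site) (hx : Even (x.1 + x.2)) (h0 : x ≠ 0) :
    1 ≤ potentialKernel x := by
  refine le_trans ?_ (potentialKernel_even_ge 1 x hx)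
  simp [potentialSum, srwProb, h0]

theorem potentialKernel_even_nonneg (x : Site) (hx : Even (x.1 + x.2)) :
    0 ≤ potentialKernel x := by
  by_cases h0 : x = 0
  · simp [h0]
  · exact zero_le_one.trans (potentialKernel_even_pos x hx h0)

theorem potentialKernel_pos {x : Site} (h0 : x ≠ 0) : 0 < potentialKernel x := by
  by_cases hx : Even (x.1 + x.2)
  · exact zero_lt_one.trans_le (potentialKernel_even_pos x hx h0)
  · obtain ⟨⟨h1, h2, h3, h4⟩, h0⟩ := even_or_nbr_even x hx
    rw [← nbrAvg_potentialKernel_of_ne h0, nbrAvg]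
    have p1 := potentialKernel_even_nonneg _ h1
    have p2 := potentialKernel_even_nonneg _ h2
    have p3 := potentialKernel_even_nonneg _ h3
    have p4 := potentialKernel_even_nonneg _ h4
    -- At most one of two opposite neighbors is the origin.
    by_cases h : x + (1, 0) = 0
    · have h' : x - (1, 0) ≠ 0 := by
        intro h''
        simp only [Prod.ext_iff, Prod.fst_add, Prod.fst_sub, Prod.fst_zero] at h h''
        omega
      linarith [potentialKernel_even_pos _ h2 h']
    · linarith [potentialKernel_even_pos _ h1 h]

theorem potentialKernel_nonneg (x : Site) : 0 ≤ potentialKernel x := by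
  by_cases h0 : x = 0
  · simp [h0]
  · exact (potentialKernel_pos h0).le

/-- The potential kernel tends to infinity, by the divergence of the harmonic series. -/
theorem exists_lt_potentialKernel (r : ℝ) :
    ∃ M : ℤ, ∀ x : Site, M ≤ |x.1| + |x.2| → r < potentialKernel x := by
  have hdiv : Filter.Tendsto (fun n => ∑ m ∈ Finset.range n, (1 : ℝ) / 4 * (1 / ((m + 1 : ℕ) : ℝ)))
      Filter.atTop Filter.atTop := by
    simp_rw [← Finset.mul_sum]
    refine Filter.Tendsto.const_mul_atTop (by norm_num) ?_
    simpa using Real.tendsto_sum_range_one_div_nat_succ_atTop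
  obtain ⟨N, hN⟩ := (hdiv.eventually_gt_atTop r).exists
  -- The return probability at time `2 m` is at least `1 / (4 m)`.
  have hsum : ∀ n : ℕ, ∑ m ∈ Finset.range n, (1 : ℝ) / 4 * (1 / ((m + 1 : ℕ) : ℝ)) ≤
      ∑ k ∈ Finset.range (2 * n + 1), srwProb k 0 := by
    intro n
    induction n with
    | zero => simp [srwProb]
    | succ n ih =>
      rw [show 2 * (n + 1) + 1 = 2 * n + 1 + 1 + 1 by ring, Finset.sum_range_succ,
        Finset.sum_range_succ, Finset.sum_range_succ]
      have h1 := srwProb_nonneg (2 * n + 1) 0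
      have h2 : (1 : ℝ) / 4 * (1 / ((n + 1 : ℕ) : ℝ)) ≤ srwProb (2 * n + 1 + 1) 0 := by
        rw [show 2 * n + 1 + 1 = 2 * (n + 1) by ring, srwProb_zero_two_mul]
        have := le_binomMass_sq (n + 1) (by omega)
        rw [div_mul_div_comm, div_le_iff₀ (by positivity)]
        linarith
      linarith
  -- A site at distance more than `2 N` is not reached before time `2 N + 1`.
  have key : ∀ x : Site, Even (x.1 + x.2) → 2 * (N : ℤ) + 1 ≤ |x.1| + |x.2| →
      r < potentialKernel x := by
    intro x hx hN'
    refine (hN.trans_le (hsum N)).trans_le (le_trans (le_of_eq ?_)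
      (potentialKernel_even_ge (2 * N + 1) x hx))
    refine Finset.sum_congr rfl fun k hk => ?_
    rw [Finset.mem_range] at hk
    rw [srwProb_eq_zero_of_lt k x (by omega), sub_zero]
  refine ⟨2 * N + 2, fun x hN' => ?_⟩
  by_cases hx : Even (x.1 + x.2)
  · exact key x hx (by omega)
  · obtain ⟨⟨h1, h2, h3, h4⟩, h0⟩ := even_or_nbr_even x hx
    rw [← nbrAvg_potentialKernel_of_ne h0, nbrAvg]
    simp only [Int.abs_eq_natAbs] at hN' key
    have h1 := key _ h1 (by simp only [Prod.fst_add, Prod.snd_add]; omega)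
    have h2 := key _ h2 (by simp only [Prod.fst_sub, Prod.snd_sub]; omega)
    have h3 := key _ h3 (by simp only [Prod.fst_add, Prod.snd_add]; omega)
    have h4 := key _ h4 (by simp only [Prod.fst_sub, Prod.snd_sub]; omega)
    linarith

theorem finite_potentialKernel_le (r : ℝ) : {x : Site | potentialKernel x ≤ r}.Finite := by
  obtain ⟨M, hM⟩ := exists_lt_potentialKernel r
  refine ((Set.finite_Icc (-M) M).prod (Set.finite_Icc (-M) M)).subset fun x hx => ?_
  have h : |x.1| + |x.2| < M := by
    by_contra h
    exact absurd (hM x (not_lt.1 h)) (not_lt.2 hx)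
  simp only [Int.abs_eq_natAbs] at h
  simp only [mem_prod, mem_Icc]
  omega

/-! ### Liouville theorem for harmonic functions of slow growth -/

/-- The variance of one-dimensional simple random walk. -/
theorem sum_choose_mul_sq (n : ℕ) :
    ∑ k ∈ Finset.range (n + 1), (n.choose k : ℝ) * (2 * (k : ℝ) - n) ^ 2 = (n : ℝ) * 2 ^ n := by
  induction n with
  | zero => simp
  | succ n ih =>
    have h2 : ∑ k ∈ Finset.range (n + 1), (n.choose k : ℝ) = 2 ^ n := by
      exact_mod_cast Nat.sum_range_choose n
    rw [sum_choose_succ_mul_real n (fun k => (2 * (k : ℝ) - (n + 1 : ℕ)) ^ 2)]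
    have : ∀ k ∈ Finset.range (n + 1), (n.choose k : ℝ) * ((2 * (k : ℝ) - (n + 1 : ℕ)) ^ 2 +
        (2 * ((k + 1 : ℕ) : ℝ) - (n + 1 : ℕ)) ^ 2) =
        2 * ((n.choose k : ℝ) * (2 * k - n) ^ 2) + 2 * (n.choose k : ℝ) := by
      intro k _
      push_cast
      ring
    rw [Finset.sum_congr rfl this, Finset.sum_add_distrib, ← Finset.mul_sum, ← Finset.mul_sum, ih,
      h2]
    push_cast
    ring

/-- Summation by parts: the increments of the binomial weights of order `n` are multiples of the
binomial weights of order `n + 1`. -/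
theorem succ_mul_sum_choose_mul_sub (n : ℕ) (g : ℕ → ℝ) :
    (n + 1) * ∑ k ∈ Finset.range (n + 1), (n.choose k : ℝ) * (g (k + 1) - g k) =
      ∑ k ∈ Finset.range (n + 2), ((n + 1).choose k : ℝ) * (2 * k - (n + 1 : ℕ)) * g k := by
  have h1 : ∑ k ∈ Finset.range (n + 2), ((n + 1).choose k : ℝ) * k * g k =
      ∑ k ∈ Finset.range (n + 1), (n + 1) * ((n.choose k : ℝ) * g (k + 1)) := by
    rw [Finset.sum_range_succ']
    simp only [Nat.cast_zero, mul_zero, zero_mul, add_zero]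
    refine Finset.sum_congr rfl fun k _ => ?_
    have : ((n + 1) * (n.choose k) : ℝ) = (n + 1).choose (k + 1) * ((k + 1 : ℕ) : ℝ) := by
      exact_mod_cast Nat.add_one_mul_choose_eq n k
    rw [← mul_assoc, this]
  have h2 : ∑ k ∈ Finset.range (n + 2), ((n + 1).choose k : ℝ) * ((n + 1 : ℕ) - k) * g k =
      ∑ k ∈ Finset.range (n + 1), (n + 1) * ((n.choose k : ℝ) * g k) := by
    rw [Finset.sum_range_succ]
    simp only [sub_self, mul_zero, zero_mul, add_zero]
    refine Finset.sum_congr rfl fun k hk => ?_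
    rw [Finset.mem_range] at hk
    have h := Nat.choose_mul_succ_eq n k
    have : ((n.choose k) * (n + 1 : ℕ) : ℝ) = (n + 1).choose k * ((n + 1 - k : ℕ) : ℝ) := by
      exact_mod_cast h
    rw [Nat.cast_sub (by omega)] at this
    rw [← this]
    push_cast
    ring
  rw [Finset.mul_sum]
  calc ∑ k ∈ Finset.range (n + 1), ((n : ℝ) + 1) * ((n.choose k : ℝ) * (g (k + 1) - g k))
      = ∑ k ∈ Finset.range (n + 1), ((n : ℝ) + 1) * ((n.choose k : ℝ) * g (k + 1)) -
        ∑ k ∈ Finset.range (n + 1), ((n : ℝ) + 1) * ((n.choose k : ℝ) * g k) := by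
        rw [← Finset.sum_sub_distrib]
        exact Finset.sum_congr rfl fun k _ => by ring
    _ = _ := by
        rw [← h1, ← h2, ← Finset.sum_sub_distrib]
        exact Finset.sum_congr rfl fun k _ => by ring

/-- The binomial distribution and its translate by one step are at distance `O(n ^ (-1 / 2))` in
total variation. -/
theorem abs_sum_choose_mul_sub_le (n : ℕ) (g : ℕ → ℝ) (B : ℝ) (hB : ∀ k ≤ n + 1, |g k| ≤ B) :
    |∑ k ∈ Finset.range (n + 1), (n.choose k : ℝ) * (g (k + 1) - g k)| ≤
      B * 2 ^ (n + 1) / Real.sqrt (n + 1) := by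
  have hB0 : 0 ≤ B := (abs_nonneg _).trans (hB 0 (by omega))
  set S := ∑ k ∈ Finset.range (n + 2), ((n + 1).choose k : ℝ) * |2 * k - ((n + 1 : ℕ) : ℝ)| with hS
  have hS0 : 0 ≤ S := Finset.sum_nonneg fun k _ => by positivity
  -- The Cauchy-Schwarz inequality bounds the first absolute moment by the variance.
  have hS2 : S ^ 2 ≤ (n + 1) * (2 ^ (n + 1)) ^ 2 := by
    have h := Finset.sum_mul_sq_le_sq_mul_sq (Finset.range (n + 2))
      (fun k => Real.sqrt ((n + 1).choose k))
      (fun k => Real.sqrt ((n + 1).choose k) * |2 * k - ((n + 1 : ℕ) : ℝ)|)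
    have e1 : ∑ k ∈ Finset.range (n + 2), Real.sqrt ((n + 1).choose k : ℝ) ^ 2 = 2 ^ (n + 1) := by
      simp_rw [Real.sq_sqrt (Nat.cast_nonneg _)]
      exact_mod_cast Nat.sum_range_choose (n + 1)
    have e2 : ∑ k ∈ Finset.range (n + 2),
        (Real.sqrt ((n + 1).choose k : ℝ) * |2 * k - ((n + 1 : ℕ) : ℝ)|) ^ 2 =
        (n + 1) * 2 ^ (n + 1) := by
      simp_rw [mul_pow, Real.sq_sqrt (Nat.cast_nonneg _), sq_abs]
      rw [sum_choose_mul_sq (n + 1)]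
      push_cast
      ring
    have e0 : ∑ k ∈ Finset.range (n + 2), Real.sqrt ((n + 1).choose k : ℝ) *
        (Real.sqrt ((n + 1).choose k : ℝ) * |2 * k - ((n + 1 : ℕ) : ℝ)|) = S := by
      refine Finset.sum_congr rfl fun k _ => ?_
      rw [← mul_assoc, Real.mul_self_sqrt (Nat.cast_nonneg _)]
    rw [e0, e1, e2] at h
    refine h.trans_eq ?_
    ring
  have hle : |(n + 1) * ∑ k ∈ Finset.range (n + 1), (n.choose k : ℝ) * (g (k + 1) - g k)| ≤
      B * S := by
    rw [succ_mul_sum_choose_mul_sub]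
    refine (Finset.abs_sum_le_sum_abs _ _).trans ?_
    rw [hS, Finset.mul_sum]
    refine Finset.sum_le_sum fun k hk => ?_
    rw [Finset.mem_range] at hk
    rw [abs_mul, abs_mul, Nat.abs_cast, mul_comm]
    exact mul_le_mul_of_nonneg_right (hB k (by omega)) (by positivity)
  have hS3 : S ≤ Real.sqrt (n + 1) * 2 ^ (n + 1) := by
    refine abs_le_of_sq_le_sq' ?_ (by positivity) |>.2
    rw [mul_pow, Real.sq_sqrt (by positivity)]
    exact hS2
  rw [abs_mul, abs_of_nonneg (by positivity : (0 : ℝ) ≤ n + 1)] at hle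
  have hs : Real.sqrt (n + 1) * Real.sqrt (n + 1) = n + 1 := Real.mul_self_sqrt (by positivity)
  have hsp : 0 < Real.sqrt (n + 1) := Real.sqrt_pos.2 (by positivity)
  rw [le_div_iff₀ hsp]
  have h3 := mul_le_mul_of_nonneg_left hS3 hB0
  have h4 : Real.sqrt (n + 1) * (Real.sqrt (n + 1) *
      |∑ k ∈ Finset.range (n + 1), (n.choose k : ℝ) * (g (k + 1) - g k)|) ≤
      Real.sqrt (n + 1) * (B * 2 ^ (n + 1)) := by
    rw [← mul_assoc, hs]
    linarith
  have := le_of_mul_le_mul_left h4 hsp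
  linarith

/-- A harmonic function of growth exponent `1 / 8` is invariant under the diagonal translation:
after `n` steps, the laws of the walk started at two diagonal neighbors are at distance `O(n ^ (-1 /
2))`, while the function is `O(n ^ (1 / 8))` on their supports. -/
theorem harmonic_diagonal_eq (h : Site → ℝ) (hh : nbrAvg h = h) (K : ℝ)
    (hK : ∀ x, |h x| ≤ K * (2 + |(x.1 : ℝ)| + |(x.2 : ℝ)|) ^ (1 / 8 : ℝ)) (x : Site) :
    h (x + (1, 1)) = h x := by
  have hK0 : 0 ≤ K := by
    have := (abs_nonneg _).trans (hK 0)
    simp only [Prod.fst_zero, Prod.snd_zero, Int.cast_zero, abs_zero, add_zero] at this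
    exact nonneg_of_mul_nonneg_left this (by positivity)
  have hit : ∀ n : ℕ, nbrAvg^[n] h = h := fun n => Function.iterate_fixed hh n
  set c : ℝ := 4 + |(x.1 : ℝ)| + |(x.2 : ℝ)| with hc
  have hbound : ∀ n : ℕ, |h (x + (1, 1)) - h x| ≤
      2 * K * c ^ (1 / 8 : ℝ) * ((n : ℝ) + 1) ^ (-(3 / 8) : ℝ) := by
    intro n
    set F : ℕ → ℕ → ℝ := fun k l => h (x.1 + k + l - n, x.2 + k - l) with hF
    set g : ℕ → ℝ := fun k => ∑ l ∈ Finset.range (n + 1), (n.choose l : ℝ) * F k l with hg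
    set B : ℝ := K * (c * (n + 1)) ^ (1 / 8 : ℝ) with hB
    have hFB : ∀ k ≤ n + 1, ∀ l ≤ n, |F k l| ≤ B := by
      intro k hk l hl
      refine (hK _).trans ?_
      rw [hB]
      refine mul_le_mul_of_nonneg_left (Real.rpow_le_rpow (by positivity) ?_ (by norm_num)) hK0
      have hk' : (k : ℝ) ≤ n + 1 := by exact_mod_cast hk
      have hl' : (l : ℝ) ≤ n := by exact_mod_cast hl
      have h0 : (0 : ℝ) ≤ k := Nat.cast_nonneg k
      have h1 : (0 : ℝ) ≤ l := Nat.cast_nonneg l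
      have h2 : (0 : ℝ) ≤ n := Nat.cast_nonneg n
      have e1 : |(x.1 : ℝ) + k + l - n| ≤ |(x.1 : ℝ)| + (n + 1) := by
        rw [show (x.1 : ℝ) + k + l - n = x.1 + (k + l - n) by ring]
        refine (abs_add_le _ _).trans (add_le_add_right (abs_le.2 ⟨?_, ?_⟩) _) <;> linarith
      have e2 : |(x.2 : ℝ) + k - l| ≤ |(x.2 : ℝ)| + (n + 1) := by
        rw [show (x.2 : ℝ) + k - l = x.2 + (k - l) by ring]
        refine (abs_add_le _ _).trans (add_le_add_right (abs_le.2 ⟨?_, ?_⟩) _) <;> linarith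
      push_cast
      rw [hc]
      nlinarith [abs_nonneg (x.1 : ℝ), abs_nonneg (x.2 : ℝ)]
    have hgB : ∀ k ≤ n + 1, |g k| ≤ 2 ^ n * B := by
      intro k hk
      rw [hg]
      refine (Finset.abs_sum_le_sum_abs _ _).trans ?_
      have : (2 : ℝ) ^ n = ∑ l ∈ Finset.range (n + 1), (n.choose l : ℝ) := by
        exact_mod_cast (Nat.sum_range_choose n).symm
      rw [this, Finset.sum_mul]
      refine Finset.sum_le_sum fun l hl => ?_
      rw [Finset.mem_range] at hl
      rw [abs_mul, Nat.abs_cast]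
      exact mul_le_mul_of_nonneg_left (hFB k hk l (by omega)) (by positivity)
    have e1 : h x = (∑ k ∈ Finset.range (n + 1), (n.choose k : ℝ) * g k) / 4 ^ n := by
      conv_lhs => rw [← hit n, nbrAvg_iterate]
    have e2 : h (x + (1, 1)) = (∑ k ∈ Finset.range (n + 1), (n.choose k : ℝ) * g (k + 1)) / 4 ^ n := by
      conv_lhs => rw [← hit n, nbrAvg_iterate]
      simp only [hg, hF, Prod.fst_add, Prod.snd_add]
      congr 1
      refine Finset.sum_congr rfl fun k _ => ?_
      congr 1
      refine Finset.sum_congr rfl fun l _ => ?_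
      congr 2
      ext <;> simp <;> ring
    have e3 : h (x + (1, 1)) - h x =
        (∑ k ∈ Finset.range (n + 1), (n.choose k : ℝ) * (g (k + 1) - g k)) / 4 ^ n := by
      rw [e1, e2, ← sub_div, ← Finset.sum_sub_distrib]
      simp_rw [mul_sub]
    rw [e3, abs_div, abs_of_pos (by positivity : (0 : ℝ) < 4 ^ n), div_le_iff₀ (by positivity)]
    refine (abs_sum_choose_mul_sub_le n g _ hgB).trans_eq ?_
    have hn : (0 : ℝ) < n + 1 := by positivity
    rw [hB, Real.mul_rpow (by positivity) hn.le, Real.sqrt_eq_rpow, pow_succ,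
      show (-(3 / 8) : ℝ) = 1 / 8 - 1 / 2 by norm_num, Real.rpow_sub hn,
      show (4 : ℝ) ^ n = 2 ^ n * 2 ^ n by rw [← mul_pow]; norm_num]
    ring
  have hlim : Filter.Tendsto (fun n : ℕ => 2 * K * c ^ (1 / 8 : ℝ) * ((n : ℝ) + 1) ^ (-(3 / 8) : ℝ))
      Filter.atTop (nhds (2 * K * c ^ (1 / 8 : ℝ) * 0)) := by
    refine Filter.Tendsto.const_mul _ ?_
    exact (tendsto_rpow_neg_atTop (by norm_num)).comp
      (Filter.tendsto_atTop_add_const_right _ _ tendsto_natCast_atTop_atTop)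
  rw [mul_zero] at hlim
  have := ge_of_tendsto' hlim hbound
  exact sub_eq_zero.1 (abs_nonpos_iff.1 this)

/-- Liouville theorem: a harmonic function of slow growth that vanishes at the origin is zero, since
it is invariant under both diagonal translations. -/
theorem eq_zero_of_harmonic (h : Site → ℝ) (hh : nbrAvg h = h) (K : ℝ)
    (hK : ∀ x, |h x| ≤ K * (2 + |(x.1 : ℝ)| + |(x.2 : ℝ)|) ^ (1 / 8 : ℝ)) (h0 : h 0 = 0)
    (x : Site) : h x = 0 := by
  have hd1 := harmonic_diagonal_eq h hh K hK
  have hd2 : ∀ x : Site, h (x + (1, -1)) = h x := by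
    -- Reflect in the horizontal axis.
    have := harmonic_diagonal_eq (fun x => h (x.1, -x.2)) (by
      funext x
      conv_rhs => rw [← hh]
      simp only [nbrAvg, Prod.fst_add, Prod.snd_add, Prod.fst_sub, Prod.snd_sub, Prod.mk_add_mk,
        Prod.mk_sub_mk]
      rw [show -(x.2 + 1) = -x.2 - 1 by ring, show -(x.2 - 1) = -x.2 + 1 by ring]
      simp only [add_zero, sub_zero]
      ring) K (fun x => by simpa using hK (x.1, -x.2))
    intro x
    have h1 := this (x.1, -x.2)
    simp only [Prod.mk_add_mk, neg_neg, neg_add] at h1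
    exact h1
  have hx1 : ∀ x : Site, h (x + (1, 0)) = h x := by
    intro x
    have h1 := congrFun hh x
    rw [nbrAvg, ← hd1 (x - (1, 0)), ← hd2 (x - (1, 0) + (1, 1)), ← hd2 (x + (0, 1)),
      ← hd1 (x - (0, 1))] at h1
    have e1 : x - (1, 0) + (1, 1) + (1, -1) = x + (1, 0) := by
      ext <;> simp
    have e2 : x + (0, 1) + (1, -1) = x + (1, 0) := by
      ext <;> simp
    have e3 : x - (0, 1) + (1, 1) = x + (1, 0) := by
      ext <;> simp
    rw [e1, e2, e3] at h1
    linarith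
  have hx2 : ∀ x : Site, h (x + (0, 1)) = h x := by
    intro x
    rw [← hx1 x, ← hd2 (x + (0, 1))]
    congr 1
    ext <;> simp
  have hc : ∀ (m n : ℤ), h (m, n) = 0 := by
    intro m n
    have h1 : ∀ m : ℤ, h (m, 0) = 0 := by
      intro m
      induction m using Int.induction_on with
      | zero => exact h0
      | succ i ih => rw [← ih, ← hx1 (i, 0)]; simp
      | pred i ih => rw [← ih, ← hx1 (-i - 1, 0)]; simp
    induction n using Int.induction_on with
    | zero => exact h1 m
    | succ i ih => rw [← ih, ← hx2 (m, i)]; simp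
    | pred i ih => rw [← ih, ← hx2 (m, -i - 1)]; simp
  exact hc x.1 x.2

/-- Bounded harmonic functions of the conditioned walk are constant: multiplied by the potential
kernel, such a function becomes harmonic off the origin, and subtracting a multiple of the
potential kernel makes it harmonic everywhere. -/
theorem exists_const_of_condHarmonic (u : Site → ℝ) (K : ℝ) (hu : ∀ x, |u x| ≤ K)
    (hharm : ∀ x, x ≠ 0 → nbrAvg (fun y => potentialKernel y * u y) x = potentialKernel x * u x) :
    ∃ c, ∀ x, x ≠ 0 → u x = c := by
  set H : Site → ℝ := fun y => potentialKernel y * u y with hH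
  set κ := nbrAvg H 0 with hκ
  refine ⟨κ, fun x hx => ?_⟩
  have hlin : ∀ x, nbrAvg (fun y => H y - κ * potentialKernel y) x =
      nbrAvg H x - κ * nbrAvg potentialKernel x := by
    intro x; simp only [nbrAvg]; ring
  have key := eq_zero_of_harmonic (fun y => H y - κ * potentialKernel y) (by
    funext y
    rw [hlin, nbrAvg_potentialKernel]
    by_cases hy : y = 0
    · subst hy
      rw [← hκ]
      simp [hH]
    · rw [hharm y hy, if_neg hy, add_zero]) ((K + |κ|) * potentialConst) (by
    intro y
    have h1 := potentialKernel_le y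
    have h2 := potentialKernel_nonneg y
    have hK0 : 0 ≤ K := (abs_nonneg _).trans (hu 0)
    calc |H y - κ * potentialKernel y| ≤ |H y| + |κ * potentialKernel y| := abs_sub _ _
      _ = potentialKernel y * |u y| + |κ| * potentialKernel y := by
          rw [hH, abs_mul, abs_mul, abs_of_nonneg h2]
      _ ≤ (K + |κ|) * potentialKernel y := by nlinarith [hu y]
      _ ≤ _ := by rw [mul_assoc]; exact mul_le_mul_of_nonneg_left h1 (by positivity)) (by
    simp [hH]) x
  have hp := potentialKernel_pos hx
  simp only [hH] at key
  have : potentialKernel x * (u x - κ) = 0 := by linarith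
  rcases mul_eq_zero.1 this with h | h
  · exact absurd h hp.ne'
  · linarith

/-! ### One step of the conditioned walk -/

theorem Adj.symm {x y : Site} (h : Adj x y) : Adj y x := by
  unfold Adj at *
  rw [abs_sub_comm y.1, abs_sub_comm y.2, h]

theorem adj_iff {x y : Site} :
    Adj x y ↔ y = x + (1, 0) ∨ y = x - (1, 0) ∨ y = x + (0, 1) ∨ y = x - (0, 1) := by
  simp only [Adj, Int.abs_eq_natAbs, Prod.ext_iff, Prod.fst_add, Prod.snd_add, Prod.fst_sub,
    Prod.snd_sub]
  omega

/-- The four neighbors of a site. -/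
def nbrs (x : Site) : Finset Site := {x + (1, 0), x - (1, 0), x + (0, 1), x - (0, 1)}

theorem mem_nbrs {x y : Site} : y ∈ nbrs x ↔ Adj x y := by
  simp [nbrs, adj_iff]

theorem sum_nbrs {M : Type*} [AddCommMonoid M] (x : Site) (f : Site → M) :
    ∑ y ∈ nbrs x, f y = f (x + (1, 0)) + f (x - (1, 0)) + f (x + (0, 1)) + f (x - (0, 1)) := by
  have h1 : x + (1, 0) ∉ ({x - (1, 0), x + (0, 1), x - (0, 1)} : Finset Site) := by
    simp only [Finset.mem_insert, Finset.mem_singleton, Prod.ext_iff, Prod.fst_add, Prod.snd_add,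
      Prod.fst_sub, Prod.snd_sub]
    omega
  have h2 : x - (1, 0) ∉ ({x + (0, 1), x - (0, 1)} : Finset Site) := by
    simp only [Finset.mem_insert, Finset.mem_singleton, Prod.ext_iff, Prod.fst_add, Prod.snd_add,
      Prod.fst_sub, Prod.snd_sub]
    omega
  have h3 : x + (0, 1) ∉ ({x - (0, 1)} : Finset Site) := by
    simp only [Finset.mem_singleton, Prod.ext_iff, Prod.fst_add, Prod.snd_add,
      Prod.fst_sub, Prod.snd_sub]
    omega
  rw [nbrs, Finset.sum_insert h1, Finset.sum_insert h2, Finset.sum_insert h3,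
    Finset.sum_singleton, add_assoc, add_assoc]

theorem nbrAvg_eq_sum (f : Site → ℝ) (x : Site) : nbrAvg f x = (∑ y ∈ nbrs x, f y) / 4 := by
  rw [sum_nbrs, nbrAvg]

theorem hasSum_condWeight {x : Site} (hx : x ≠ 0) : HasSum (condWeight x) 1 := by
  have h1 : ∑ y ∈ nbrs x, condWeight x y = 1 := by
    have h2 : ∀ y ∈ nbrs x, condWeight x y =
        ENNReal.ofReal (potentialKernel y / (4 * potentialKernel x)) := fun y hy => by
      rw [condWeight, if_pos (mem_nbrs.1 hy)]
    rw [Finset.sum_congr rfl h2, ← ENNReal.ofReal_sum_of_nonneg, ← Finset.sum_div,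
      ENNReal.ofReal_eq_one]
    · have h3 := nbrAvg_potentialKernel_of_ne hx
      rw [nbrAvg_eq_sum] at h3
      have := potentialKernel_pos hx
      rw [div_eq_one_iff_eq (by positivity)]
      linarith
    · intro y _
      have := potentialKernel_nonneg y
      have := potentialKernel_nonneg x
      positivity
  rw [← h1]
  refine hasSum_sum_of_ne_finset_zero fun y hy => ?_
  rw [condWeight, if_neg (mt mem_nbrs.2 hy)]

theorem condStep_of_ne {x : Site} (hx : x ≠ 0) (y : Site) :
    condStep x y = if Adj x y then
      ENNReal.ofReal (potentialKernel y / (4 * potentialKernel x)) else 0 := by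
  have h : condStep x = ⟨condWeight x, hasSum_condWeight hx⟩ := dif_pos (hasSum_condWeight hx)
  rw [h]
  rfl

theorem condStep_ne_zero {x y : Site} (hx : x ≠ 0) (h : condStep x y ≠ 0) : Adj x y ∧ y ≠ 0 := by
  rw [condStep_of_ne hx] at h
  split_ifs at h with h1
  · refine ⟨h1, ?_⟩
    rintro rfl
    simp at h
  · exact absurd rfl h

theorem condStep_pos {x y : Site} (hx : x ≠ 0) (hy : y ≠ 0) (h : Adj x y) : 0 < condStep x y := by
  rw [condStep_of_ne hx, if_pos h, ENNReal.ofReal_pos]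
  have := potentialKernel_pos hx
  have := potentialKernel_pos hy
  positivity

/-- The origin is never reached. -/
theorem condStep_to_zero {x : Site} (hx : x ≠ 0) : condStep x 0 = 0 := by
  by_contra h
  exact (condStep_ne_zero hx h).2 rfl

/-- The conditioned walk is reversible with respect to the squared potential kernel. -/
theorem condStep_reversible (x y : Site) :
    ENNReal.ofReal (potentialKernel x ^ 2) * condStep x y =
      ENNReal.ofReal (potentialKernel y ^ 2) * condStep y x := by
  by_cases hx : x = 0
  · subst hx
    by_cases hy : y = 0
    · rw [hy]
    · simp [condStep_to_zero hy]
  by_cases hy : y = 0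
  · subst hy
    simp [condStep_to_zero hx]
  rw [condStep_of_ne hx, condStep_of_ne hy]
  by_cases h : Adj x y
  · rw [if_pos h, if_pos h.symm, ← ENNReal.ofReal_mul (by positivity),
      ← ENNReal.ofReal_mul (by positivity)]
    have := potentialKernel_pos hx
    have := potentialKernel_pos hy
    congr 1
    field_simp
  · rw [if_neg h, if_neg (mt Adj.symm h), mul_zero, mul_zero]

theorem tsum_condStep_mul {x : Site} (hx : x ≠ 0) (f : Site → ℝ≥0∞) :
    ∑' y, condStep x y * f y = ∑ y ∈ nbrs x, condStep x y * f y := by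
  refine tsum_eq_sum fun y hy => ?_
  have : condStep x y = 0 := by
    by_contra h
    exact hy (mem_nbrs.2 (condStep_ne_zero hx h).1)
  rw [this, zero_mul]

/-! ### Cylinder probabilities and the Markov property -/

/-- Paths that agree with `s` up to time `n`. -/
def cyl (s : ℕ → Site) (n : ℕ) : Set (ℕ → Site) := {f | ∀ i ≤ n, f i = s i}

theorem cyl_eq_preimage (s : ℕ → Site) (n : ℕ) :
    cyl s n = Preorder.frestrictLe (π := fun _ => Site) n ⁻¹'
      {Preorder.frestrictLe (π := fun _ => Site) n s} := by
  ext f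
  simp only [cyl, mem_ofPred_eq, mem_preimage, mem_singleton_iff, funext_iff, Subtype.forall,
    Finset.mem_Iic, Preorder.frestrictLe_apply]

theorem measurableSet_cyl (s : ℕ → Site) (n : ℕ) : MeasurableSet (cyl s n) := by
  rw [cyl_eq_preimage]
  exact measurableSet_preimage (Preorder.measurable_frestrictLe n) (measurableSet_singleton _)

instance (x : Site) : IsProbabilityMeasure (condWalk x) :=
  inferInstanceAs (IsProbabilityMeasure (Kernel.traj _ _ _))

theorem condWalk_cyl_zero (x : Site) (s : ℕ → Site) :
    condWalk x (cyl s 0) = if s 0 = x then 1 else 0 := by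
  rw [cyl_eq_preimage, ← Measure.map_apply (Preorder.measurable_frestrictLe 0)
    (measurableSet_singleton _), condWalk, Kernel.traj_map_frestrictLe_apply,
    Kernel.partialTraj_self, Kernel.id_apply, Measure.dirac_apply]
  simp only [indicator, mem_singleton_iff, funext_iff, Subtype.forall,
    Finset.mem_Iic, Preorder.frestrictLe_apply, Pi.one_apply, nonpos_iff_eq_zero, forall_eq,
    eq_comm]

theorem condWalk_cyl_succ (x : Site) (s : ℕ → Site) (n : ℕ) :
    condWalk x (cyl s (n + 1)) = condWalk x (cyl s n) * condStep (s n) (s (n + 1)) := by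
  have h := Kernel.partialTraj_compProd_eq_map_traj (X := fun _ => Site) (κ := condHistoryKernel)
    (Nat.zero_le n) (x₀ := fun _ => x)
  have h2 := congrArg (fun μ => μ ({Preorder.frestrictLe (π := fun _ => Site) n s} ×ˢ
    {s (n + 1)})) h
  rw [Measure.map_apply (by fun_prop) ((measurableSet_singleton _).prod (measurableSet_singleton _)),
    Measure.compProd_apply_prod (measurableSet_singleton _) (measurableSet_singleton _),
    lintegral_singleton, ← Kernel.traj_map_frestrictLe_apply,
    Measure.map_apply (by fun_prop) (measurableSet_singleton _), ← cyl_eq_preimage] at h2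
  have e1 : condHistoryKernel n (Preorder.frestrictLe (π := fun _ => Site) n s) {s (n + 1)} =
      condStep (s n) (s (n + 1)) := by
    change (condStep (s n)).toMeasure {s (n + 1)} = _
    rw [PMF.toMeasure_apply_singleton _ _ (measurableSet_singleton _)]
  have e2 : cyl s (n + 1) = (fun f : ℕ → Site => (Preorder.frestrictLe (π := fun _ => Site) n f,
      f (n + 1))) ⁻¹' ({Preorder.frestrictLe (π := fun _ => Site) n s} ×ˢ {s (n + 1)}) := by
    rw [mk_preimage_prod, ← cyl_eq_preimage]
    ext f
    simp only [cyl, mem_ofPred_eq, mem_inter_iff, mem_preimage, mem_singleton_iff]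
    constructor
    · exact fun h => ⟨fun i hi => h i (by omega), h _ le_rfl⟩
    · rintro ⟨h1, h2⟩ i hi
      rcases Nat.le_succ_iff.1 hi with h | rfl
      · exact h1 i h
      · exact h2
  rw [e2]
  exact h2.symm.trans (by rw [e1, mul_comm]; rfl)

/-- Finite measures on path space that agree on cylinders are equal. -/
theorem ext_of_cyl {μ ν : Measure (ℕ → Site)} [IsFiniteMeasure μ] [IsFiniteMeasure ν]
    (h : ∀ s n, μ (cyl s n) = ν (cyl s n)) : μ = ν := by
  have hn : ∀ n, μ.map (Preorder.frestrictLe (π := fun _ => Site) n) =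
      ν.map (Preorder.frestrictLe (π := fun _ => Site) n) := by
    intro n
    refine Measure.ext_of_singleton fun r => ?_
    obtain ⟨s, rfl⟩ : ∃ s : ℕ → Site, Preorder.frestrictLe (π := fun _ => Site) n s = r :=
      ⟨fun i => if hi : i ≤ n then r ⟨i, Finset.mem_Iic.2 hi⟩ else 0, by
        ext i
        · simp [Finset.mem_Iic.1 i.2]
        · simp [Finset.mem_Iic.1 i.2]⟩
    rw [Measure.map_apply (by fun_prop) (measurableSet_singleton _),
      Measure.map_apply (by fun_prop) (measurableSet_singleton _), ← cyl_eq_preimage, h]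
  have hproj : IsProjectiveMeasureFamily (α := fun _ : ℕ => Site)
      (fun J : Finset ℕ => ν.map J.restrict) := isProjectiveMeasureFamily_map_restrict
        (fun i => (measurable_pi_apply i).aemeasurable)
  have h1 : IsProjectiveLimit μ (fun J : Finset ℕ => ν.map J.restrict) :=
    (isProjectiveLimit_nat_iff hproj μ).2 hn
  have h2 : IsProjectiveLimit ν (fun J : Finset ℕ => ν.map J.restrict) := fun J => rfl
  exact h1.unique h2

/-- The path that starts at `x` and continues with `f`. -/
def consPath (x : Site) (f : ℕ → Site) : ℕ → Site
  | 0 => x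
  | n + 1 => f n

@[simp] theorem consPath_zero (x : Site) (f : ℕ → Site) : consPath x f 0 = x := rfl

@[simp] theorem consPath_succ (x : Site) (f : ℕ → Site) (n : ℕ) :
    consPath x f (n + 1) = f n := rfl

@[fun_prop]
theorem measurable_consPath (x : Site) : Measurable (consPath x) := by
  refine measurable_pi_lambda _ fun n => ?_
  cases n with
  | zero => exact measurable_const
  | succ n => exact measurable_pi_apply n

theorem consPath_preimage_cyl (x : Site) (s : ℕ → Site) (n : ℕ) :
    consPath x ⁻¹' cyl s (n + 1) = {f | s 0 = x ∧ f ∈ cyl (fun i => s (i + 1)) n} := by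
  ext f
  simp only [cyl, mem_preimage, mem_ofPred_eq]
  constructor
  · exact fun h => ⟨(h 0 (by omega)).symm, fun i hi => h (i + 1) (by omega)⟩
  · rintro ⟨h1, h2⟩ i hi
    cases i with
    | zero => exact h1.symm
    | succ i => exact h2 i (by omega)

/-- The Markov property at time one. -/
theorem condWalk_eq_sum (x : Site) :
    condWalk x = Measure.sum fun y => condStep x y • (condWalk y).map (consPath x) := by
  have hcyl : ∀ (n : ℕ) (x : Site) (s : ℕ → Site), condWalk x (cyl s (n + 1)) =
      if s 0 = x then condStep x (s 1) * condWalk (s 1) (cyl (fun i => s (i + 1)) n) else 0 := by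
    intro n
    induction n with
    | zero =>
      intro x s
      rw [condWalk_cyl_succ, condWalk_cyl_zero, condWalk_cyl_zero, if_pos rfl, mul_one]
      split_ifs with h <;> simp [h]
    | succ n ih =>
      intro x s
      rw [condWalk_cyl_succ, ih, condWalk_cyl_succ]
      split_ifs with h <;> simp [mul_assoc]
  have hs : ∀ B, MeasurableSet B →
      (Measure.sum fun y => condStep x y • (condWalk y).map (consPath x)) B =
      ∑' y, condStep x y * condWalk y (consPath x ⁻¹' B) := by
    intro B hB
    rw [Measure.sum_apply _ hB]
    refine tsum_congr fun y => ?_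
    rw [Measure.smul_apply, Measure.map_apply (by fun_prop) hB, smul_eq_mul]
  have : IsFiniteMeasure (Measure.sum fun y => condStep x y • (condWalk y).map (consPath x)) := by
    refine ⟨?_⟩
    rw [hs _ MeasurableSet.univ]
    simp
  refine ext_of_cyl fun s n => ?_
  rw [hs _ (measurableSet_cyl s n)]
  cases n with
  | zero =>
    rw [condWalk_cyl_zero]
    have : consPath x ⁻¹' cyl s 0 = if s 0 = x then univ else ∅ := by
      ext f
      split_ifs with h <;> simp [cyl, h, eq_comm]
    rw [this]
    split_ifs <;> simp
  | succ n =>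
    rw [hcyl, consPath_preimage_cyl]
    split_ifs with h
    · simp only [h, true_and, ofPred_mem_eq]
      rw [tsum_eq_single (s 1)]
      intro y hy
      have h0 : condWalk y (cyl (fun i => s (i + 1)) n) = 0 := by
        refine measure_mono_null (t := cyl (fun i => s (i + 1)) 0)
          (fun f hf i hi => hf i (by omega)) ?_
        rw [condWalk_cyl_zero, if_neg]
        exact fun h => hy h.symm
      rw [h0, mul_zero]
    · simp [h]

theorem condWalk_apply (x : Site) {B : Set (ℕ → Site)} (hB : MeasurableSet B) :
    condWalk x B = ∑' y, condStep x y * condWalk y (consPath x ⁻¹' B) := by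
  rw [condWalk_eq_sum, Measure.sum_apply _ hB]
  refine tsum_congr fun y => ?_
  rw [Measure.smul_apply, Measure.map_apply (by fun_prop) hB, smul_eq_mul]

theorem condWalk_start (x : Site) : ∀ᵐ f ∂condWalk x, f 0 = x := by
  have h := condWalk_cyl_zero x (fun _ => x)
  rw [if_pos rfl] at h
  have h2 : ∀ᵐ f ∂condWalk x, f ∈ cyl (fun _ => x) 0 := by
    rw [ae_iff]
    exact (prob_compl_eq_zero_iff (measurableSet_cyl _ _)).2 h
  filter_upwards [h2] with f hf using hf 0 le_rfl

/-! ### Connectivity of the punctured lattice -/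

/-- Adjacency in the punctured lattice. -/
def PAdj (x y : Site) : Prop := Adj x y ∧ x ≠ 0 ∧ y ≠ 0

theorem PAdj.symm {x y : Site} (h : PAdj x y) : PAdj y x := ⟨h.1.symm, h.2.2, h.2.1⟩

theorem pAdj_connected_aux (n : ℕ) (x : Site) (hx : x ≠ 0) (hn : x.1.natAbs + x.2.natAbs = n) :
    Relation.ReflTransGen PAdj x (1, 0) := by
  have hstep : ∀ {a b : ℤ × ℤ}, |a.1 - b.1| + |a.2 - b.2| = 1 → a ≠ 0 → b ≠ 0 →
      Relation.ReflTransGen PAdj b (1, 0) → Relation.ReflTransGen PAdj a (1, 0) :=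
    fun h1 h2 h3 h4 => Relation.ReflTransGen.head ⟨h1, h2, h3⟩ h4
  induction n generalizing x with
  | zero =>
    exact absurd (by simp only [Prod.ext_iff, Prod.fst_zero, Prod.snd_zero]; omega) hx
  | succ n ih =>
    obtain ⟨a, b⟩ := x
    simp only at hn
    rcases Nat.eq_zero_or_pos n with rfl | hpos
    · -- The four neighbors of the origin are joined through the corners of the unit square.
      have h10 : Relation.ReflTransGen PAdj ((1, 0) : Site) (1, 0) := Relation.ReflTransGen.refl
      have h11 := hstep (a := (1, 1)) (b := (1, 0)) (by decide) (by decide) (by decide) h10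
      have h01 := hstep (a := (0, 1)) (b := (1, 1)) (by decide) (by decide) (by decide) h11
      have hm1 := hstep (a := (-1, 1)) (b := (0, 1)) (by decide) (by decide) (by decide) h01
      have hm0 := hstep (a := (-1, 0)) (b := (-1, 1)) (by decide) (by decide) (by decide) hm1
      have h1m := hstep (a := (1, -1)) (b := (1, 0)) (by decide) (by decide) (by decide) h10
      have h0m := hstep (a := (0, -1)) (b := (1, -1)) (by decide) (by decide) (by decide) h1m
      have : (a = 1 ∧ b = 0) ∨ (a = -1 ∧ b = 0) ∨ (a = 0 ∧ b = 1) ∨ (a = 0 ∧ b = -1) := by omega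
      rcases this with ⟨rfl, rfl⟩ | ⟨rfl, rfl⟩ | ⟨rfl, rfl⟩ | ⟨rfl, rfl⟩
      exacts [h10, hm0, h01, h0m]
    · have hne : ∀ y : Site, y.1.natAbs + y.2.natAbs = n → y ≠ 0 := by
        rintro y hy rfl
        simp at hy
        omega
      have : ∃ y : Site, y.1.natAbs + y.2.natAbs = n ∧ |a - y.1| + |b - y.2| = 1 := by
        simp only [Int.abs_eq_natAbs]
        rcases lt_trichotomy a 0 with h | h | h
        · exact ⟨(a + 1, b), by dsimp; omega, by dsimp; omega⟩
        · rcases lt_or_ge b 0 with h' | h'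
          · exact ⟨(a, b + 1), by dsimp; omega, by dsimp; omega⟩
          · exact ⟨(a, b - 1), by dsimp; omega, by dsimp; omega⟩
        · exact ⟨(a - 1, b), by dsimp; omega, by dsimp; omega⟩
      obtain ⟨y, hy, hxy⟩ := this
      exact hstep hxy hx (hne y hy) (ih y (hne y hy) hy)

/-- The lattice without the origin is connected. -/
theorem pAdj_connected {x y : Site} (hx : x ≠ 0) (hy : y ≠ 0) :
    Relation.ReflTransGen PAdj x y := by
  refine (pAdj_connected_aux _ x hx rfl).trans ?_
  have : Std.Symm PAdj := ⟨fun _ _ h => h.symm⟩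
  exact Relation.ReflTransGen.stdSymm.symm _ _ (pAdj_connected_aux _ y hy rfl)

/-! ### Hitting probabilities and transience of the conditioned walk -/

theorem condWalk_eq_zero {x : Site} (hx : x ≠ 0) {B : Set (ℕ → Site)} (hB : MeasurableSet B)
    (h : ∀ y, Adj x y → y ≠ 0 → condWalk y (consPath x ⁻¹' B) = 0) : condWalk x B = 0 := by
  rw [condWalk_apply x hB, ENNReal.tsum_eq_zero]
  intro y
  by_cases hy : condStep x y = 0
  · rw [hy, zero_mul]
  · obtain ⟨h1, h2⟩ := condStep_ne_zero hx hy
    rw [h y h1 h2, mul_zero]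

theorem condWalk_adj {x : Site} (hx : x ≠ 0) : ∀ᵐ f ∂condWalk x, ∀ k, Adj (f k) (f (k + 1)) := by
  rw [ae_all_iff]
  intro k
  have hm : ∀ k : ℕ, MeasurableSet {f : ℕ → Site | ¬ Adj (f k) (f (k + 1))} := fun k =>
    measurableSet_preimage (f := fun f : ℕ → Site => (f k, f (k + 1))) (by fun_prop)
      (MeasurableSet.of_discrete (s := {p : Site × Site | ¬ Adj p.1 p.2}))
  rw [ae_iff]
  induction k generalizing x with
  | zero =>
    refine condWalk_eq_zero hx (hm 0) fun y hy _ => ?_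
    refine measure_mono_null ?_ (ae_iff.1 (condWalk_start y))
    rintro f hf rfl
    exact hf hy
  | succ k ih => exact condWalk_eq_zero hx (hm _) fun y _ hy => ih hy

/-- The function `1 / a`, superharmonic for the conditioned walk. -/
noncomputable def invKernel (x : Site) : ℝ≥0∞ := ENNReal.ofReal (1 / potentialKernel x)

theorem condStep_mul_invKernel {x y : Site} (hx : x ≠ 0) (hxy : Adj x y) :
    condStep x y * invKernel y =
      if y = 0 then 0 else ENNReal.ofReal (1 / (4 * potentialKernel x)) := by
  split_ifs with hy
  · rw [hy, condStep_to_zero hx, zero_mul]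
  · have := potentialKernel_pos hx
    have := potentialKernel_pos hy
    rw [condStep_of_ne hx, if_pos hxy, invKernel, ← ENNReal.ofReal_mul (by positivity)]
    congr 1
    field_simp

/-- The defect of `1 / a` from being harmonic is located at the neighbors of the origin. -/
theorem tsum_condStep_mul_invKernel {x : Site} (hx : x ≠ 0) :
    ∑' y, condStep x y * invKernel y +
      (if Adj x 0 then ENNReal.ofReal (1 / (4 * potentialKernel x)) else 0) ≤ invKernel x := by
  have hp := potentialKernel_pos hx
  have h4 : invKernel x = ∑ y ∈ nbrs x, ENNReal.ofReal (1 / (4 * potentialKernel x)) := by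
    rw [sum_nbrs, ← ENNReal.ofReal_add (by positivity) (by positivity),
      ← ENNReal.ofReal_add (by positivity) (by positivity),
      ← ENNReal.ofReal_add (by positivity) (by positivity), invKernel]
    congr 1
    field_simp
    norm_num
  have h0 : (if Adj x 0 then ENNReal.ofReal (1 / (4 * potentialKernel x)) else 0) =
      ∑ y ∈ nbrs x, if y = 0 then ENNReal.ofReal (1 / (4 * potentialKernel x)) else 0 := by
    rw [Finset.sum_ite_eq']
    simp only [mem_nbrs]
  rw [tsum_condStep_mul hx, h0, h4, ← Finset.sum_add_distrib]
  refine Finset.sum_le_sum fun y hy => ?_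
  rw [condStep_mul_invKernel hx (mem_nbrs.1 hy)]
  split_ifs <;> simp

theorem tsum_condStep_mul_invKernel_le {x : Site} (hx : x ≠ 0) :
    ∑' y, condStep x y * invKernel y ≤ invKernel x :=
  le_self_add.trans (tsum_condStep_mul_invKernel hx)

/-- The level sets of the potential kernel are hit with probability at most `r / a(y)`. -/
theorem condWalk_hit_le {y : Site} (hy : y ≠ 0) (r : ℝ) (S : Set Site)
    (hS : ∀ z ∈ S, potentialKernel z ≤ r) :
    condWalk y {f | ∃ k, f k ∈ S} ≤ ENNReal.ofReal r * invKernel y := by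
  have hm : ∀ n : ℕ, MeasurableSet {f : ℕ → Site | ∃ k ≤ n, f k ∈ S} := by
    intro n
    have : {f : ℕ → Site | ∃ k ≤ n, f k ∈ S} = ⋃ k ≤ n, (fun f : ℕ → Site => f k) ⁻¹' S := by
      ext f; simp
    rw [this]
    exact MeasurableSet.biUnion (Set.to_countable _) fun k _ =>
      measurable_pi_apply k MeasurableSet.of_discrete
  -- The function `r / a` is superharmonic and at least one on `S`, hence it dominates the hitting
  -- probabilities before any finite time.
  have hone : ∀ y ∈ S, y ≠ 0 → 1 ≤ ENNReal.ofReal r * invKernel y := by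
    intro y hyS hy
    have h1 := potentialKernel_pos hy
    have h2 := hS y hyS
    rw [invKernel, ← ENNReal.ofReal_mul (by linarith), ENNReal.one_le_ofReal, mul_one_div,
      one_le_div h1]
    exact h2
  have key : ∀ (n : ℕ) (y : Site), y ≠ 0 → condWalk y {f | ∃ k ≤ n, f k ∈ S} ≤
      ENNReal.ofReal r * invKernel y := by
    intro n
    induction n with
    | zero =>
      intro y hy
      by_cases hyS : y ∈ S
      · exact prob_le_one.trans (hone y hyS hy)
      · refine le_of_eq_of_le ?_ zero_le
        refine measure_mono_null ?_ (ae_iff.1 (condWalk_start y))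
        rintro f ⟨k, hk, hf⟩ h0
        rw [Nat.le_zero.1 hk, h0] at hf
        exact hyS hf
    | succ n ih =>
      intro y hy
      by_cases hyS : y ∈ S
      · exact prob_le_one.trans (hone y hyS hy)
      · have hpre : consPath y ⁻¹' {f | ∃ k ≤ n + 1, f k ∈ S} = {f | ∃ k ≤ n, f k ∈ S} := by
          ext f
          constructor
          · rintro ⟨k, hk, hf⟩
            cases k with
            | zero => exact absurd hf hyS
            | succ k => exact ⟨k, by omega, hf⟩
          · rintro ⟨k, hk, hf⟩
            exact ⟨k + 1, by omega, hf⟩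
        rw [condWalk_apply y (hm _), hpre]
        calc ∑' z, condStep y z * condWalk z {f | ∃ k ≤ n, f k ∈ S}
            ≤ ∑' z, ENNReal.ofReal r * (condStep y z * invKernel z) := by
              refine ENNReal.tsum_le_tsum fun z => ?_
              by_cases hz : condStep y z = 0
              · simp [hz]
              · rw [mul_left_comm]
                gcongr
                exact ih z (condStep_ne_zero hy hz).2
          _ ≤ _ := by
              rw [ENNReal.tsum_mul_left]
              gcongr
              exact tsum_condStep_mul_invKernel_le hy
  have hU : {f : ℕ → Site | ∃ k, f k ∈ S} = ⋃ n, {f | ∃ k ≤ n, f k ∈ S} := by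
    ext f
    simp only [mem_ofPred_eq, mem_iUnion]
    exact ⟨fun ⟨k, hk⟩ => ⟨k, k, le_rfl, hk⟩, fun ⟨_, k, _, hk⟩ => ⟨k, hk⟩⟩
  rw [hU, Monotone.measure_iUnion]
  · exact iSup_le fun n => key n y hy
  · rintro m n hmn f ⟨k, hk, hf⟩
    exact ⟨k, hk.trans hmn, hf⟩

theorem measurableSet_visit (k : ℕ) (y : Site) : MeasurableSet {f : ℕ → Site | f k = y} :=
  measurableSet_preimage (f := fun f : ℕ → Site => f k) (by fun_prop) (measurableSet_singleton y)

theorem visitProb_zero (x y : Site) :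
    condWalk x {f | f 0 = y} = if x = y then 1 else 0 := by
  have : condWalk x {f | f 0 = y} = condWalk x {_f | x = y} := by
    refine measure_congr ?_
    filter_upwards [condWalk_start x] with f hf
    exact propext (by rw [← hf]; rfl)
  rw [this]
  split_ifs with h <;> simp [h]

theorem visitProb_succ (k : ℕ) (x y : Site) : condWalk x {f | f (k + 1) = y} =
    ∑' z, condStep x z * condWalk z {f | f k = y} :=
  condWalk_apply x (measurableSet_visit (k + 1) y)

/-- The Green function of the conditioned walk is finite at the neighbors of the origin, where
`1 / a` is strictly superharmonic. -/
theorem green_bound_nbr {e : Site} (he : e ≠ 0) (hadj : Adj e 0) {x : Site} (hx : x ≠ 0) :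
    ∑' k, condWalk x {f | f k = e} ≠ ∞ := by
  set c := ENNReal.ofReal (1 / (4 * potentialKernel e)) with hc
  have hpos : c ≠ 0 := by
    have := potentialKernel_pos he
    rw [hc, ne_eq, ENNReal.ofReal_eq_zero, not_le]
    positivity
  have key : ∀ (n : ℕ) (x : Site), x ≠ 0 →
      c * ∑ k ∈ Finset.range n, condWalk x {f | f k = e} ≤ invKernel x := by
    intro n
    induction n with
    | zero => intro x _; simp
    | succ n ih =>
      intro x hx
      rw [Finset.sum_range_succ', mul_add]
      refine le_trans (add_le_add ?_ ?_) (tsum_condStep_mul_invKernel hx)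
      · simp_rw [visitProb_succ]
        rw [← Summable.tsum_finsetSum (fun _ _ => ENNReal.summable), ← ENNReal.tsum_mul_left]
        refine ENNReal.tsum_le_tsum fun z => ?_
        by_cases hz : condStep x z = 0
        · simp [hz]
        · rw [← Finset.mul_sum, mul_left_comm]
          gcongr
          exact ih z (condStep_ne_zero hx hz).2
      · rw [visitProb_zero]
        by_cases hxe : x = e
        · subst hxe
          rw [if_pos rfl, if_pos hadj, mul_one]
        · rw [if_neg hxe, mul_zero]
          exact zero_le
  have h2 : c * ∑' k, condWalk x {f | f k = e} ≤ invKernel x := by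
    rw [← ENNReal.tsum_mul_left]
    refine ENNReal.tsum_le_of_sum_range_le fun n => ?_
    rw [← Finset.mul_sum]
    exact key n x hx
  intro htop
  rw [htop, ENNReal.mul_top hpos] at h2
  exact absurd (top_le_iff.1 h2) ENNReal.ofReal_ne_top

/-- The last step of a walk that visits `y` may lead to `z`. -/
theorem visitProb_mul_le (k : ℕ) (x y z : Site) :
    condWalk x {f | f k = y} * condStep y z ≤ condWalk x {f | f (k + 1) = z} := by
  induction k generalizing x with
  | zero =>
    rw [visitProb_succ, visitProb_zero]
    split_ifs with h
    · subst h
      refine le_trans ?_ (ENNReal.le_tsum z)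
      rw [visitProb_zero, if_pos rfl, one_mul, mul_one]
    · rw [zero_mul]
      exact zero_le
  | succ k ih =>
    rw [visitProb_succ, visitProb_succ, ← ENNReal.tsum_mul_right]
    refine ENNReal.tsum_le_tsum fun w => ?_
    rw [mul_assoc]
    gcongr
    exact ih w

/-- The conditioned walk is transient: finiteness of the Green function propagates from a neighbor
of the origin to all other sites. -/
theorem green_finite {x y : Site} (hx : x ≠ 0) (hy : y ≠ 0) :
    ∑' k, condWalk x {f | f k = y} ≠ ∞ := by
  refine Relation.ReflTransGen.head_induction_on
    (motive := fun y _ => ∑' k, condWalk x {f | f k = y} ≠ ∞)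
    (pAdj_connected hy (by decide : ((1, 0) : Site) ≠ 0))
    (green_bound_nbr (by decide) (by decide) hx) ?_
  rintro y z ⟨hadj, hy, hz⟩ _ ih htop
  refine ih (top_le_iff.1 ?_)
  have h1 : (∑' k, condWalk x {f | f k = y}) * condStep y z ≤ ∑' k, condWalk x {f | f k = z} := by
    rw [← ENNReal.tsum_mul_right]
    refine (ENNReal.tsum_le_tsum fun k => visitProb_mul_le k x y z).trans ?_
    exact ENNReal.tsum_comp_le_tsum_of_injective (fun a b h => Nat.succ_injective h)
      (fun k => condWalk x {f | f k = z})
  rwa [htop, ENNReal.top_mul (condStep_pos hy hz hadj).ne'] at h1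

/-- One-sided nearest-neighbor paths visiting every site finitely many times. -/
def halfTrajSet : Set (ℕ → Site) :=
  {f | (∀ k, Adj (f k) (f (k + 1))) ∧ ∀ x, {k | f k = x}.Finite}

theorem condWalk_visitProb_origin (k : ℕ) {x : Site} (hx : x ≠ 0) :
    condWalk x {f | f k = 0} = 0 := by
  induction k generalizing x with
  | zero => rw [visitProb_zero, if_neg hx]
  | succ k ih => exact condWalk_eq_zero hx (measurableSet_visit _ _) fun y _ hy => ih hy

theorem condWalk_halfTrajSet {x : Site} (hx : x ≠ 0) : ∀ᵐ f ∂condWalk x, f ∈ halfTrajSet := by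
  have h : ∀ᵐ f ∂condWalk x, ∀ y, {k | f k = y}.Finite := by
    rw [ae_all_iff]
    intro y
    have hfin : ∑' k, condWalk x {f | f k = y} ≠ ∞ := by
      by_cases hy : y = 0
      · subst hy
        simp [condWalk_visitProb_origin _ hx]
      · exact green_finite hx hy
    filter_upwards [ae_eventually_notMem hfin] with f hf
    rw [← Nat.cofinite_eq_atTop] at hf
    simpa [Filter.eventually_cofinite] using hf
  filter_upwards [condWalk_adj hx, h] with f h1 h2 using ⟨h1, h2⟩

/-! ### The stationary measure on doubly infinite paths -/

@[fun_prop]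
theorem measurable_glue : Measurable glue := by
  refine measurable_pi_lambda _ fun k => ?_
  unfold glue
  split_ifs with h <;> fun_prop

theorem glue_of_nonneg (p : (ℕ → Site) × (ℕ → Site)) (k : ℕ) : glue p k = p.1 k := by
  simp [glue]

theorem glue_neg (p : (ℕ → Site) × (ℕ → Site)) (k : ℕ) (hk : 1 ≤ k) : glue p (-k) = p.2 k := by
  rw [glue, if_neg (by omega)]
  simp

/-- The time shift of doubly infinite paths. -/
def shiftBy (m : ℤ) (w : ℤ → Site) : ℤ → Site := fun k => w (k + m)

@[fun_prop]
theorem measurable_shiftBy (m : ℤ) : Measurable (shiftBy m) :=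
  measurable_pi_lambda _ fun k => measurable_pi_apply (k + m)

theorem shiftBy_zero : shiftBy 0 = id := by
  funext w k; simp [shiftBy]

theorem shiftBy_comp (m n : ℤ) : shiftBy m ∘ shiftBy n = shiftBy (m + n) := by
  funext w k; simp [shiftBy, add_assoc]

theorem shiftBy_one_glue (f g : ℕ → Site) (z : Site) :
    shiftBy 1 (glue (consPath (g 0) f, g)) = glue (f, consPath z g) := by
  funext k
  rcases le_or_gt 0 k with h | h
  · obtain ⟨n, rfl⟩ := Int.eq_ofNat_of_zero_le h
    have : shiftBy 1 (glue (consPath (g 0) f, g)) n = glue (consPath (g 0) f, g) ((n + 1 : ℕ) : ℤ) := by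
      simp [shiftBy]
    rw [this, glue_of_nonneg, glue_of_nonneg]
    rfl
  · obtain ⟨n, rfl⟩ : ∃ n : ℕ, k = -((n + 1 : ℕ) : ℤ) := ⟨(-k - 1).toNat, by omega⟩
    rw [glue_neg _ _ (by omega)]
    have : shiftBy 1 (glue (consPath (g 0) f, g)) (-((n + 1 : ℕ) : ℤ)) =
        glue (consPath (g 0) f, g) (-(n : ℤ)) := by
      simp [shiftBy]
    rw [this]
    cases n with
    | zero => exact glue_of_nonneg (consPath (g 0) f, g) 0
    | succ n => rw [glue_neg _ _ (by omega)]; rfl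

/-- The weight `a(x)²` of a site, the reversible measure of the conditioned walk. -/
noncomputable def siteWeight (x : Site) : ℝ≥0∞ := ENNReal.ofReal (potentialKernel x ^ 2)

@[simp] theorem siteWeight_zero : siteWeight 0 = 0 := by simp [siteWeight]

theorem siteWeight_ne_top (x : Site) : siteWeight x ≠ ∞ := ENNReal.ofReal_ne_top

/-- The stationary measure of the doubly infinite conditioned walk: the position at time zero has
the reversible measure `a²`, and future and past are independent conditioned walks. -/
noncomputable def stationaryMeasure : Measure (ℤ → Site) :=
  Measure.sum fun x => siteWeight x • ((condWalk x).prod (condWalk x)).map glue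

theorem stationaryMeasure_apply {B : Set (ℤ → Site)} (hB : MeasurableSet B) :
    stationaryMeasure B =
      ∑' x, siteWeight x * ((condWalk x).prod (condWalk x)) (glue ⁻¹' B) := by
  rw [stationaryMeasure, Measure.sum_apply _ hB]
  refine tsum_congr fun x => ?_
  rw [Measure.smul_apply, Measure.map_apply measurable_glue hB, smul_eq_mul]

theorem condWalk_prod_left (x : Site) (ν : Measure (ℕ → Site)) [SFinite ν]
    {S : Set ((ℕ → Site) × (ℕ → Site))} (hS : MeasurableSet S) :
    ((condWalk x).prod ν) S =
      ∑' y, condStep x y * ((condWalk y).prod ν) {p | (consPath x p.1, p.2) ∈ S} := by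
  have hm : MeasurableSet {p : (ℕ → Site) × (ℕ → Site) | (consPath x p.1, p.2) ∈ S} :=
    measurableSet_preimage (f := fun p : (ℕ → Site) × (ℕ → Site) => (consPath x p.1, p.2))
      (by fun_prop) hS
  rw [Measure.prod_apply_symm hS]
  simp_rw [Measure.prod_apply_symm hm]
  have : ∀ g, condWalk x ((fun f => (f, g)) ⁻¹' S) = ∑' y, condStep x y *
      condWalk y ((fun f => (f, g)) ⁻¹' {p | (consPath x p.1, p.2) ∈ S}) := fun g =>
    condWalk_apply x (measurableSet_preimage (by fun_prop) hS)
  simp_rw [this]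
  rw [lintegral_tsum]
  · refine tsum_congr fun y => ?_
    rw [lintegral_const_mul _ (measurable_measure_prodMk_right hm)]
  · exact fun y => ((measurable_measure_prodMk_right hm).const_mul _).aemeasurable

theorem condWalk_prod_right (x : Site) (ν : Measure (ℕ → Site)) [SFinite ν]
    {S : Set ((ℕ → Site) × (ℕ → Site))} (hS : MeasurableSet S) :
    (ν.prod (condWalk x)) S =
      ∑' y, condStep x y * (ν.prod (condWalk y)) {p | (p.1, consPath x p.2) ∈ S} := by
  have hm : MeasurableSet {p : (ℕ → Site) × (ℕ → Site) | (p.1, consPath x p.2) ∈ S} :=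
    measurableSet_preimage (f := fun p : (ℕ → Site) × (ℕ → Site) => (p.1, consPath x p.2))
      (by fun_prop) hS
  rw [Measure.prod_apply hS]
  simp_rw [Measure.prod_apply hm]
  have : ∀ f, condWalk x (Prod.mk f ⁻¹' S) = ∑' y, condStep x y *
      condWalk y (Prod.mk f ⁻¹' {p | (p.1, consPath x p.2) ∈ S}) := fun f =>
    condWalk_apply x (measurableSet_preimage (by fun_prop) hS)
  simp_rw [this]
  rw [lintegral_tsum]
  · refine tsum_congr fun y => ?_
    rw [lintegral_const_mul _ (measurable_measure_prodMk_left hm)]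
  · exact fun y => ((measurable_measure_prodMk_left hm).const_mul _).aemeasurable

theorem condWalk_prod_start (x y : Site) :
    ∀ᵐ p ∂(condWalk x).prod (condWalk y), p.1 0 = x ∧ p.2 0 = y := by
  have h1 : ∀ᵐ p ∂(condWalk x).prod (condWalk y), p.1 0 = x :=
    Measure.quasiMeasurePreserving_fst.ae (condWalk_start x)
  have h2 : ∀ᵐ p ∂(condWalk x).prod (condWalk y), p.2 0 = y :=
    Measure.quasiMeasurePreserving_snd.ae (condWalk_start y)
  filter_upwards [h1, h2] with p hp1 hp2 using ⟨hp1, hp2⟩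

theorem stationaryMeasure_shiftBy_one {B : Set (ℤ → Site)} (hB : MeasurableSet B) :
    stationaryMeasure (shiftBy 1 ⁻¹' B) = stationaryMeasure B := by
  set T : Site → Site → ℝ≥0∞ := fun x y =>
    ((condWalk y).prod (condWalk x)) {p | glue (p.1, consPath y p.2) ∈ B} with hT
  have h1 : stationaryMeasure (shiftBy 1 ⁻¹' B) =
      ∑' x, ∑' y, siteWeight x * condStep x y * T x y := by
    rw [stationaryMeasure_apply (measurable_shiftBy 1 hB)]
    refine tsum_congr fun x => ?_
    rw [condWalk_prod_left x _ (measurable_glue (measurable_shiftBy 1 hB)), ← ENNReal.tsum_mul_left]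
    refine tsum_congr fun y => ?_
    rw [mul_assoc]
    congr 2
    refine measure_congr ?_
    filter_upwards [condWalk_prod_start y x] with p hp
    refine propext ?_
    change shiftBy 1 (glue (consPath x p.1, p.2)) ∈ B ↔ _
    rw [← hp.2, shiftBy_one_glue p.1 p.2 y]
    rfl
  have h2 : stationaryMeasure B = ∑' y, ∑' x, siteWeight y * condStep y x * T x y := by
    rw [stationaryMeasure_apply hB]
    refine tsum_congr fun y => ?_
    rw [condWalk_prod_right y _ (measurable_glue hB), ← ENNReal.tsum_mul_left]
    refine tsum_congr fun x => ?_
    rw [mul_assoc]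
    rfl
  rw [h1, h2, ENNReal.tsum_comm]
  refine tsum_congr fun y => tsum_congr fun x => ?_
  rw [siteWeight, condStep_reversible, siteWeight]

/-- Stationarity of the doubly infinite conditioned walk. -/
theorem stationaryMeasure_shiftBy (m : ℤ) {B : Set (ℤ → Site)} (hB : MeasurableSet B) :
    stationaryMeasure (shiftBy m ⁻¹' B) = stationaryMeasure B := by
  induction m using Int.induction_on with
  | zero => rw [shiftBy_zero, preimage_id]
  | succ i ih =>
    rw [← ih, ← stationaryMeasure_shiftBy_one (measurable_shiftBy i hB), ← preimage_comp,
      shiftBy_comp]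
  | pred i ih =>
    rw [← ih, ← stationaryMeasure_shiftBy_one (measurable_shiftBy (-i - 1) hB), ← preimage_comp,
      shiftBy_comp, sub_add_cancel]

/-! ### Entrance times and the hitting measures -/

/-- Paths whose entrance time into `K` is `n`. -/
def entrance (K : Finset Site) (n : ℤ) : Set (ℤ → Site) := {w | w n ∈ K ∧ ∀ k < n, w k ∉ K}

theorem measurableSet_coord_mem (k : ℤ) (S : Set Site) :
    MeasurableSet {w : ℤ → Site | w k ∈ S} :=
  measurableSet_preimage (f := fun w : ℤ → Site => w k) (by fun_prop) MeasurableSet.of_discrete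

theorem measurableSet_entrance (K : Finset Site) (n : ℤ) : MeasurableSet (entrance K n) := by
  have : entrance K n = {w | w n ∈ (K : Set Site)} ∩ ⋂ k < n, {w | w k ∈ (K : Set Site)ᶜ} := by
    ext w; simp [entrance]
  rw [this]
  exact (measurableSet_coord_mem _ _).inter
    (MeasurableSet.biInter (Set.to_countable _) fun k _ => measurableSet_coord_mem _ _)

theorem measurableSet_finite_visits (x : Site) :
    MeasurableSet {w : ℤ → Site | {k | w k = x}.Finite} := by
  have : {w : ℤ → Site | {k | w k = x}.Finite} =
      ⋃ N : ℕ, ⋂ k : ℤ, ⋂ _ : N < k.natAbs, {w | w k ∈ ({x} : Set Site)ᶜ} := by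
    ext w
    simp only [mem_ofPred_eq, mem_iUnion, mem_iInter, mem_compl_iff, mem_singleton_iff]
    constructor
    · intro h
      obtain ⟨N, hN⟩ := (h.image Int.natAbs).bddAbove
      exact ⟨N, fun k hk hw => absurd (hN ⟨k, hw, rfl⟩) (not_le.2 hk)⟩
    · rintro ⟨N, hN⟩
      refine (Set.finite_Icc (-(N : ℤ)) N).subset fun k hk => ?_
      by_contra h
      rw [mem_Icc] at h
      exact hN k (by omega) hk
  rw [this]
  exact MeasurableSet.iUnion fun N => MeasurableSet.iInter fun k => MeasurableSet.iInter fun _ =>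
    measurableSet_coord_mem _ _

theorem measurableSet_trajSet : MeasurableSet trajSet := by
  have : trajSet = (⋂ k : ℤ, {w : ℤ → Site | Adj (w k) (w (k + 1))}) ∩
      ⋂ x : Site, {w : ℤ → Site | {k | w k = x}.Finite} := by
    ext w; simp [trajSet]
  rw [this]
  refine (MeasurableSet.iInter fun k => ?_).inter
    (MeasurableSet.iInter fun x => measurableSet_finite_visits x)
  exact measurableSet_preimage (f := fun w : ℤ → Site => (w k, w (k + 1))) (by fun_prop)
    (MeasurableSet.of_discrete (s := {p : Site × Site | Adj p.1 p.2}))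

theorem measurableSet_neverReturn (K : Finset Site) : MeasurableSet (neverReturn K) := by
  have : neverReturn K = ⋂ k : ℕ, ⋂ _ : 1 ≤ k, {g : ℕ → Site | g k ∈ (K : Set Site)ᶜ} := by
    ext w; simp [neverReturn]
  rw [this]
  exact MeasurableSet.iInter fun k => MeasurableSet.iInter fun _ =>
    measurableSet_preimage (f := fun w : ℕ → Site => w k) (by fun_prop) MeasurableSet.of_discrete

theorem glue_mem_entrance (K : Finset Site) (p : (ℕ → Site) × (ℕ → Site)) :
    glue p ∈ entrance K 0 ↔ p.1 0 ∈ K ∧ p.2 ∈ neverReturn K := by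
  have h0 : glue p 0 = p.1 0 := glue_of_nonneg p 0
  simp only [entrance, mem_ofPred_eq, h0, neverReturn]
  refine and_congr_right fun _ => ⟨fun h k hk => ?_, fun h k hk => ?_⟩
  · rw [← glue_neg p k hk]
    exact h _ (by omega)
  · obtain ⟨n, rfl⟩ : ∃ n : ℕ, k = -(n : ℤ) := ⟨(-k).toNat, by omega⟩
    rw [glue_neg p n (by omega)]
    exact h n (by omega)

/-- The stationary measure of paths entering `K` at time zero. -/
theorem stationaryMeasure_entrance (K : Finset Site) {B : Set (ℤ → Site)} (hB : MeasurableSet B) :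
    stationaryMeasure (B ∩ entrance K 0) = ∑ x ∈ K, siteWeight x *
      ((condWalk x).prod (condWalk x)) (glue ⁻¹' B ∩ univ ×ˢ neverReturn K) := by
  rw [stationaryMeasure_apply (hB.inter (measurableSet_entrance K 0)), tsum_eq_sum (s := K)]
  · refine Finset.sum_congr rfl fun x hx => ?_
    congr 1
    refine measure_congr ?_
    filter_upwards [condWalk_prod_start x x] with p hp
    refine propext ?_
    change glue p ∈ B ∧ glue p ∈ entrance K 0 ↔ glue p ∈ B ∧ (True ∧ p.2 ∈ neverReturn K)
    rw [glue_mem_entrance, hp.1]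
    simp [hx]
  · intro x hx
    rw [measure_mono_null _ (ae_iff.1 (condWalk_prod_start x x)), mul_zero]
    rintro p ⟨_, hp⟩ ⟨h1, _⟩
    change glue p ∈ entrance K 0 at hp
    rw [glue_mem_entrance, h1] at hp
    exact hx hp.1

/-- The measure `Q_K` is the stationary measure restricted to the trajectories that enter `K` at
time zero. -/
theorem hittingMeasure_apply (K : Finset Site) {A : Set Traj} (hA : MeasurableSet A) :
    hittingMeasure K A = stationaryMeasure (Subtype.val '' A ∩ entrance K 0) := by
  have hA' : MeasurableSet (Subtype.val '' A : Set (ℤ → Site)) :=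
    measurableSet_trajSet.subtype_image hA
  rw [stationaryMeasure_entrance K hA', hittingMeasure,
    (MeasurableEmbedding.subtype_coe measurableSet_trajSet).comap_apply, Measure.finsetSum_apply]
  refine Finset.sum_congr rfl fun x _ => ?_
  have h : (condWalk x).prod ((condWalk x).restrict (neverReturn K)) =
      ((condWalk x).prod (condWalk x)).restrict (univ ×ˢ neverReturn K) := by
    rw [← Measure.prod_restrict, Measure.restrict_univ]
  rw [Measure.smul_apply, Measure.map_apply measurable_glue hA', h,
    Measure.restrict_apply (measurable_glue hA'), smul_eq_mul, siteWeight]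

/-- A future and a past that start from the same site and visit every site finitely often glue to
a trajectory. -/
theorem glue_mem_trajSet {f g : ℕ → Site} (hf : f ∈ halfTrajSet) (hg : g ∈ halfTrajSet)
    (h0 : f 0 = g 0) : glue (f, g) ∈ trajSet := by
  refine ⟨fun k => ?_, fun x => ?_⟩
  · rcases le_or_gt 0 k with h | h
    · obtain ⟨n, rfl⟩ := Int.eq_ofNat_of_zero_le h
      have h2 := glue_of_nonneg (f, g) (n + 1)
      push_cast at h2
      rw [glue_of_nonneg, h2]
      exact hf.1 n
    · obtain ⟨n, rfl⟩ : ∃ n : ℕ, k = -((n + 1 : ℕ) : ℤ) := ⟨(-k - 1).toNat, by omega⟩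
      rw [glue_neg _ _ (by omega)]
      have h3 : -((n + 1 : ℕ) : ℤ) + 1 = -(n : ℤ) := by push_cast; ring
      rw [h3]
      have h2 : glue (f, g) (-(n : ℤ)) = g n := by
        cases n with
        | zero => exact (glue_of_nonneg (f, g) 0).trans h0
        | succ n => exact glue_neg _ _ (by omega)
      rw [h2]
      exact (hg.1 n).symm
  · refine (((hf.2 x).image (fun n : ℕ => (n : ℤ))).union
      ((hg.2 x).image (fun n : ℕ => -(n : ℤ)))).subset fun k hk => ?_
    rcases le_or_gt 0 k with h | h
    · obtain ⟨n, rfl⟩ := Int.eq_ofNat_of_zero_le h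
      refine Or.inl ⟨n, ?_, rfl⟩
      rw [mem_ofPred_eq, glue_of_nonneg] at hk
      exact hk
    · obtain ⟨n, rfl⟩ : ∃ n : ℕ, k = -((n + 1 : ℕ) : ℤ) := ⟨(-k - 1).toNat, by omega⟩
      refine Or.inr ⟨n + 1, ?_, rfl⟩
      rw [mem_ofPred_eq, glue_neg _ _ (by omega)] at hk
      exact hk

theorem condWalk_prod_halfTrajSet {x y : Site} (hx : x ≠ 0) (hy : y ≠ 0) :
    ∀ᵐ p ∂(condWalk x).prod (condWalk y), p.1 ∈ halfTrajSet ∧ p.2 ∈ halfTrajSet := by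
  have h1 : ∀ᵐ p ∂(condWalk x).prod (condWalk y), p.1 ∈ halfTrajSet :=
    Measure.quasiMeasurePreserving_fst.ae (condWalk_halfTrajSet hx)
  have h2 : ∀ᵐ p ∂(condWalk x).prod (condWalk y), p.2 ∈ halfTrajSet :=
    Measure.quasiMeasurePreserving_snd.ae (condWalk_halfTrajSet hy)
  filter_upwards [h1, h2] with p hp1 hp2 using ⟨hp1, hp2⟩

theorem exists_entrance {w : ℤ → Site} (hw : w ∈ trajSet) {K : Finset Site} {k : ℤ}
    (hk : w k ∈ K) : ∃ n, w ∈ entrance K n := by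
  have hfin : {k | w k ∈ K}.Finite := by
    have : {k | w k ∈ K} = ⋃ x ∈ K, {k | w k = x} := by ext; simp
    rw [this]
    exact K.finite_toSet.biUnion fun x _ => hw.2 x
  obtain ⟨n, hn, hmin⟩ := hfin.exists_minimal ⟨k, hk⟩
  refine ⟨n, hn, fun j hj hjK => ?_⟩
  exact absurd (hmin hjK hj.le) (not_le.2 hj)

theorem entrance_disjoint (K : Finset Site) : Pairwise (Function.onFun Disjoint (entrance K)) := by
  intro m n hmn
  rw [Function.onFun, Set.disjoint_left]
  rintro w ⟨h1, h2⟩ ⟨h3, h4⟩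
  rcases lt_or_gt_of_ne hmn with h | h
  · exact h4 m h h1
  · exact h2 n h h3

theorem shiftBy_mem_entrance (K : Finset Site) (m n : ℤ) (w : ℤ → Site) :
    shiftBy m w ∈ entrance K n ↔ w ∈ entrance K (n + m) := by
  simp only [entrance, shiftBy, mem_ofPred_eq]
  refine and_congr_right fun _ => ⟨fun h k hk => ?_, fun h k hk => h _ (by omega)⟩
  have := h (k - m) (by omega)
  rwa [sub_add_cancel] at this

/-! ### The intensity of random interlacements -/

/-- The trajectories whose class modulo time shift belongs to `A`. -/
def pathsOf (A : Set TrajMod) : Set (ℤ → Site) :=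
  Subtype.val '' (Quotient.mk shiftSetoid ⁻¹' A)

theorem mem_pathsOf {A : Set TrajMod} {w : ℤ → Site} :
    w ∈ pathsOf A ↔ ∃ h : w ∈ trajSet, Quotient.mk shiftSetoid ⟨w, h⟩ ∈ A := by
  simp [pathsOf]

theorem measurable_mk : Measurable (Quotient.mk shiftSetoid) := fun _ h => h

theorem measurableSet_pathsOf {A : Set TrajMod} (hA : MeasurableSet A) :
    MeasurableSet (pathsOf A) :=
  measurableSet_trajSet.subtype_image (measurable_mk hA)

theorem shiftBy_mem_trajSet {m : ℤ} {w : ℤ → Site} (h : w ∈ trajSet) : shiftBy m w ∈ trajSet := by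
  refine ⟨fun k => ?_, fun x => ?_⟩
  · have := h.1 (k + m)
    rwa [show k + m + 1 = k + 1 + m by ring] at this
  · exact ((h.2 x).preimage (f := fun k => k + m) (by intro a _ b _; simp))

theorem shiftBy_neg (m : ℤ) (w : ℤ → Site) : shiftBy (-m) (shiftBy m w) = w := by
  funext k; simp [shiftBy]

theorem shiftBy_mem_pathsOf {A : Set TrajMod} (m : ℤ) {w : ℤ → Site} :
    shiftBy m w ∈ pathsOf A ↔ w ∈ pathsOf A := by
  have key : ∀ (m : ℤ) (w : ℤ → Site), w ∈ pathsOf A → shiftBy m w ∈ pathsOf A := by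
    intro m w h
    rw [mem_pathsOf] at h ⊢
    obtain ⟨hw, hA⟩ := h
    refine ⟨shiftBy_mem_trajSet hw, ?_⟩
    have : Quotient.mk shiftSetoid (⟨w, hw⟩ : Traj) =
        Quotient.mk shiftSetoid ⟨shiftBy m w, shiftBy_mem_trajSet hw⟩ :=
      Quotient.sound ⟨m, fun k => rfl⟩
    rwa [← this]
  refine ⟨fun h => ?_, key m w⟩
  have := key (-m) _ h
  rwa [shiftBy_neg] at this

/-- The image of `Q_K` on trajectories modulo time shift. -/
noncomputable def hitIntensity (K : Finset Site) : Measure TrajMod :=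
  (hittingMeasure K).map (Quotient.mk shiftSetoid)

theorem hitIntensity_apply (K : Finset Site) {A : Set TrajMod} (hA : MeasurableSet A) :
    hitIntensity K A = stationaryMeasure (pathsOf A ∩ entrance K 0) := by
  rw [hitIntensity, Measure.map_apply measurable_mk hA, hittingMeasure_apply K (measurable_mk hA)]
  rfl

/-- The trajectories that visit `K`. -/
def hitSet (K : Finset Site) : Set TrajMod := {ρ | ∃ x ∈ K, x ∈ ρ.sites}

theorem mem_pathsOf_hitSet {K : Finset Site} {w : ℤ → Site} :
    w ∈ pathsOf (hitSet K) ↔ w ∈ trajSet ∧ ∃ k, w k ∈ K := by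
  rw [mem_pathsOf]
  constructor
  · rintro ⟨h, x, hx, k, rfl⟩
    exact ⟨h, k, hx⟩
  · rintro ⟨h, k, hk⟩
    exact ⟨h, w k, hk, k, rfl⟩

theorem measurableSet_hitSet (K : Finset Site) : MeasurableSet (hitSet K) := by
  change MeasurableSet (Quotient.mk shiftSetoid ⁻¹' hitSet K)
  have : Quotient.mk shiftSetoid ⁻¹' hitSet K =
      Subtype.val ⁻¹' (⋃ k : ℤ, {w : ℤ → Site | w k ∈ (K : Set Site)}) := by
    ext w
    simp only [mem_preimage, mem_iUnion, mem_ofPred_eq]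
    constructor
    · rintro ⟨x, hx, k, rfl⟩
      exact ⟨k, hx⟩
    · rintro ⟨k, hk⟩
      exact ⟨w.1 k, hk, k, rfl⟩
  rw [this]
  exact measurable_subtype_coe (MeasurableSet.iUnion fun k => measurableSet_coord_mem _ _)

theorem hitSet_mono {K K' : Finset Site} (h : K ⊆ K') : hitSet K ⊆ hitSet K' :=
  fun _ ⟨x, hx, hxs⟩ => ⟨x, h hx, hxs⟩

/-- Consistency of the measures `Q_K`, a consequence of stationarity: shift the entrance time into
the smaller set to zero. -/
theorem hitIntensity_inter {K K' : Finset Site} (h : K ⊆ K') {A : Set TrajMod}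
    (hA : MeasurableSet A) : hitIntensity K' (A ∩ hitSet K) = hitIntensity K A := by
  rw [hitIntensity_apply K' (hA.inter (measurableSet_hitSet K)), hitIntensity_apply K hA]
  have hmA := measurableSet_pathsOf hA
  -- Decompose the two sides according to the entrance time into `K`, respectively into `K'`.
  have h1 : pathsOf (A ∩ hitSet K) ∩ entrance K' 0 =
      ⋃ n : ℤ, (pathsOf A ∩ entrance K' 0) ∩ entrance K n := by
    ext w
    simp only [mem_inter_iff, mem_iUnion]
    constructor
    · rintro ⟨hw, he⟩
      obtain ⟨ht, hwA, hwK⟩ := mem_pathsOf.1 hw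
      obtain ⟨_, k, hk⟩ := mem_pathsOf_hitSet.1 (mem_pathsOf.2 ⟨ht, hwK⟩)
      obtain ⟨n, hn⟩ := exists_entrance ht hk
      exact ⟨n, ⟨mem_pathsOf.2 ⟨ht, hwA⟩, he⟩, hn⟩
    · rintro ⟨n, ⟨hw, he⟩, hn⟩
      obtain ⟨ht, hwA⟩ := mem_pathsOf.1 hw
      obtain ⟨_, hwK⟩ := mem_pathsOf.1 (mem_pathsOf_hitSet.2 ⟨ht, n, hn.1⟩)
      exact ⟨mem_pathsOf.2 ⟨ht, hwA, hwK⟩, he⟩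
  have h2 : pathsOf A ∩ entrance K 0 =
      ⋃ n : ℤ, (pathsOf A ∩ entrance K 0) ∩ entrance K' (-n) := by
    ext w
    simp only [mem_inter_iff, mem_iUnion]
    constructor
    · rintro ⟨hw, he⟩
      obtain ⟨n, hn⟩ := exists_entrance (mem_pathsOf.1 hw).1 (h he.1)
      exact ⟨-n, ⟨hw, he⟩, by rwa [neg_neg]⟩
    · rintro ⟨n, h, _⟩
      exact h
  rw [h1, h2, measure_iUnion, measure_iUnion]
  · refine tsum_congr fun n => ?_
    rw [← stationaryMeasure_shiftBy n ((hmA.inter (measurableSet_entrance K 0)).inter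
      (measurableSet_entrance K' (-n)))]
    congr 1
    ext w
    simp only [mem_inter_iff, mem_preimage, shiftBy_mem_pathsOf, shiftBy_mem_entrance, zero_add,
      neg_add_cancel]
    tauto
  · exact fun m n hmn => ((entrance_disjoint K') (neg_injective.ne hmn)).mono
      inter_subset_right inter_subset_right
  · exact fun n => (hmA.inter (measurableSet_entrance K 0)).inter (measurableSet_entrance K' (-n))
  · exact fun m n hmn => ((entrance_disjoint K) hmn).mono inter_subset_right inter_subset_right
  · exact fun n => (hmA.inter (measurableSet_entrance K' 0)).inter (measurableSet_entrance K n)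

theorem hitIntensity_mono {K K' : Finset Site} (h : K ⊆ K') : hitIntensity K ≤ hitIntensity K' := by
  refine Measure.le_iff.2 fun A hA => ?_
  rw [← hitIntensity_inter h hA]
  exact measure_mono inter_subset_left

/-- The restriction of the intensity to the trajectories that visit `K` is the image of `Q_K`. -/
theorem intensity_inter (K : Finset Site) {A : Set TrajMod} (hA : MeasurableSet A) :
    intensity (A ∩ hitSet K) = hitIntensity K A := by
  refine le_antisymm ?_ ?_
  -- The measure that is infinite on nonempty sets bounds what misses `K`.
  · have hle : intensity ≤ hitIntensity K + (⊤ : Measure TrajMod).restrict (hitSet K)ᶜ := by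
      refine iSup_le fun K' => Measure.le_iff.2 fun B hB => ?_
      rw [Measure.add_apply, Measure.restrict_apply hB,
        ← measure_inter_add_sdiff B (measurableSet_hitSet K)]
      refine add_le_add ?_ ?_
      · rw [← hitIntensity_inter (Finset.subset_union_left : K ⊆ K ∪ K') hB]
        exact hitIntensity_mono Finset.subset_union_right _
      · exact (le_top : hitIntensity K' ≤ ⊤) _
    refine (hle _).trans ?_
    rw [Measure.add_apply, Measure.restrict_apply (hA.inter (measurableSet_hitSet K))]
    have : A ∩ hitSet K ∩ (hitSet K)ᶜ = ∅ := by
      ext; simp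
    rw [this, measure_empty, add_zero]
    exact measure_mono inter_subset_left
  · rw [← hitIntensity_inter (Finset.Subset.refl K) hA]
    exact (le_iSup (fun K : Finset Site => (hittingMeasure K).map (Quotient.mk shiftSetoid)) K) _

theorem pathsOf_univ : pathsOf univ = trajSet := by
  ext w; simp [mem_pathsOf]

/-- The intensity of the trajectories that visit `K` is the capacity of `K`. -/
theorem intensity_hitSet (K : Finset Site) :
    intensity (hitSet K) = ∑ x ∈ K, siteWeight x * condWalk x (neverReturn K) := by
  have := intensity_inter K MeasurableSet.univ
  rw [univ_inter] at this
  rw [this, hitIntensity_apply K MeasurableSet.univ, pathsOf_univ,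
    stationaryMeasure_entrance K measurableSet_trajSet]
  refine Finset.sum_congr rfl fun x _ => ?_
  by_cases hx : x = 0
  · simp [hx]
  congr 1
  have h1 : ((condWalk x).prod (condWalk x)) (univ ×ˢ neverReturn K) =
      condWalk x (neverReturn K) := by
    rw [Measure.prod_prod, measure_univ, one_mul]
  rw [← h1]
  refine measure_congr ?_
  filter_upwards [condWalk_prod_start x x, condWalk_prod_halfTrajSet hx hx] with p hp hp2
  refine propext ⟨fun h => h.2, fun h => ⟨?_, h⟩⟩
  exact glue_mem_trajSet hp2.1 hp2.2 (hp.1.trans hp.2.symm)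

theorem intensity_hitSet_ne_top (K : Finset Site) : intensity (hitSet K) ≠ ∞ := by
  rw [intensity_hitSet]
  exact ENNReal.sum_ne_top.2 fun x _ =>
    ENNReal.mul_ne_top (siteWeight_ne_top x) (measure_ne_top _ _)

/-! ### The intensity has infinite total mass -/

/-- The finite sublevel sets of the potential kernel. -/
noncomputable def level (r : ℝ) : Finset Site := (finite_potentialKernel_le r).toFinset

theorem mem_level {r : ℝ} {x : Site} : x ∈ level r ↔ potentialKernel x ≤ r := by
  simp [level]

theorem level_mono {r s : ℝ} (h : r ≤ s) : level r ⊆ level s := fun _ hx =>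
  mem_level.2 ((mem_level.1 hx).trans h)

theorem potentialKernel_adj_le {x y : Site} (hx : x ≠ 0) (h : Adj x y) :
    potentialKernel y ≤ 4 * potentialKernel x := by
  have h1 := nbrAvg_potentialKernel_of_ne hx
  rw [nbrAvg_eq_sum] at h1
  have h2 := Finset.single_le_sum (f := potentialKernel) (fun z _ => potentialKernel_nonneg z)
    (mem_nbrs.2 h)
  linarith

/-- A site of a level set from which the walk can escape has a comparable value of the potential
kernel. -/
theorem invKernel_le_of_escape {r : ℝ} (hr : 0 < r) {x : Site} (hx : x ≠ 0)
    (h : condWalk x (neverReturn (level r)) ≠ 0) : invKernel x ≤ ENNReal.ofReal (4 / r) := by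
  have : ∃ y, Adj x y ∧ y ∉ level r := by
    by_contra! hno
    refine h (condWalk_eq_zero hx (measurableSet_neverReturn _) fun y hy _ => ?_)
    refine measure_mono_null ?_ (ae_iff.1 (condWalk_start y))
    rintro f hf rfl
    exact hf 1 le_rfl (hno _ hy)
  obtain ⟨y, hy, hyl⟩ := this
  have h1 := potentialKernel_adj_le hx hy
  rw [mem_level, not_le] at hyl
  refine ENNReal.ofReal_le_ofReal ?_
  have := potentialKernel_pos hx
  rw [div_le_div_iff₀ this hr]
  linarith

/-- Capacities of level sets grow at least linearly in the level. -/
theorem intensity_level_le {r₀ r : ℝ} (h0 : 0 < r₀) (hr : r₀ ≤ r) :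
    intensity (hitSet (level r₀)) ≤ ENNReal.ofReal (4 * r₀ / r) * intensity (hitSet (level r)) := by
  have hrpos : 0 < r := h0.trans_le hr
  have h1 := intensity_inter (level r) (measurableSet_hitSet (level r₀))
  rw [inter_eq_self_of_subset_left (hitSet_mono (level_mono hr))] at h1
  rw [h1, hitIntensity_apply _ (measurableSet_hitSet _),
    stationaryMeasure_entrance _ (measurableSet_pathsOf (measurableSet_hitSet _)),
    intensity_hitSet, Finset.mul_sum]
  refine Finset.sum_le_sum fun x _ => ?_
  by_cases hx : x = 0
  · simp [hx]
  by_cases hesc : condWalk x (neverReturn (level r)) = 0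
  · rw [measure_mono_null inter_subset_right, mul_zero]
    · exact zero_le
    · rw [Measure.prod_prod, hesc, mul_zero]
  -- The past never returns to the larger level set, so the smaller one is visited by the future.
  have hsub : glue ⁻¹' pathsOf (hitSet (level r₀)) ∩ univ ×ˢ neverReturn (level r) ⊆
      {f | ∃ k, f k ∈ (level r₀ : Set Site)} ×ˢ neverReturn (level r) := by
    rintro p ⟨hp, -, hnr⟩
    refine ⟨?_, hnr⟩
    obtain ⟨-, k, hk⟩ := mem_pathsOf_hitSet.1 hp
    rcases le_or_gt 0 k with h | h
    · obtain ⟨n, rfl⟩ := Int.eq_ofNat_of_zero_le h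
      rw [glue_of_nonneg] at hk
      exact ⟨n, hk⟩
    · obtain ⟨n, rfl⟩ : ∃ n : ℕ, k = -((n + 1 : ℕ) : ℤ) := ⟨(-k - 1).toNat, by omega⟩
      rw [glue_neg _ _ (by omega)] at hk
      exact absurd (level_mono hr hk) (hnr _ (by omega))
  calc siteWeight x * ((condWalk x).prod (condWalk x))
        (glue ⁻¹' pathsOf (hitSet (level r₀)) ∩ univ ×ˢ neverReturn (level r))
      ≤ siteWeight x * (condWalk x {f | ∃ k, f k ∈ (level r₀ : Set Site)} *
        condWalk x (neverReturn (level r))) := by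
        gcongr
        exact (measure_mono hsub).trans_eq (Measure.prod_prod _ _)
    _ ≤ siteWeight x * (ENNReal.ofReal (4 * r₀ / r) * condWalk x (neverReturn (level r))) := by
        gcongr
        refine (condWalk_hit_le hx r₀ _ fun z hz => mem_level.1 hz).trans ?_
        calc ENNReal.ofReal r₀ * invKernel x
            ≤ ENNReal.ofReal r₀ * ENNReal.ofReal (4 / r) := by
              gcongr
              exact invKernel_le_of_escape hrpos hx hesc
          _ = ENNReal.ofReal (4 * r₀ / r) := by
              rw [← ENNReal.ofReal_mul h0.le]
              congr 1
              ring
    _ = _ := by ring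

/-- Some level set has positive capacity. -/
theorem intensity_level_pos :
    intensity (hitSet (level (potentialKernel (1, 0)))) ≠ 0 := by
  have he : ((1, 0) : Site) ≠ 0 := by decide
  set x : Site := (1, 0) with hx
  have hpx := potentialKernel_pos he
  -- One neighbor is the origin, so another one has a larger value of the potential kernel. From
  -- there the walk avoids the level set with positive probability.
  have hex : ∃ y, Adj x y ∧ potentialKernel x < potentialKernel y := by
    by_contra! hno
    have h1 := nbrAvg_potentialKernel_of_ne he
    have a1 := hno _ (adj_iff.2 (Or.inl rfl))
    have a3 := hno _ (adj_iff.2 (Or.inr (Or.inr (Or.inl rfl))))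
    have a4 := hno _ (adj_iff.2 (Or.inr (Or.inr (Or.inr rfl))))
    have a2 : potentialKernel (x - (1, 0)) = 0 := by
      rw [hx, sub_self, potentialKernel_zero]
    rw [nbrAvg] at h1
    linarith
  obtain ⟨y, hxy, hlt⟩ := hex
  have hy : y ≠ 0 := by
    rintro rfl
    rw [potentialKernel_zero] at hlt
    linarith
  have hpy := potentialKernel_pos hy
  rw [intensity_hitSet]
  have hxl : x ∈ level (potentialKernel x) := mem_level.2 le_rfl
  refine fun h0 => ?_
  have h1 := (Finset.sum_eq_zero_iff.1 h0) x hxl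
  rw [mul_eq_zero] at h1
  rcases h1 with h1 | h1
  · rw [siteWeight, ENNReal.ofReal_eq_zero] at h1
    have : 0 < potentialKernel x ^ 2 := by positivity
    linarith
  · rw [condWalk_apply x (measurableSet_neverReturn _), ENNReal.tsum_eq_zero] at h1
    have h2 := (mul_eq_zero.1 (h1 y)).resolve_left (condStep_pos he hy hxy).ne'
    have h3 := condWalk_hit_le hy (potentialKernel x) (level (potentialKernel x) : Set Site)
      fun z hz => mem_level.1 hz
    have h4 : condWalk y (univ : Set (ℕ → Site)) ≤
        condWalk y {f | ∃ k, f k ∈ (level (potentialKernel x) : Set Site)} +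
        condWalk y (consPath x ⁻¹' neverReturn (level (potentialKernel x))) := by
      refine (measure_mono ?_).trans (measure_union_le _ _)
      intro f _
      by_cases hf : ∃ k, f k ∈ (level (potentialKernel x) : Set Site)
      · exact Or.inl hf
      · refine Or.inr fun k hk hmem => hf ?_
        cases k with
        | zero => omega
        | succ k => exact ⟨k, hmem⟩
    rw [measure_univ, h2, add_zero] at h4
    have h5 := h4.trans h3
    rw [invKernel, ← ENNReal.ofReal_mul hpx.le, ENNReal.one_le_ofReal, mul_one_div,
      one_le_div hpy] at h5
    linarith

/-- The intensity has infinite total mass: the capacities of the level sets of the potential kernel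
tend to infinity. -/
theorem tendsto_intensity_level :
    Filter.Tendsto (fun n : ℕ => intensity (hitSet (level n))) Filter.atTop (nhds ∞) := by
  set r₀ := potentialKernel (1, 0) with hr₀
  have h0 : 0 < r₀ := potentialKernel_pos (by decide)
  set c := intensity (hitSet (level r₀)) with hc
  have hc0 : c ≠ 0 := intensity_level_pos
  have hlow : ∀ n : ℕ, r₀ ≤ n → c * ENNReal.ofReal (n / (4 * r₀)) ≤ intensity (hitSet (level n)) := by
    intro n hn
    have hnpos : (0 : ℝ) < n := h0.trans_le hn
    have h1 := intensity_level_le h0 hn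
    calc c * ENNReal.ofReal (n / (4 * r₀))
        ≤ (ENNReal.ofReal (4 * r₀ / n) * intensity (hitSet (level n))) *
          ENNReal.ofReal (n / (4 * r₀)) := by gcongr
      _ = (ENNReal.ofReal (4 * r₀ / n) * ENNReal.ofReal (n / (4 * r₀))) *
          intensity (hitSet (level n)) := by ring
      _ = intensity (hitSet (level n)) := by
          rw [← ENNReal.ofReal_mul (by positivity)]
          have : 4 * r₀ / n * (n / (4 * r₀)) = 1 := by field_simp
          rw [this, ENNReal.ofReal_one, one_mul]
  have hlim : Filter.Tendsto (fun n : ℕ => c * ENNReal.ofReal (n / (4 * r₀))) Filter.atTop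
      (nhds (c * ∞)) := by
    refine ENNReal.Tendsto.const_mul ?_ (Or.inl ENNReal.top_ne_zero)
    refine ENNReal.tendsto_ofReal_nhds_top.2 ?_
    exact tendsto_natCast_atTop_atTop.atTop_div_const (by positivity)
  rw [ENNReal.mul_top hc0] at hlim
  refine tendsto_of_tendsto_of_tendsto_of_le_of_le' hlim tendsto_const_nhds ?_
    (Filter.Eventually.of_forall fun _ => le_top)
  filter_upwards [Filter.eventually_ge_atTop ⌈r₀⌉₊] with n hn
  exact hlow n (Nat.ceil_le.1 hn)

theorem iUnion_hitSet_level : ⋃ n : ℕ, hitSet (level n) = univ := by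
  refine eq_univ_of_forall fun ρ => ?_
  induction ρ using Quotient.inductionOn with
  | h w =>
    obtain ⟨n, hn⟩ := exists_nat_ge (potentialKernel (w.1 0))
    exact mem_iUnion.2 ⟨n, w.1 0, mem_level.2 hn, 0, rfl⟩

/-! ### Triviality of the tail of one trajectory -/

/-- The Liouville property of the conditioned walk. -/
theorem exists_const_of_harmonic_condStep (U : Site → ℝ≥0∞) (hU : ∀ x, U x ≤ 1)
    (hharm : ∀ x, x ≠ 0 → U x = ∑' y, condStep x y * U y) : ∃ c, ∀ x, x ≠ 0 → U x = c := by
  have hfin : ∀ x, U x ≠ ∞ := fun x => ne_top_of_le_ne_top ENNReal.one_ne_top (hU x)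
  obtain ⟨c, hc⟩ := exists_const_of_condHarmonic (fun x => (U x).toReal) 1 (fun x => by
      rw [abs_of_nonneg ENNReal.toReal_nonneg]
      exact ENNReal.toReal_le_of_le_ofReal zero_le_one (by simpa using hU x)) (by
    intro x hx
    have hp := potentialKernel_pos hx
    have h1 : (U x).toReal =
        ∑ y ∈ nbrs x, potentialKernel y / (4 * potentialKernel x) * (U y).toReal := by
      conv_lhs => rw [hharm x hx, tsum_condStep_mul hx]
      rw [ENNReal.toReal_sum fun y _ => ENNReal.mul_ne_top ((condStep x).apply_ne_top y) (hfin y)]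
      refine Finset.sum_congr rfl fun y hy => ?_
      have := potentialKernel_nonneg y
      rw [ENNReal.toReal_mul, condStep_of_ne hx, if_pos (mem_nbrs.1 hy),
        ENNReal.toReal_ofReal (by positivity)]
    rw [nbrAvg_eq_sum, h1, Finset.mul_sum, Finset.sum_div]
    refine Finset.sum_congr rfl fun y _ => ?_
    field_simp)
  refine ⟨ENNReal.ofReal c, fun x hx => ?_⟩
  rw [← hc x hx, ENNReal.ofReal_toReal (hfin x)]

/-- Two paths agree from some times on, up to a time shift. -/
def EvShiftEq (f g : ℕ → Site) : Prop := ∃ m n : ℕ, ∀ k, f (k + m) = g (k + n)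

theorem EvShiftEq.refl (f : ℕ → Site) : EvShiftEq f f := ⟨0, 0, fun _ => rfl⟩

theorem EvShiftEq.symm {f g : ℕ → Site} (h : EvShiftEq f g) : EvShiftEq g f := by
  obtain ⟨m, n, h⟩ := h
  exact ⟨n, m, fun k => (h k).symm⟩

theorem EvShiftEq.trans {f g h : ℕ → Site} (h1 : EvShiftEq f g) (h2 : EvShiftEq g h) :
    EvShiftEq f h := by
  obtain ⟨m, n, h1⟩ := h1
  obtain ⟨m', n', h2⟩ := h2
  refine ⟨m' + m, n + n', fun k => ?_⟩
  rw [← add_assoc, h1, ← add_assoc, ← h2, add_right_comm]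

theorem evShiftEq_consPath (x : Site) (f : ℕ → Site) : EvShiftEq (consPath x f) f :=
  ⟨1, 0, fun _ => rfl⟩

theorem consPath_mem_halfTrajSet {x : Site} {f : ℕ → Site} (hf : f ∈ halfTrajSet)
    (h : Adj x (f 0)) : consPath x f ∈ halfTrajSet := by
  refine ⟨fun k => ?_, fun y => ?_⟩
  · cases k with
    | zero => exact h
    | succ k => exact hf.1 k
  · refine (((hf.2 y).image Nat.succ).insert 0).subset fun k hk => ?_
    cases k with
    | zero => exact Or.inl rfl
    | succ k => exact Or.inr ⟨k, hk, rfl⟩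

/-- `c` attaches to the paths from `y` a fixed initial segment leading from `x` to `y`. -/
structure IsPrefix (x y : Site) (c : (ℕ → Site) → (ℕ → Site)) : Prop where
  measurable : Measurable c
  mem : ∀ f ∈ halfTrajSet, f 0 = y → c f ∈ halfTrajSet
  start : ∀ f ∈ halfTrajSet, f 0 = y → c f 0 = x
  evShiftEq : ∀ f ∈ halfTrajSet, f 0 = y → EvShiftEq (c f) f

theorem IsPrefix.refl (x : Site) : IsPrefix x x id :=
  ⟨measurable_id, fun _ h _ => h, fun _ _ h => h, fun f _ _ => EvShiftEq.refl f⟩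

theorem IsPrefix.cons {x y z : Site} {c : (ℕ → Site) → (ℕ → Site)} (hc : IsPrefix x y c)
    (h : Adj y z) : IsPrefix x z (c ∘ consPath y) := by
  have hm : ∀ f ∈ halfTrajSet, f 0 = z → consPath y f ∈ halfTrajSet := fun f hf h0 =>
    consPath_mem_halfTrajSet hf (by rwa [h0])
  exact ⟨hc.measurable.comp (measurable_consPath y), fun f hf h0 => hc.mem _ (hm f hf h0) rfl,
    fun f hf h0 => hc.start _ (hm f hf h0) rfl,
    fun f hf h0 => (hc.evShiftEq _ (hm f hf h0) rfl).trans (evShiftEq_consPath y f)⟩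

theorem exists_isPrefix {x y : Site} (hx : x ≠ 0) (hy : y ≠ 0) : ∃ c, IsPrefix x y c := by
  have h := pAdj_connected hx hy
  induction h with
  | refl => exact ⟨id, IsPrefix.refl x⟩
  | tail _ hbc ih =>
    obtain ⟨c, hc⟩ := ih hbc.2.1
    exact ⟨_, hc.cons hbc.1⟩

theorem condWalk_cyl_of_ne {x : Site} {s : ℕ → Site} (n : ℕ) (h : s 0 ≠ x) :
    condWalk x (cyl s n) = 0 := by
  refine measure_mono_null (t := cyl s 0) (fun f hf i hi => hf i (by omega)) ?_
  rw [condWalk_cyl_zero, if_neg h]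

/-- Zero-one law for the events of the conditioned walk that do not depend on a finite initial
segment, up to a time shift: the conditional probability of such an event given the past is a
bounded harmonic function of the current position, hence constant. -/
theorem condWalk_zero_one {x : Site} (hx : x ≠ 0) {B : Set (ℕ → Site)} (hB : MeasurableSet B)
    (hinv : ∀ f ∈ halfTrajSet, ∀ g ∈ halfTrajSet, f 0 = x → g 0 = x → EvShiftEq f g →
      (f ∈ B ↔ g ∈ B)) : condWalk x B = 0 ∨ condWalk x B = 1 := by
  classical
  -- Conditionally on an initial segment from `x` to `y`, the probability of `B` depends on `y` only.
  have hindep : ∀ {y : Site} {c c' : (ℕ → Site) → (ℕ → Site)}, y ≠ 0 → IsPrefix x y c →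
      IsPrefix x y c' → condWalk y (c ⁻¹' B) = condWalk y (c' ⁻¹' B) := by
    intro y c c' hy hc hc'
    refine measure_congr ?_
    filter_upwards [condWalk_start y, condWalk_halfTrajSet hy] with f h0 hf
    exact propext (hinv _ (hc.mem f hf h0) _ (hc'.mem f hf h0) (hc.start f hf h0)
      (hc'.start f hf h0) ((hc.evShiftEq f hf h0).trans (hc'.evShiftEq f hf h0).symm))
  choose! c hc using fun (y : Site) (hy : y ≠ 0) => exists_isPrefix hx hy
  obtain ⟨C, hC⟩ := exists_const_of_harmonic_condStep (fun y => condWalk y (c y ⁻¹' B))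
    (fun y => prob_le_one) (by
      intro y hy
      rw [condWalk_apply y ((hc y hy).measurable hB)]
      refine tsum_congr fun z => ?_
      by_cases hz : condStep y z = 0
      · simp [hz]
      · obtain ⟨h1, h2⟩ := condStep_ne_zero hy hz
        congr 1
        exact hindep h2 ((hc y hy).cons h1) (hc z h2))
  have hval : ∀ {y : Site} {c' : (ℕ → Site) → (ℕ → Site)}, y ≠ 0 → IsPrefix x y c' →
      condWalk y (c' ⁻¹' B) = C := fun hy hc' => (hindep hy hc' (hc _ hy)).trans (hC _ hy)
  -- The event is independent of all cylinders, hence of itself.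
  have hcyl : ∀ (n : ℕ) (s : ℕ → Site) (c' : (ℕ → Site) → (ℕ → Site)), s 0 ≠ 0 →
      IsPrefix x (s 0) c' →
      condWalk (s 0) (c' ⁻¹' B ∩ cyl s n) = C * condWalk (s 0) (cyl s n) := by
    intro n
    induction n with
    | zero =>
      intro s c' hs hc'
      rw [condWalk_cyl_zero, if_pos rfl, mul_one, ← hval hs hc']
      refine measure_congr ?_
      filter_upwards [condWalk_start (s 0)] with f hf
      refine propext ⟨fun h => h.1, fun h => ⟨h, fun i hi => ?_⟩⟩
      rw [Nat.le_zero.1 hi, hf]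
    | succ n ih =>
      intro s c' hs hc'
      rw [condWalk_apply _ ((hc'.measurable hB).inter (measurableSet_cyl s _)),
        condWalk_apply _ (measurableSet_cyl s _), ← ENNReal.tsum_mul_left]
      refine tsum_congr fun y => ?_
      by_cases hz : condStep (s 0) y = 0
      · simp [hz]
      obtain ⟨h1, h2⟩ := condStep_ne_zero hs hz
      rw [mul_left_comm, preimage_inter, consPath_preimage_cyl]
      simp only [true_and, ofPred_mem_eq]
      congr 1
      by_cases hy : s 1 = y
      · subst hy
        exact ih (fun i => s (i + 1)) (c' ∘ consPath (s 0)) h2 (hc'.cons h1)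
      · have h0 : condWalk y (cyl (fun i => s (i + 1)) n) = 0 := condWalk_cyl_of_ne n hy
        rw [measure_mono_null inter_subset_right h0, h0, mul_zero]
  have hC1 : condWalk x B = C := hval hx (IsPrefix.refl x)
  have hCtop : C ≠ ∞ := hC1 ▸ measure_ne_top _ _
  have : IsFiniteMeasure (C • condWalk x) := Measure.smul_finite _ hCtop
  have heq : (condWalk x).restrict B = C • condWalk x := by
    refine ext_of_cyl fun s n => ?_
    rw [Measure.restrict_apply (measurableSet_cyl s n), Measure.smul_apply, smul_eq_mul]
    by_cases hs : s 0 = x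
    · have := hcyl n s id (hs ▸ hx) (by rw [hs]; exact IsPrefix.refl x)
      rw [hs] at this
      rw [inter_comm]
      exact this
    · have h0 := condWalk_cyl_of_ne n hs
      rw [measure_mono_null inter_subset_left h0, h0, mul_zero]
  have hBB := congrArg (fun μ => μ B) heq
  simp only [Measure.restrict_apply hB, inter_self, Measure.smul_apply, smul_eq_mul] at hBB
  rw [hC1] at hBB ⊢
  by_cases h0 : C = 0
  · exact Or.inl h0
  · right
    exact ((ENNReal.mul_eq_left h0 hCtop).1 hBB.symm)

/-- Two doubly infinite paths agree, up to separate time shifts, in the far future and in the far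
past. -/
def TailEq (w w' : ℤ → Site) : Prop :=
  (∃ m n : ℤ, ∀ k : ℕ, w (m + k) = w' (n + k)) ∧ ∃ m n : ℤ, ∀ k : ℕ, w (m - k) = w' (n - k)

theorem tailEq_glue {f f' g g' : ℕ → Site} (hf : EvShiftEq f f') (hg : EvShiftEq g g') :
    TailEq (glue (f, g)) (glue (f', g')) := by
  obtain ⟨m, n, hf⟩ := hf
  obtain ⟨m', n', hg⟩ := hg
  refine ⟨⟨m, n, fun k => ?_⟩, ⟨-(m' + 1 : ℕ), -(n' + 1 : ℕ), fun k => ?_⟩⟩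
  · rw [← Nat.cast_add, ← Nat.cast_add, glue_of_nonneg, glue_of_nonneg, add_comm m, add_comm n]
    exact hf k
  · rw [show -((m' + 1 : ℕ) : ℤ) - k = -((k + 1 + m' : ℕ) : ℤ) by push_cast; ring,
      show -((n' + 1 : ℕ) : ℤ) - k = -((k + 1 + n' : ℕ) : ℤ) by push_cast; ring,
      glue_neg _ _ (by omega), glue_neg _ _ (by omega)]
    exact hg (k + 1)

/-- Sets of doubly infinite trajectories that do not depend on a finite portion of the trajectory
have probability zero or one for the two-sided walk from a fixed site. -/
theorem glue_zero_one {x : Site} (hx : x ≠ 0) {A : Set (ℤ → Site)} (hA : MeasurableSet A)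
    (hinv : ∀ w ∈ trajSet, ∀ w' ∈ trajSet, TailEq w w' → (w ∈ A ↔ w' ∈ A)) :
    ((condWalk x).prod (condWalk x)) (glue ⁻¹' A) = 0 ∨
      ((condWalk x).prod (condWalk x)) (glue ⁻¹' A) = 1 := by
  -- Fix the past and apply the zero-one law to the future; the set of pasts for which the
  -- conditional probability is one satisfies the zero-one law in turn.
  set φ : (ℕ → Site) → ℝ≥0∞ := fun g => condWalk x ((fun f => (f, g)) ⁻¹' (glue ⁻¹' A)) with hφ
  have hφm : Measurable φ := measurable_measure_prodMk_right (measurable_glue hA)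
  have hφ01 : ∀ g ∈ halfTrajSet, g 0 = x → φ g = 0 ∨ φ g = 1 := by
    intro g hg hg0
    refine condWalk_zero_one hx (measurableSet_preimage (by fun_prop) (measurable_glue hA)) ?_
    intro f hf f' hf' h0 h0' hff
    exact hinv _ (glue_mem_trajSet hf hg (h0.trans hg0.symm)) _
      (glue_mem_trajSet hf' hg (h0'.trans hg0.symm)) (tailEq_glue hff (EvShiftEq.refl g))
  have hGm : MeasurableSet (φ ⁻¹' {1}) := hφm (measurableSet_singleton 1)
  have hG : condWalk x (φ ⁻¹' {1}) = 0 ∨ condWalk x (φ ⁻¹' {1}) = 1 := by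
    refine condWalk_zero_one hx hGm ?_
    intro g hg g' hg' h0 h0' hgg
    have : φ g = φ g' := by
      refine measure_congr ?_
      filter_upwards [condWalk_start x, condWalk_halfTrajSet hx] with f hf0 hf
      exact propext (hinv _ (glue_mem_trajSet hf hg (hf0.trans h0.symm)) _
        (glue_mem_trajSet hf hg' (hf0.trans h0'.symm)) (tailEq_glue (EvShiftEq.refl f) hgg))
    simp [this]
  have heq : ((condWalk x).prod (condWalk x)) (glue ⁻¹' A) = condWalk x (φ ⁻¹' {1}) := by
    rw [Measure.prod_apply_symm (measurable_glue hA), ← lintegral_indicator_one hGm]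
    refine lintegral_congr_ae ?_
    filter_upwards [condWalk_start x, condWalk_halfTrajSet hx] with g hg0 hg
    change φ g = _
    rcases hφ01 g hg hg0 with h | h
    · rw [h, indicator_of_notMem]
      simp [h]
    · rw [h, indicator_of_mem]
      · rfl
      · exact h
  rw [heq]
  exact hG

/-- The alternative in the zero-one law is the same for two adjacent starting sites. -/
theorem glue_pathsOf_eq_zero_of_adj {A : Set TrajMod} (hA : MeasurableSet A)
    (hinv : ∀ w ∈ trajSet, ∀ w' ∈ trajSet, TailEq w w' → (w ∈ pathsOf A ↔ w' ∈ pathsOf A))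
    {x y : Site} (hxy : PAdj x y)
    (h0 : ((condWalk x).prod (condWalk x)) (glue ⁻¹' pathsOf A) = 0) :
    ((condWalk y).prod (condWalk y)) (glue ⁻¹' pathsOf A) = 0 := by
  obtain ⟨hadj, hx, hy⟩ := hxy
  have hm := measurable_glue (measurableSet_pathsOf hA)
  refine (glue_zero_one hy (measurableSet_pathsOf hA) hinv).resolve_right fun h1 => ?_
  -- Two-sided paths crossing the edge between `x` and `y` at time zero can be read from either of
  -- its ends: decompose at the first step backward from `x`, and at the first step forward from
  -- `y`. They would belong both to a null set and to a conull set.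
  rw [condWalk_prod_right x _ hm, ENNReal.tsum_eq_zero] at h0
  have h2 := (mul_eq_zero.1 (h0 y)).resolve_left (condStep_pos hx hy hadj).ne'
  have h1' : ((condWalk y).prod (condWalk y)) (glue ⁻¹' pathsOf A)ᶜ = 0 :=
    (prob_compl_eq_zero_iff hm).2 h1
  rw [condWalk_prod_left y _ hm.compl, ENNReal.tsum_eq_zero] at h1'
  have h3 := (mul_eq_zero.1 (h1' x)).resolve_left (condStep_pos hy hx hadj.symm).ne'
  have hcover : ((condWalk x).prod (condWalk y)) univ = 0 := by
    refine measure_mono_null (fun p _ => ?_) (measure_union_null (measure_union_null h2 h3)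
      (ae_iff.1 (condWalk_prod_start x y)))
    by_cases hp0 : p.1 0 = x ∧ p.2 0 = y
    · left
      by_cases hp : glue (p.1, consPath x p.2) ∈ pathsOf A
      · exact Or.inl hp
      · right
        rw [← shiftBy_one_glue, shiftBy_mem_pathsOf, hp0.2] at hp
        exact hp
    · exact Or.inr hp0
  rw [measure_univ] at hcover
  exact one_ne_zero hcover

/-- A set of trajectories modulo time shift that does not depend on finite portions of the
trajectories is null or conull for the intensity. -/
theorem intensity_zero_one {A : Set TrajMod} (hA : MeasurableSet A)
    (hinv : ∀ w ∈ trajSet, ∀ w' ∈ trajSet, TailEq w w' → (w ∈ pathsOf A ↔ w' ∈ pathsOf A)) :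
    intensity A = 0 ∨ intensity Aᶜ = 0 := by
  -- A set that is null for the two-sided walk from every site is null for the intensity.
  have hnull : ∀ B : Set TrajMod, MeasurableSet B → (∀ x : Site, x ≠ 0 →
      ((condWalk x).prod (condWalk x)) (glue ⁻¹' pathsOf B) = 0) → intensity B = 0 := by
    intro B hB h
    have hst : stationaryMeasure (pathsOf B) = 0 := by
      rw [stationaryMeasure_apply (measurableSet_pathsOf hB), ENNReal.tsum_eq_zero]
      intro x
      by_cases hx : x = 0
      · simp [hx]
      · rw [h x hx, mul_zero]
    rw [← inter_univ B, ← iUnion_hitSet_level, inter_iUnion]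
    refine measure_iUnion_null fun n => ?_
    rw [intensity_inter _ hB, hitIntensity_apply _ hB]
    exact measure_mono_null inter_subset_left hst
  have h10 : ((1, 0) : Site) ≠ 0 := by decide
  rcases glue_zero_one h10 (measurableSet_pathsOf hA) hinv with h | h
  · left
    refine hnull A hA fun x hx => ?_
    have hp := pAdj_connected h10 hx
    induction hp with
    | refl => exact h
    | tail _ hbc ih => exact glue_pathsOf_eq_zero_of_adj hA hinv hbc (ih hbc.2.1)
  · right
    have hcompl : ∀ w, w ∈ trajSet → (w ∈ pathsOf Aᶜ ↔ w ∉ pathsOf A) := by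
      intro w hw
      simp [mem_pathsOf, hw]
    have hinv' : ∀ w ∈ trajSet, ∀ w' ∈ trajSet, TailEq w w' →
        (w ∈ pathsOf Aᶜ ↔ w' ∈ pathsOf Aᶜ) := by
      intro w hw w' hw' ht
      rw [hcompl w hw, hcompl w' hw', hinv w hw w' hw' ht]
    have h' : ((condWalk (1, 0)).prod (condWalk (1, 0))) (glue ⁻¹' pathsOf Aᶜ) = 0 := by
      refine measure_mono_null (t := (glue ⁻¹' pathsOf A)ᶜ) (fun p hp hp' => ?_)
        ((prob_compl_eq_zero_iff (measurable_glue (measurableSet_pathsOf hA))).2 h)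
      exact (hcompl _ (mem_pathsOf.1 hp).1).1 hp hp'
    refine hnull _ hA.compl fun x hx => ?_
    have hp := pAdj_connected h10 hx
    induction hp with
    | refl => exact h'
    | tail _ hbc ih => exact glue_pathsOf_eq_zero_of_adj hA.compl hinv' hbc (ih hbc.2.1)

/-! ### Counts of a Poisson point process and the Mecke equation -/

section Poisson

variable {Ω X ι : Type*}

/-- The numbers of points of `S` in the sets of a family `A`. -/
noncomputable def counts (A : ι → Set X) (S : Set X) : ι → ℕ∞ := fun i => (S ∩ A i).encard

/-- The contribution of a single point `ρ` to the counts of a family `A`. -/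
noncomputable def pointCounts (A : ι → Set X) (ρ : X) : ι → ℕ∞ :=
  fun i => (A i).indicator (fun _ => 1) ρ

theorem pointCounts_of_mem {A : ι → Set X} {ρ : X} {i : ι} (h : ρ ∈ A i) :
    pointCounts A ρ i = 1 := indicator_of_mem h _

theorem pointCounts_of_notMem {A : ι → Set X} {ρ : X} {i : ι} (h : ρ ∉ A i) :
    pointCounts A ρ i = 0 := indicator_of_notMem h _

theorem add_single_injective [DecidableEq ι] (j : ι) :
    Function.Injective fun k : ι → ℕ∞ => k + Pi.single j 1 := by
  intro k k' h
  funext i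
  have hi := congrFun h i
  by_cases hij : i = j
  · subst hij
    simpa using hi
  · simpa [hij] using hi

variable [MeasurableSpace Ω] [MeasurableSpace X] {μ : Measure X} {P : Measure Ω}
  {I : Ω → Set X}

theorem measurable_pointCounts {A : ι → Set X} (hA : ∀ i, MeasurableSet (A i)) :
    Measurable (pointCounts A) :=
  measurable_pi_lambda _ fun i => measurable_const.indicator (hA i)

theorem IsPoissonPointProcess.measurable_counts (hI : IsPoissonPointProcess μ P I)
    {A : ι → Set X} (hA : ∀ i, MeasurableSet (A i)) : Measurable fun ω => counts A (I ω) :=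
  measurable_pi_lambda _ fun i => hI.measurable_count _ (hA i)

theorem IsPoissonPointProcess.measure_count_eq_natCast (hI : IsPoissonPointProcess μ P I)
    {B : Set X} (hB : MeasurableSet B) (hμ : μ B ≠ ∞) (k : ℕ) :
    P {ω | (I ω ∩ B).encard = k} = poissonMeasure (μ B).toNNReal {k} := by
  have h := congrArg (fun m : Measure ℕ∞ => m {(k : ℕ∞)}) (hI.law_count B hB hμ)
  rw [Measure.map_apply (hI.measurable_count B hB) .of_discrete,
    Measure.map_apply .of_discrete .of_discrete] at h
  refine h.trans (congrArg _ ?_)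
  ext m
  simp

theorem IsPoissonPointProcess.measure_count_eq_top (hI : IsPoissonPointProcess μ P I)
    {B : Set X} (hB : MeasurableSet B) (hμ : μ B ≠ ∞) :
    P {ω | (I ω ∩ B).encard = ⊤} = 0 := by
  have h := congrArg (fun m : Measure ℕ∞ => m {(⊤ : ℕ∞)}) (hI.law_count B hB hμ)
  rw [Measure.map_apply (hI.measurable_count B hB) .of_discrete,
    Measure.map_apply .of_discrete .of_discrete] at h
  refine h.trans ?_
  rw [show ((fun k : ℕ => (k : ℕ∞)) ⁻¹' {⊤}) = ∅ by ext m; simp]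
  simp

/-- The recurrence `(k + 1) P[N = k + 1] = μ(B) P[N = k]` of the Poisson weights. -/
theorem IsPoissonPointProcess.measure_count_succ (hI : IsPoissonPointProcess μ P I)
    {B : Set X} (hB : MeasurableSet B) (hμ : μ B ≠ ∞) (k : ℕ∞) :
    ((k + 1 : ℕ∞) : ℝ≥0∞) * P {ω | (I ω ∩ B).encard = k + 1} =
      μ B * P {ω | (I ω ∩ B).encard = k} := by
  induction k with
  | top => rw [top_add, hI.measure_count_eq_top hB hμ, mul_zero, mul_zero]
  | coe k =>
    have h := hI.measure_count_eq_natCast hB hμ (k + 1)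
    push_cast at h
    rw [h, hI.measure_count_eq_natCast hB hμ k, poissonMeasure_singleton, poissonMeasure_singleton]
    have e1 : ((((k : ℕ∞) + 1 : ℕ∞)) : ℝ≥0∞) = ENNReal.ofReal ((k : ℝ) + 1) := by
      rw [ENNReal.ofReal_add (by positivity) (by positivity)]
      simp
    have e2 : μ B = ENNReal.ofReal ((μ B).toNNReal : ℝ) := by
      rw [ENNReal.ofReal_coe_nnreal, ENNReal.coe_toNNReal hμ]
    rw [e1]
    generalize (μ B).toNNReal = r at e2
    rw [e2, ← ENNReal.ofReal_mul (by positivity), ← ENNReal.ofReal_mul (by positivity)]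
    congr 1
    rw [Nat.factorial_succ]
    push_cast
    have : (k : ℝ) + 1 ≠ 0 := by positivity
    field_simp
    ring

theorem IsPoissonPointProcess.iIndepFun_counts [Finite ι] (hI : IsPoissonPointProcess μ P I)
    {C : ι → Set X} (hC : ∀ i, MeasurableSet (C i))
    (hd : Pairwise fun i j => Disjoint (C i) (C j)) :
    iIndepFun (fun i ω => (I ω ∩ C i).encard) P := by
  obtain ⟨n, ⟨e⟩⟩ := Finite.exists_equiv_fin ι
  have h := hI.indep_count n (fun i => C (e.symm i)) (fun i => hC _)
    fun i j hij => hd (by simpa using hij)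
  have h2 := h.precomp e.injective
  simpa using h2

theorem IsPoissonPointProcess.measure_counts_eq [Fintype ι] (hI : IsPoissonPointProcess μ P I)
    {C : ι → Set X} (hC : ∀ i, MeasurableSet (C i))
    (hd : Pairwise fun i j => Disjoint (C i) (C j)) (k : ι → ℕ∞) :
    P {ω | counts C (I ω) = k} = ∏ j, P {ω | (I ω ∩ C j).encard = k j} := by
  have h := (hI.iIndepFun_counts hC hd).measure_inter_preimage_eq_mul Finset.univ
    (sets := fun i => {k i}) fun i _ => .of_discrete
  refine Eq.trans ?_ h
  congr 1
  ext ω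
  simp [counts, funext_iff]

theorem IsPoissonPointProcess.measure_counts_add_single [Fintype ι] [DecidableEq ι]
    (hI : IsPoissonPointProcess μ P I) {C : ι → Set X} (hC : ∀ i, MeasurableSet (C i))
    (hfin : ∀ i, μ (C i) ≠ ∞) (hd : Pairwise fun i j => Disjoint (C i) (C j)) (k : ι → ℕ∞)
    (j : ι) :
    ((k j + 1 : ℕ∞) : ℝ≥0∞) * P {ω | counts C (I ω) = k + Pi.single j 1} =
      μ (C j) * P {ω | counts C (I ω) = k} := by
  rw [hI.measure_counts_eq hC hd, hI.measure_counts_eq hC hd,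
    ← Finset.mul_prod_erase _ _ (Finset.mem_univ j), ← Finset.mul_prod_erase _ _ (Finset.mem_univ j),
    ← mul_assoc, ← mul_assoc, ← hI.measure_count_succ (hC j) (hfin j)]
  congr 1
  · simp
  · refine Finset.prod_congr rfl fun i hi => ?_
    simp [(Finset.mem_erase.1 hi).1]

/-- The Mecke equation for the counts of disjoint sets. -/
theorem IsPoissonPointProcess.lintegral_count_mul [Finite ι] [DecidableEq ι]
    (hI : IsPoissonPointProcess μ P I) {C : ι → Set X} (hC : ∀ i, MeasurableSet (C i))
    (hfin : ∀ i, μ (C i) ≠ ∞) (hd : Pairwise fun i j => Disjoint (C i) (C j)) (j : ι)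
    (ψ : (ι → ℕ∞) → ℝ≥0∞) :
    ∫⁻ ω, ((counts C (I ω) j : ℕ∞) : ℝ≥0∞) * ψ (counts C (I ω)) ∂P =
      μ (C j) * ∫⁻ ω, ψ (counts C (I ω) + Pi.single j 1) ∂P := by
  have := Fintype.ofFinite ι
  have hm := hI.measurable_counts hC
  have e1 := lintegral_map (μ := P) (f := fun v : ι → ℕ∞ => ((v j : ℕ∞) : ℝ≥0∞) * ψ v)
    .of_discrete hm
  have e2 := lintegral_map (μ := P) (f := fun v : ι → ℕ∞ => ψ (v + Pi.single j 1))
    .of_discrete hm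
  rw [← e1, ← e2, lintegral_countable', lintegral_countable', ← ENNReal.tsum_mul_left]
  simp_rw [Measure.map_apply hm (MeasurableSet.singleton _)]
  -- Both sides are sums over the values of the counts; the term with `k j = 0` vanishes on the left.
  have hinj := add_single_injective (ι := ι) j
  rw [← hinj.tsum_eq]
  · refine tsum_congr fun k => ?_
    have h := hI.measure_counts_add_single hC hfin hd k j
    simp only [Pi.add_apply, Pi.single_eq_same]
    calc _ = ψ (k + Pi.single j 1) * (((k j + 1 : ℕ∞) : ℝ≥0∞) *
          P {ω | counts C (I ω) = k + Pi.single j 1}) := by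
            rw [mul_comm (((k j + 1 : ℕ∞) : ℝ≥0∞)), mul_assoc]; rfl
      _ = _ := by rw [h, mul_left_comm]; rfl
  · intro k hk
    have hk0 : k j ≠ 0 := by
      intro h
      simp [h] at hk
    refine ⟨Function.update k j (k j - 1), ?_⟩
    funext i
    by_cases hij : i = j
    · subst hij
      simpa using tsub_add_cancel_of_le (Order.one_le_iff_ne_zero.2 hk0)
    · simp [hij]

end Poisson

section Poisson

variable {Ω X ι : Type*}

/-- The cells of the Venn diagram of a family `A`, without the cell outside of all the `A i`, which
may have infinite measure. -/
def vennCell (A : ι → Set X) (j : {j : Set ι // j.Nonempty}) : Set X := {ρ | {i | ρ ∈ A i} = j.1}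

open Classical in
/-- The counts of a family in terms of the counts of the cells of its Venn diagram. -/
noncomputable def vennSum [Finite ι] (v : {j : Set ι // j.Nonempty} → ℕ∞) (i : ι) : ℕ∞ :=
  ∑ᶠ j, if i ∈ j.1 then v j else 0

theorem vennCell_disjoint (A : ι → Set X) :
    Pairwise fun j j' => Disjoint (vennCell A j) (vennCell A j') := by
  intro j j' hj
  refine Set.disjoint_left.2 fun ρ h h' => hj (Subtype.ext ?_)
  rw [← show {i | ρ ∈ A i} = j.1 from h, ← show {i | ρ ∈ A i} = j'.1 from h']

theorem vennCell_subset {A : ι → Set X} {j : {j : Set ι // j.Nonempty}} {i : ι} (h : i ∈ j.1) :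
    vennCell A j ⊆ A i := fun ρ hρ => by
  have : i ∈ {i | ρ ∈ A i} := (show {i | ρ ∈ A i} = j.1 from hρ) ▸ h
  exact this

theorem iUnion_vennCell (A : ι → Set X) (i : ι) :
    ⋃ j : {j : {j : Set ι // j.Nonempty} // i ∈ j.1}, vennCell A j.1 = A i := by
  refine Subset.antisymm (iUnion_subset fun j => vennCell_subset j.2) fun ρ hρ => ?_
  exact mem_iUnion.2 ⟨⟨⟨{i | ρ ∈ A i}, i, hρ⟩, hρ⟩, rfl⟩

/-- The counts of a finite family are sums of counts of disjoint sets. -/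
theorem counts_eq_vennSum [Finite ι] (A : ι → Set X) (S : Set X) :
    counts A S = vennSum (counts (vennCell A) S) := by
  classical
  funext i
  have h : S ∩ A i = ⋃ j : {j : Set ι // j.Nonempty}, if i ∈ j.1 then S ∩ vennCell A j else ∅ := by
    rw [← iUnion_vennCell A i]
    ext ρ
    simp only [mem_inter_iff, mem_iUnion]
    constructor
    · rintro ⟨h, j, hj⟩
      exact ⟨j.1, by rw [if_pos j.2]; exact ⟨h, hj⟩⟩
    · rintro ⟨j, hj⟩
      split_ifs at hj with hij
      · exact ⟨hj.1, ⟨j, hij⟩, hj.2⟩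
      · exact hj.elim
  rw [counts, h, encard_iUnion_of_finite, vennSum]
  · refine finsum_congr fun j => ?_
    split_ifs <;> simp [counts]
  · intro j j' hj
    have := vennCell_disjoint A hj
    simp only [Function.onFun]
    split_ifs
    · exact this.mono inter_subset_right inter_subset_right
    all_goals simp

theorem vennSum_add_single [Finite ι] [DecidableEq {j : Set ι // j.Nonempty}]
    (v : {j : Set ι // j.Nonempty} → ℕ∞) {A : ι → Set X} {ρ : X} {j : {j : Set ι // j.Nonempty}}
    (hρ : ρ ∈ vennCell A j) :
    vennSum (v + Pi.single j 1) = vennSum v + pointCounts A ρ := by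
  classical
  funext i
  have hj : (i ∈ j.1) ↔ ρ ∈ A i := by
    rw [← show {i | ρ ∈ A i} = j.1 from hρ]; rfl
  simp only [vennSum, Pi.add_apply]
  have e : ∀ j', (if i ∈ j'.1 then v j' + (Pi.single j 1 : _ → ℕ∞) j' else 0) =
      (if i ∈ j'.1 then v j' else 0) + if j' = j then (if i ∈ j.1 then 1 else 0) else 0 := by
    intro j'
    by_cases h : j' = j
    · subst h
      rw [if_pos rfl]
      split_ifs <;> simp
    · simp [h]
  simp_rw [e]
  rw [finsum_add_distrib (toFinite _) (toFinite _)]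
  congr 1
  rw [finsum_eq_single _ j fun j' h => if_neg h, if_pos rfl, pointCounts, indicator_apply]
  simp only [hj]

theorem toENNReal_vennSum [Finite ι] (v : {j : Set ι // j.Nonempty} → ℕ∞) (i : ι) :
    ((vennSum v i : ℕ∞) : ℝ≥0∞) =
      ∑' j : {j : {j : Set ι // j.Nonempty} // i ∈ j.1}, ((v j.1 : ℕ∞) : ℝ≥0∞) := by
  classical
  have := Fintype.ofFinite {j : Set ι // j.Nonempty}
  have := Fintype.ofFinite {j : {j : Set ι // j.Nonempty} // i ∈ j.1}
  rw [vennSum, finsum_eq_sum_of_fintype, tsum_fintype, ← Finset.sum_filter,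
    Finset.sum_subtype (p := fun j => i ∈ j.1) _ (by simp)]
  exact map_sum ENat.toENNRealRingHom _ _

variable [MeasurableSpace Ω] [MeasurableSpace X] {μ : Measure X} {P : Measure Ω} {I : Ω → Set X}

theorem measurableSet_vennCell [Finite ι] {A : ι → Set X} (hA : ∀ i, MeasurableSet (A i))
    (j : {j : Set ι // j.Nonempty}) : MeasurableSet (vennCell A j) := by
  have : vennCell A j = ⋂ i, {ρ | ρ ∈ A i ↔ i ∈ j.1} := by
    ext ρ
    simp [vennCell, Set.ext_iff]
  rw [this]
  refine MeasurableSet.iInter fun i => ?_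
  by_cases h : i ∈ j.1
  · simpa [h] using hA i
  · simp only [h, iff_false]
    exact (hA i).compl

/-- The Mecke equation on a cell of the Venn diagram of a finite family. -/
theorem IsPoissonPointProcess.setLIntegral_vennCell [Finite ι]
    (hI : IsPoissonPointProcess μ P I) {A : ι → Set X} (hA : ∀ i, MeasurableSet (A i))
    (hfin : ∀ i, μ (A i) ≠ ∞) (T : Set (ι → ℕ∞)) (j : {j : Set ι // j.Nonempty}) :
    ∫⁻ ρ in vennCell A j, P {ω | counts A (I ω) + pointCounts A ρ ∈ T} ∂μ =
      ∫⁻ ω in {ω | counts A (I ω) ∈ T}, ((counts (vennCell A) (I ω) j : ℕ∞) : ℝ≥0∞) ∂P := by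
  classical
  have hCf : ∀ j, μ (vennCell A j) ≠ ∞ := fun j =>
    ne_top_of_le_ne_top (hfin j.2.some) (measure_mono (vennCell_subset j.2.some_mem))
  have hT : MeasurableSet {ω | counts A (I ω) ∈ T} := hI.measurable_counts hA .of_discrete
  have h := hI.lintegral_count_mul (measurableSet_vennCell hA) hCf (vennCell_disjoint A) j
    ((vennSum ⁻¹' T).indicator fun _ => 1)
  rw [← lintegral_indicator hT]
  refine Eq.trans ?_ (h.symm.trans (lintegral_congr fun ω => ?_))
  · rw [setLIntegral_congr_fun (g := fun _ => ∫⁻ ω, (vennSum ⁻¹' T).indicator (fun _ => 1)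
      (counts (vennCell A) (I ω) + Pi.single j 1) ∂P) (measurableSet_vennCell hA j),
      lintegral_const, Measure.restrict_apply_univ, mul_comm]
    intro ρ hρ
    have hset : MeasurableSet {ω | counts A (I ω) + pointCounts A ρ ∈ T} :=
      hI.measurable_counts hA (t := {v | v + pointCounts A ρ ∈ T}) .of_discrete
    change P {ω | counts A (I ω) + pointCounts A ρ ∈ T} = _
    rw [← lintegral_indicator_one hset]
    refine lintegral_congr fun ω => ?_
    simp only [indicator, mem_preimage, vennSum_add_single _ hρ, ← counts_eq_vennSum,
      mem_ofPred_eq, Pi.one_apply]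
  · simp only [indicator, mem_preimage, ← counts_eq_vennSum, mem_ofPred_eq]
    split_ifs <;> simp

/-- The Mecke equation for a member of a finite family of sets that may overlap. -/
theorem IsPoissonPointProcess.lintegral_count_of_finite [Finite ι]
    (hI : IsPoissonPointProcess μ P I) {A : ι → Set X} (hA : ∀ i, MeasurableSet (A i))
    (hfin : ∀ i, μ (A i) ≠ ∞) (i : ι) (T : Set (ι → ℕ∞)) :
    ∫⁻ ω in {ω | counts A (I ω) ∈ T}, ((counts A (I ω) i : ℕ∞) : ℝ≥0∞) ∂P =
      ∫⁻ ρ in A i, P {ω | counts A (I ω) + pointCounts A ρ ∈ T} ∂μ := by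
  have hU : Pairwise (Function.onFun Disjoint
      fun j : {j : {j : Set ι // j.Nonempty} // i ∈ j.1} => vennCell A j.1) :=
    fun j j' h => vennCell_disjoint A fun e => h (Subtype.ext e)
  have hm : ∀ j, Measurable fun ω => ((counts (vennCell A) (I ω) j : ℕ∞) : ℝ≥0∞) := fun j =>
    (Measurable.of_discrete (f := fun n : ℕ∞ => (n : ℝ≥0∞))).comp
      (hI.measurable_count _ (measurableSet_vennCell hA j))
  conv_rhs => rw [← iUnion_vennCell A i]
  rw [lintegral_iUnion (fun j => measurableSet_vennCell hA _) hU]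
  simp_rw [hI.setLIntegral_vennCell hA hfin]
  have hsum := lintegral_tsum (μ := P.restrict {ω | counts A (I ω) ∈ T})
    (f := fun (j : {j : {j : Set ι // j.Nonempty} // i ∈ j.1}) ω =>
      ((counts (vennCell A) (I ω) j.1 : ℕ∞) : ℝ≥0∞)) fun j => (hm j.1).aemeasurable
  refine Eq.trans (lintegral_congr fun ω => ?_) hsum
  rw [counts_eq_vennSum, toENNReal_vennSum]

end Poisson

section Poisson

variable {Ω X ι : Type*} [MeasurableSpace Ω] [MeasurableSpace X] {μ : Measure X} {P : Measure Ω}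
  {I : Ω → Set X}

theorem measurable_toENNReal_count (hI : IsPoissonPointProcess μ P I) {C : Set X}
    (hC : MeasurableSet C) : Measurable fun ω => (((I ω ∩ C).encard : ℕ∞) : ℝ≥0∞) :=
  (Measurable.of_discrete (f := fun n : ℕ∞ => (n : ℝ≥0∞))).comp (hI.measurable_count C hC)

/-- The Mecke equation for a finite family of counts. -/
theorem IsPoissonPointProcess.lintegral_count_inter_of_finite [Finite ι]
    (hI : IsPoissonPointProcess μ P I) {A : ι → Set X} (hA : ∀ i, MeasurableSet (A i))
    (hfin : ∀ i, μ (A i) ≠ ∞) {C : Set X} (hC : MeasurableSet C) (hCf : μ C ≠ ∞)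
    (T : Set (ι → ℕ∞)) :
    ∫⁻ ω in {ω | counts A (I ω) ∈ T}, (((I ω ∩ C).encard : ℕ∞) : ℝ≥0∞) ∂P =
      ∫⁻ ρ in C, P {ω | counts A (I ω) + pointCounts A ρ ∈ T} ∂μ := by
  have hA' : ∀ i : Option ι, MeasurableSet (i.elim C A) := by
    rintro (_ | i)
    exacts [hC, hA i]
  have hfin' : ∀ i : Option ι, μ (i.elim C A) ≠ ∞ := by
    rintro (_ | i)
    exacts [hCf, hfin i]
  exact hI.lintegral_count_of_finite hA' hfin' none {v | (fun i => v (some i)) ∈ T}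

theorem measurable_counts_add (hI : IsPoissonPointProcess μ P I) {A : ι → Set X}
    (hA : ∀ i, MeasurableSet (A i)) :
    Measurable fun p : Ω × X => counts A (I p.1) + pointCounts A p.2 := by
  refine measurable_pi_lambda _ fun i => ?_
  exact ((measurable_pi_apply i).comp ((hI.measurable_counts hA).comp measurable_fst)).add
    ((measurable_pi_apply i).comp ((measurable_pointCounts hA).comp measurable_snd))

/-- The Mecke equation: a point of the process in `C`, chosen at random, is seen by the remaining
process as a point added at a location distributed according to `μ`. -/
theorem IsPoissonPointProcess.lintegral_count_inter [IsProbabilityMeasure P]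
    (hI : IsPoissonPointProcess μ P I) {A : ι → Set X} (hA : ∀ i, MeasurableSet (A i))
    (hfin : ∀ i, μ (A i) ≠ ∞) {C : Set X} (hC : MeasurableSet C) (hCf : μ C ≠ ∞)
    {T : Set (ι → ℕ∞)} (hT : MeasurableSet T) :
    ∫⁻ ω in {ω | counts A (I ω) ∈ T}, (((I ω ∩ C).encard : ℕ∞) : ℝ≥0∞) ∂P =
      ∫⁻ ρ in C, P {ω | counts A (I ω) + pointCounts A ρ ∈ T} ∂μ := by
  have : IsFiniteMeasure (μ.restrict C) := ⟨by simpa using hCf.lt_top⟩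
  -- Both sides are finite measures of `T`; they have the same finite-dimensional marginals.
  set m₁ := (P.withDensity fun ω => (((I ω ∩ C).encard : ℕ∞) : ℝ≥0∞)).map
    fun ω => counts A (I ω) with hm₁
  set m₂ := (P.prod (μ.restrict C)).map
    (fun p : Ω × X => counts A (I p.1) + pointCounts A p.2) with hm₂
  have e₁ : ∀ T, MeasurableSet T → m₁ T =
      ∫⁻ ω in {ω | counts A (I ω) ∈ T}, (((I ω ∩ C).encard : ℕ∞) : ℝ≥0∞) ∂P := fun T hT => by
    rw [hm₁, Measure.map_apply (hI.measurable_counts hA) hT,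
      withDensity_apply _ (hI.measurable_counts hA hT)]
    rfl
  have e₂ : ∀ T, MeasurableSet T → m₂ T =
      ∫⁻ ρ in C, P {ω | counts A (I ω) + pointCounts A ρ ∈ T} ∂μ := fun T hT => by
    rw [hm₂, Measure.map_apply (measurable_counts_add hI hA) hT,
      Measure.prod_apply_symm (measurable_counts_add hI hA hT)]
    rfl
  rw [← e₁ T hT, ← e₂ T hT]
  congr 1
  refine IsProjectiveLimit.unique (P := fun s : Finset ι => m₂.map s.restrict) (fun s => ?_)
    fun s => rfl
  ext S hS
  have hr := Finset.measurable_restrict (X := fun _ : ι => ℕ∞) s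
  rw [Measure.map_apply hr hS, Measure.map_apply hr hS, e₁ _ (hr hS), e₂ _ (hr hS)]
  exact hI.lintegral_count_inter_of_finite (A := fun i : s => A i) (fun i => hA i)
    (fun i => hfin i) hC hCf S

theorem IsPoissonPointProcess.lintegral_count [IsProbabilityMeasure P]
    (hI : IsPoissonPointProcess μ P I) {C : Set X} (hC : MeasurableSet C) (hCf : μ C ≠ ∞) :
    ∫⁻ ω, (((I ω ∩ C).encard : ℕ∞) : ℝ≥0∞) ∂P = μ C := by
  have h := hI.lintegral_count_inter (A := Empty.elim) (fun i => i.elim) (fun i => i.elim) hC hCf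
    MeasurableSet.univ
  simpa using h

theorem IsPoissonPointProcess.lintegral_count_sq [IsProbabilityMeasure P]
    (hI : IsPoissonPointProcess μ P I) {C : Set X} (hC : MeasurableSet C) (hCf : μ C ≠ ∞) :
    ∫⁻ ω, (((I ω ∩ C).encard : ℕ∞) : ℝ≥0∞) * (((I ω ∩ C).encard : ℕ∞) : ℝ≥0∞) ∂P =
      μ C * (μ C + 1) := by
  have h := hI.lintegral_count_mul (C := fun _ : Unit => C) (fun _ => hC) (fun _ => hCf)
    (fun i j hij => (hij rfl).elim) () (fun v => ((v () : ℕ∞) : ℝ≥0∞))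
  simp only [counts, Pi.add_apply, Pi.single_eq_same, ENat.toENNReal_add, ENat.toENNReal_one] at h
  rw [h, lintegral_add_left (measurable_toENNReal_count hI hC), hI.lintegral_count hC hCf]
  simp

/-- The law of large numbers for the counts of sets of large measure, in the form in which it is
used: the correlation of the count of `C` with an event `F` is close to `μ(C) P[F]`. -/
theorem IsPoissonPointProcess.abs_sub_le [IsProbabilityMeasure P]
    (hI : IsPoissonPointProcess μ P I) {C : Set X} (hC : MeasurableSet C) (hCf : μ C ≠ ∞)
    {F : Set Ω} (hF : MeasurableSet F) {c : ℝ} (hc : 0 ≤ c)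
    (h : ∫⁻ ω in F, (((I ω ∩ C).encard : ℕ∞) : ℝ≥0∞) ∂P = ENNReal.ofReal c * μ C) :
    (c - P.real F) ^ 2 * (μ C).toReal ≤ 1 := by
  set N : Ω → ℝ≥0∞ := fun ω => (((I ω ∩ C).encard : ℕ∞) : ℝ≥0∞) with hN
  set M := (μ C).toReal with hM
  set f : Ω → ℝ := fun ω => (N ω).toReal with hf
  have hNm : Measurable N := measurable_toENNReal_count hI hC
  have h1 : ∫⁻ ω, N ω ∂P = μ C := hI.lintegral_count hC hCf
  have h2 : ∫⁻ ω, N ω * N ω ∂P = μ C * (μ C + 1) := hI.lintegral_count_sq hC hCf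
  have hfi : Integrable f P :=
    integrable_toReal_of_lintegral_ne_top hNm.aemeasurable (by rw [h1]; exact hCf)
  have htop : μ C * (μ C + 1) ≠ ∞ := by finiteness
  have hfi2 : Integrable (fun ω => f ω * f ω) P := by
    have := integrable_toReal_of_lintegral_ne_top (hNm.mul hNm).aemeasurable
      (μ := P) (by simpa [h2] using htop)
    simpa [hf] using this
  have hae : ∀ᵐ ω ∂P, N ω < ∞ := ae_lt_top hNm (by rw [h1]; exact hCf)
  have i1 : ∫ ω, f ω ∂P = M := by
    rw [hf, integral_toReal hNm.aemeasurable hae, h1]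
  have i2 : ∫ ω, f ω * f ω ∂P = M * (M + 1) := by
    have : ∀ ω, f ω * f ω = (N ω * N ω).toReal := fun ω => by simp [hf]
    simp_rw [this]
    rw [integral_toReal (f := fun ω => N ω * N ω) (hNm.mul hNm).aemeasurable, h2, ENNReal.toReal_mul,
      ENNReal.toReal_add hCf (by simp)]
    · simp [hM]
    · filter_upwards [hae] with ω hω using ENNReal.mul_lt_top hω hω
  have i3 : ∫ ω in F, f ω ∂P = c * M := by
    rw [hf, integral_toReal hNm.aemeasurable (ae_restrict_of_ae hae), h, ENNReal.toReal_mul,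
      ENNReal.toReal_ofReal hc]
  set p := P.real F with hp
  -- `t` is the optimal choice in `0 ≤ E[(N - M - t 1_F)²]`, up to replacing `P[F]` by one.
  set t := (c - p) * M with ht
  have hFi : Integrable (F.indicator f) P := hfi.indicator hF
  have hF1 : Integrable (F.indicator fun _ => (1 : ℝ)) P := (integrable_const 1).indicator hF
  have hexp : ∀ ω, (f ω - M - t * F.indicator (fun _ => (1 : ℝ)) ω) ^ 2 =
      f ω * f ω - 2 * M * f ω + M ^ 2 - 2 * t * F.indicator f ω
        + (2 * t * M + t ^ 2) * F.indicator (fun _ => (1 : ℝ)) ω := by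
    intro ω
    by_cases hω : ω ∈ F
    · simp only [indicator_of_mem hω]; ring
    · simp only [indicator_of_notMem hω]; ring
  have hnn : 0 ≤ ∫ ω, (f ω - M - t * F.indicator (fun _ => (1 : ℝ)) ω) ^ 2 ∂P :=
    integral_nonneg fun ω => sq_nonneg _
  simp_rw [hexp] at hnn
  rw [integral_add, integral_sub, integral_add, integral_sub, integral_const_mul,
    integral_const_mul, integral_const_mul, integral_indicator hF, integral_indicator hF, i1, i2, i3,
    integral_const, integral_const] at hnn
  · simp only [probReal_univ, measureReal_restrict_apply_univ, smul_eq_mul, one_mul, mul_one,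
      ← hp] at hnn
    have hp1 : p ≤ 1 := measureReal_le_one
    have hM0 : 0 ≤ M := ENNReal.toReal_nonneg
    have hkey : t ^ 2 ≤ M := by nlinarith [sq_nonneg t, mul_nonneg (sq_nonneg t) (sub_nonneg.2 hp1)]
    rcases hM0.eq_or_lt with h0 | h0
    · simp [← h0]
    · rw [ht, mul_pow] at hkey
      have : ((c - p) ^ 2 * M) * M ≤ 1 * M := by linarith
      exact le_of_mul_le_mul_right this h0
  all_goals fun_prop

end Poisson

/-! ### A zero-one law for Poisson point processes -/

section Poisson

variable {Ω X ι J : Type*}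

theorem pointCounts_of_disjoint {C : J → Set X} {ρ : X} (h : ∀ j, ρ ∉ C j) :
    pointCounts C ρ = 0 := by
  funext j
  exact pointCounts_of_notMem (h j)

theorem pointCounts_eq_single [DecidableEq J] {C : J → Set X}
    (hd : Pairwise fun i j => Disjoint (C i) (C j)) {j : J} {ρ : X} (h : ρ ∈ C j) :
    pointCounts C ρ = Pi.single j 1 := by
  funext i
  by_cases hij : i = j
  · subst hij
    simp [pointCounts_of_mem h]
  · rw [pointCounts_of_notMem (Set.disjoint_left.1 (hd (Ne.symm hij)) h), Pi.single_eq_of_ne hij]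

variable [MeasurableSpace Ω] [MeasurableSpace X] {μ : Measure X} {P : Measure Ω} {I : Ω → Set X}

theorem IsPoissonPointProcess.lintegral_count_inter_and [IsProbabilityMeasure P] [Finite J]
    (hI : IsPoissonPointProcess μ P I) {A : ι → Set X} (hA : ∀ i, MeasurableSet (A i))
    (hfin : ∀ i, μ (A i) ≠ ∞) {C : J → Set X} (hC : ∀ j, MeasurableSet (C j))
    (hCf : ∀ j, μ (C j) ≠ ∞) {B : Set X} (hB : MeasurableSet B) (hBf : μ B ≠ ∞)
    {S : Set (ι → ℕ∞)} (hS : MeasurableSet S) (k : J → ℕ∞) :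
    ∫⁻ ω in {ω | counts A (I ω) ∈ S ∧ counts C (I ω) = k},
        (((I ω ∩ B).encard : ℕ∞) : ℝ≥0∞) ∂P =
      ∫⁻ ρ in B, P {ω | counts A (I ω) + pointCounts A ρ ∈ S ∧
        counts C (I ω) + pointCounts C ρ = k} ∂μ := by
  have hS1 : MeasurableSet {v : ι ⊕ J → ℕ∞ | (fun i => v (.inl i)) ∈ S} :=
    measurableSet_preimage (f := fun (v : ι ⊕ J → ℕ∞) i => v (.inl i)) (by fun_prop) hS
  have hS2 : MeasurableSet {v : ι ⊕ J → ℕ∞ | (fun j => v (.inr j)) ∈ ({k} : Set (J → ℕ∞))} :=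
    measurableSet_preimage (f := fun (v : ι ⊕ J → ℕ∞) j => v (.inr j)) (by fun_prop) .of_discrete
  exact hI.lintegral_count_inter (A := Sum.elim A C) (Sum.rec hA hC) (Sum.rec hfin hCf) hB hBf
    (hS1.inter hS2)

/-- The probability that an event expressed by the counts of `A` holds after an additional point is
inserted depends measurably on the contribution of the point to these counts. -/
theorem measurable_measure_insert [IsProbabilityMeasure P] (hI : IsPoissonPointProcess μ P I)
    {A : ι → Set X} (hA : ∀ i, MeasurableSet (A i)) {S : Set (ι → ℕ∞)} (hS : MeasurableSet S)
    {D : Set Ω} (hD : MeasurableSet D) :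
    Measurable[MeasurableSpace.comap (pointCounts A) MeasurableSpace.pi]
      fun ρ => P ({ω | counts A (I ω) + pointCounts A ρ ∈ S} ∩ D) := by
  have hadd : Measurable fun p : (ι → ℕ∞) × Ω => counts A (I p.2) + p.1 := by
    refine measurable_pi_lambda _ fun i => ?_
    exact ((measurable_pi_apply i).comp ((hI.measurable_counts hA).comp measurable_snd)).add
      ((measurable_pi_apply i).comp measurable_fst)
  have hg : Measurable fun v : ι → ℕ∞ => P ({ω | counts A (I ω) + v ∈ S} ∩ D) :=
    measurable_measure_prodMk_left ((hadd hS).inter (measurable_snd hD))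
  exact hg.comp (comap_measurable _)

/-- A sequence of functions that agree almost everywhere, the `n`-th of which is measurable with
respect to `G n`, has a common limit superior that is measurable with respect to the tail `⋂ G n`;
if the tail is trivial, it is almost everywhere constant. -/
theorem exists_ae_const_of_tail [SigmaFinite μ] {G : ℕ → MeasurableSpace X}
    (hG : Antitone G)
    (htail : ∀ T, (∀ n, MeasurableSet[G n] T) → μ T = 0 ∨ μ Tᶜ = 0) {φ : ℕ → X → ℝ≥0∞}
    (hφ : ∀ n, Measurable[G n] (φ n)) (hae : ∀ n, φ n =ᵐ[μ] φ 0) :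
    ∃ c, φ 0 =ᵐ[μ] fun _ => c := by
  set ψ : X → ℝ≥0∞ := fun ρ => Filter.limsup (fun n => φ n ρ) Filter.atTop with hψ
  have hψm : ∀ m, Measurable[G m] ψ := by
    intro m
    have : ψ = fun ρ => Filter.limsup (fun n => φ (n + m) ρ) Filter.atTop := by
      funext ρ
      exact (Filter.limsup_nat_add (fun n => φ n ρ) m).symm
    rw [this]
    exact @Measurable.limsup _ _ _ _ _ (G m) _ _ _ _ fun n =>
      (hφ (n + m)).mono (hG (Nat.le_add_left m n)) le_rfl
  have hψ0 : ψ =ᵐ[μ] φ 0 := by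
    filter_upwards [ae_all_iff.2 hae] with ρ hρ
    simp only [hψ, hρ]
    exact Filter.limsup_const _
  obtain ⟨c, hc⟩ := Filter.exists_eventuallyEq_const_of_forall_separating (l := ae μ) (f := ψ)
    MeasurableSet fun U hU => by
      rcases htail (ψ ⁻¹' U) fun n => hψm n hU with h | h
      · right
        rw [ae_iff]
        simp only [not_not]
        exact h
      · left
        exact h
  exact ⟨c, hψ0.symm.trans hc⟩

/-- If an event `E` is a tail event for a sequence of families of counts, then inserting a point
changes the probability of `E ∩ {counts C = k}` to a constant that does not depend on the location
of the point. -/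
theorem exists_const_of_tail [IsProbabilityMeasure P] [SigmaFinite μ]
    (hI : IsPoissonPointProcess μ P I) {ι : ℕ → Type*} {A : ∀ n, ι n → Set X}
    (hA : ∀ n i, MeasurableSet (A n i)) (hfin : ∀ n i, μ (A n i) ≠ ∞)
    (hanti : Antitone fun n => MeasurableSpace.comap (pointCounts (A n)) MeasurableSpace.pi)
    (htail : ∀ T, (∀ n, MeasurableSet[MeasurableSpace.comap (pointCounts (A n))
      MeasurableSpace.pi] T) → μ T = 0 ∨ μ Tᶜ = 0)
    {E : Set Ω} {S : ∀ n, Set (ι n → ℕ∞)} (hS : ∀ n, MeasurableSet (S n))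
    (hE : ∀ n, E = {ω | counts (A n) (I ω) ∈ S n}) [Finite J] [DecidableEq J] {C : J → Set X}
    (hC : ∀ j, MeasurableSet (C j)) (hCf : ∀ j, μ (C j) ≠ ∞)
    (hd : Pairwise fun i j => Disjoint (C i) (C j)) (k : J → ℕ∞) :
    ∃ c : ℝ≥0∞,
      (∀ B, MeasurableSet B → μ B ≠ ∞ → (∀ j, Disjoint B (C j)) →
        ∫⁻ ω in E ∩ {ω | counts C (I ω) = k}, (((I ω ∩ B).encard : ℕ∞) : ℝ≥0∞) ∂P = c * μ B) ∧
      ∀ j, ((k j + 1 : ℕ∞) : ℝ≥0∞) * P (E ∩ {ω | counts C (I ω) = k + Pi.single j 1}) =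
        c * μ (C j) := by
  set D : Set Ω := {ω | counts C (I ω) = k} with hD
  have hDm : ∀ k, MeasurableSet {ω | counts C (I ω) = k} := fun k =>
    hI.measurable_counts hC (MeasurableSet.singleton k)
  set φ : ℕ → X → ℝ≥0∞ := fun n ρ =>
    P ({ω | counts (A n) (I ω) + pointCounts (A n) ρ ∈ S n} ∩ D) with hφ
  -- By the Mecke equation, the integrals of `φ n` over subsets of one of the sets `C j`, or of the
  -- complement of their union, are probabilistic quantities in which `n` does not occur.
  have hout : ∀ n B, MeasurableSet B → μ B ≠ ∞ → (∀ j, Disjoint B (C j)) →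
      ∫⁻ ω in E ∩ D, (((I ω ∩ B).encard : ℕ∞) : ℝ≥0∞) ∂P = ∫⁻ ρ in B, φ n ρ ∂μ := by
    intro n B hB hBf hdis
    have h := hI.lintegral_count_inter_and (hA n) (hfin n) hC hCf hB hBf (hS n) k
    rw [hE n]
    refine h.trans (setLIntegral_congr_fun hB fun ρ hρ => ?_)
    simp only [pointCounts_of_disjoint fun j => Set.disjoint_left.1 (hdis j) hρ, add_zero]
    rfl
  have hin : ∀ n j B, MeasurableSet B → B ⊆ C j →
      ∫⁻ ω in E ∩ {ω | counts C (I ω) = k + Pi.single j 1},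
        (((I ω ∩ B).encard : ℕ∞) : ℝ≥0∞) ∂P = ∫⁻ ρ in B, φ n ρ ∂μ := by
    intro n j B hB hBC
    have h := hI.lintegral_count_inter_and (hA n) (hfin n) hC hCf hB
      (ne_top_of_le_ne_top (hCf j) (measure_mono hBC)) (hS n) (k + Pi.single j 1)
    rw [hE n]
    refine h.trans (setLIntegral_congr_fun hB fun ρ hρ => ?_)
    simp only [pointCounts_eq_single hd (hBC hρ), (add_single_injective j).eq_iff]
    rfl
  have hφm : ∀ n, Measurable[MeasurableSpace.comap (pointCounts (A n)) MeasurableSpace.pi] (φ n) :=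
    fun n => measurable_measure_insert hI (hA n) (hS n) (hDm k)
  have hle : ∀ n, MeasurableSpace.comap (pointCounts (A n)) MeasurableSpace.pi ≤
      ‹MeasurableSpace X› := fun n => (measurable_pointCounts (hA n)).comap_le
  have hae : ∀ n, φ n =ᵐ[μ] φ 0 := by
    intro n
    refine ae_eq_of_forall_setLIntegral_eq_of_sigmaFinite ((hφm n).mono (hle n) le_rfl)
      ((hφm 0).mono (hle 0) le_rfl) fun s hs hsf => ?_
    have hU : MeasurableSet (⋃ j, C j) := MeasurableSet.iUnion hC
    rw [← lintegral_inter_add_sdiff (φ n) s hU, ← lintegral_inter_add_sdiff (φ 0) s hU, inter_iUnion]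
    have hdis : Pairwise (Function.onFun Disjoint fun j => s ∩ C j) := fun i j hij =>
      (hd hij).mono inter_subset_right inter_subset_right
    rw [lintegral_iUnion (fun j => hs.inter (hC j)) hdis,
      lintegral_iUnion (fun j => hs.inter (hC j)) hdis]
    congr 1
    · refine tsum_congr fun j => ?_
      rw [← hin n j _ (hs.inter (hC j)) inter_subset_right,
        ← hin 0 j _ (hs.inter (hC j)) inter_subset_right]
    · have hB := hs.diff hU
      have hBf : μ (s \ ⋃ j, C j) ≠ ∞ := ne_top_of_le_ne_top hsf.ne (measure_mono sdiff_subset)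
      have hBd : ∀ j, Disjoint (s \ ⋃ j, C j) (C j) := fun j =>
        Set.disjoint_left.2 fun ρ h h' => h.2 (mem_iUnion.2 ⟨j, h'⟩)
      rw [← hout n _ hB hBf hBd, ← hout 0 _ hB hBf hBd]
  obtain ⟨c, hc⟩ := exists_ae_const_of_tail hanti htail hφm hae
  refine ⟨c, fun B hB hBf hdis => ?_, fun j => ?_⟩
  · rw [hout 0 B hB hBf hdis, lintegral_congr_ae (ae_restrict_of_ae hc), setLIntegral_const]
  · have hm : MeasurableSet (E ∩ {ω | counts C (I ω) = k + Pi.single j 1}) := by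
      rw [hE 0]
      exact (hI.measurable_counts (hA 0) (hS 0)).inter (hDm _)
    have h := hin 0 j (C j) (hC j) le_rfl
    rw [lintegral_congr_ae (ae_restrict_of_ae hc), setLIntegral_const] at h
    rw [← h, setLIntegral_congr_fun (g := fun _ => ((k j + 1 : ℕ∞) : ℝ≥0∞)) hm, setLIntegral_const]
    rintro ω ⟨-, hω⟩
    have : counts C (I ω) j = k j + 1 := by
      rw [show counts C (I ω) = k + Pi.single j 1 from hω]
      simp
    simp only [← this]
    rfl

end Poisson

section Poisson

variable {Ω X J : Type*}

/-- Two families of weights that satisfy the Poisson recurrence are proportional. -/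
theorem mul_eq_mul_of_recurrence [Fintype J] [DecidableEq J] {p q : (J → ℕ∞) → ℝ≥0∞}
    {m : J → ℝ≥0∞}
    (hp : ∀ k j, ((k j + 1 : ℕ∞) : ℝ≥0∞) * p (k + Pi.single j 1) = m j * p k)
    (hq : ∀ k j, ((k j + 1 : ℕ∞) : ℝ≥0∞) * q (k + Pi.single j 1) = m j * q k) (k : J → ℕ) :
    q (fun j => (k j : ℕ∞)) * p 0 = q 0 * p (fun j => (k j : ℕ∞)) := by
  induction hn : ∑ j, k j generalizing k with
  | zero =>
    have : (fun j => (k j : ℕ∞)) = 0 := by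
      funext j
      have := (Finset.sum_eq_zero_iff.1 hn) j (Finset.mem_univ j)
      simp [this]
    rw [this]
  | succ n ih =>
    obtain ⟨j, -, hj⟩ : ∃ j ∈ Finset.univ, k j ≠ 0 := by
      by_contra! h
      rw [Finset.sum_eq_zero h] at hn
      omega
    set k' : J → ℕ := Function.update k j (k j - 1) with hk'
    have hk'j : k' j + 1 = k j := by simp [hk']; omega
    have hkk : (fun i => (k i : ℕ∞)) = (fun i => (k' i : ℕ∞)) + Pi.single j 1 := by
      funext i
      by_cases hij : i = j
      · subst hij
        rw [← hk'j]
        simp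
      · simp [hk', hij]
    have hsum : ∑ i, k' i = n := by
      have e1 := Finset.add_sum_erase Finset.univ k (Finset.mem_univ j)
      have e2 := Finset.add_sum_erase Finset.univ k' (Finset.mem_univ j)
      have e3 : ∑ i ∈ Finset.univ.erase j, k' i = ∑ i ∈ Finset.univ.erase j, k i :=
        Finset.sum_congr rfl fun i hi => by simp [hk', (Finset.mem_erase.1 hi).1]
      omega
    have h := ih k' hsum
    rw [hkk]
    have h1 := hp (fun i => (k' i : ℕ∞)) j
    have h2 := hq (fun i => (k' i : ℕ∞)) j
    set r : ℝ≥0∞ := (((k' j : ℕ∞) + 1 : ℕ∞) : ℝ≥0∞) with hr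
    have hr0 : r ≠ 0 := by simp [hr]
    have hrt : r ≠ ∞ := by simp [hr]
    refine (ENNReal.mul_right_inj hr0 hrt).1 ?_
    rw [← mul_assoc, h2, mul_assoc, h, mul_left_comm r, h1, mul_left_comm]

variable [MeasurableSpace Ω] [MeasurableSpace X] {μ : Measure X} {P : Measure Ω} {I : Ω → Set X}

theorem IsPoissonPointProcess.measure_counts_zero_ne_zero [Finite J]
    (hI : IsPoissonPointProcess μ P I) {C : J → Set X} (hC : ∀ j, MeasurableSet (C j))
    (hCf : ∀ j, μ (C j) ≠ ∞) (hd : Pairwise fun i j => Disjoint (C i) (C j)) :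
    P {ω | counts C (I ω) = 0} ≠ 0 := by
  have := Fintype.ofFinite J
  rw [hI.measure_counts_eq hC hd]
  refine Finset.prod_ne_zero_iff.2 fun j _ => ?_
  have h := hI.measure_count_eq_natCast (hC j) (hCf j) 0
  rw [poissonMeasure_singleton] at h
  simp only [Nat.cast_zero] at h
  simp only [Pi.zero_apply, h]
  simp [Real.exp_pos]

theorem tsum_measure_singleton {α : Type*} [Countable α] [MeasurableSpace α]
    [MeasurableSingletonClass α] (m : Measure α) : ∑' a, m {a} = m univ := by
  rw [← lintegral_one, lintegral_countable']
  simp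

/-- An event whose intersections with all the events `{counts C = k}` satisfy the Poisson
recurrence is independent of the counts of the disjoint sets `C`. -/
theorem IsPoissonPointProcess.map_counts_restrict_of_recurrence [IsProbabilityMeasure P] [Finite J]
    [DecidableEq J] (hI : IsPoissonPointProcess μ P I) {C : J → Set X}
    (hC : ∀ j, MeasurableSet (C j)) (hCf : ∀ j, μ (C j) ≠ ∞)
    (hd : Pairwise fun i j => Disjoint (C i) (C j)) {E : Set Ω}
    (hrec : ∀ (k : J → ℕ∞) j,
      ((k j + 1 : ℕ∞) : ℝ≥0∞) * P (E ∩ {ω | counts C (I ω) = k + Pi.single j 1}) =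
        μ (C j) * P (E ∩ {ω | counts C (I ω) = k})) :
    (P.restrict E).map (fun ω => counts C (I ω)) = P E • P.map fun ω => counts C (I ω) := by
  have := Fintype.ofFinite J
  have hm := hI.measurable_counts hC
  set p : (J → ℕ∞) → ℝ≥0∞ := fun k => P {ω | counts C (I ω) = k} with hp
  set q : (J → ℕ∞) → ℝ≥0∞ := fun k => P (E ∩ {ω | counts C (I ω) = k}) with hq
  have hpk : ∀ k, P.map (fun ω => counts C (I ω)) {k} = p k := fun k => by
    rw [Measure.map_apply hm (MeasurableSet.singleton k)]; rfl
  have hqk : ∀ k, (P.restrict E).map (fun ω => counts C (I ω)) {k} = q k := fun k => by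
    rw [Measure.map_apply hm (MeasurableSet.singleton k),
      Measure.restrict_apply (hm (MeasurableSet.singleton k)), inter_comm]; rfl
  -- The values with an infinite coordinate have probability zero.
  have hprop : ∀ k, q k * p 0 = q 0 * p k := by
    intro k
    by_cases hk : ∃ j, k j = ⊤
    · obtain ⟨j, hj⟩ := hk
      have hp0 : p k = 0 := measure_mono_null (fun ω hω => by
        change (I ω ∩ C j).encard = ⊤
        rw [← hj, ← show counts C (I ω) = k from hω]
        rfl) (hI.measure_count_eq_top (hC j) (hCf j))
      have hq0 : q k = 0 := measure_mono_null inter_subset_right hp0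
      rw [hp0, hq0, zero_mul, mul_zero]
    · push Not at hk
      have : k = fun j => (((k j).toNat : ℕ) : ℕ∞) := by
        funext j
        exact (ENat.natCast_toNat (hk j)).symm
      rw [this]
      exact mul_eq_mul_of_recurrence (fun k j => hI.measure_counts_add_single hC hCf hd k j) hrec _
  have hsum : P E * p 0 = q 0 := by
    have e1 : ∑' k, q k = P E := by
      simp_rw [← hqk]
      rw [tsum_measure_singleton, Measure.map_apply hm .univ, preimage_univ, Measure.restrict_apply_univ]
    have e2 : ∑' k, p k = 1 := by
      simp_rw [← hpk]
      rw [tsum_measure_singleton, Measure.map_apply hm .univ, preimage_univ, measure_univ]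
    rw [← e1, ← ENNReal.tsum_mul_right]
    simp_rw [hprop]
    rw [ENNReal.tsum_mul_left, e2, mul_one]
  have hp0 : p 0 ≠ 0 := hI.measure_counts_zero_ne_zero hC hCf hd
  refine Measure.ext_of_singleton fun k => ?_
  rw [hqk, Measure.smul_apply, hpk, smul_eq_mul]
  refine (ENNReal.mul_left_inj hp0 (measure_ne_top P _)).1 ?_
  rw [hprop, ← hsum]
  ring

/-- The constant of a tail event is the probability of the event, since sets of large measure obey
the law of large numbers. -/
theorem IsPoissonPointProcess.eq_measure_of_lintegral_count [IsProbabilityMeasure P]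
    (hI : IsPoissonPointProcess μ P I) {F : Set Ω} (hF : MeasurableSet F) {U : Set X}
    (hU : MeasurableSet U) (hUf : μ U ≠ ∞) {B : ℕ → Set X} (hB : ∀ m, MeasurableSet (B m))
    (hBf : ∀ m, μ (B m) ≠ ∞) (hBt : Filter.Tendsto (fun m => μ (B m)) Filter.atTop (nhds ∞))
    {c : ℝ≥0∞} (h : ∀ B, MeasurableSet B → μ B ≠ ∞ → Disjoint B U →
      ∫⁻ ω in F, (((I ω ∩ B).encard : ℕ∞) : ℝ≥0∞) ∂P = c * μ B) : c = P F := by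
  have hlarge : ∀ R : ℝ≥0, ∃ B, MeasurableSet B ∧ μ B ≠ ∞ ∧ Disjoint B U ∧ R < μ B := by
    intro R
    obtain ⟨m, hm⟩ := (hBt.eventually (lt_mem_nhds
      (show (R : ℝ≥0∞) + μ U < ∞ from by finiteness))).exists
    refine ⟨B m \ U, (hB m).diff hU, ne_top_of_le_ne_top (hBf m) (measure_mono sdiff_subset),
      disjoint_sdiff_left, ?_⟩
    exact (lt_tsub_iff_right.2 hm).trans_le le_measure_sdiff
  have hc1 : c ≤ 1 := by
    obtain ⟨B, hB, hBf, hBU, hlt⟩ := hlarge 0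
    have h0 : μ B ≠ 0 := by simpa using hlt.ne'
    refine (ENNReal.mul_le_mul_iff_left h0 hBf).1 ?_
    rw [← h B hB hBf hBU, one_mul]
    exact (setLIntegral_le_lintegral _ _).trans (hI.lintegral_count hB hBf).le
  have hct : c ≠ ∞ := ne_top_of_le_ne_top ENNReal.one_ne_top hc1
  rw [← ENNReal.toReal_eq_toReal_iff' hct (measure_ne_top P F)]
  by_contra hne
  have hpos : 0 < (c.toReal - P.real F) ^ 2 := by
    have : c.toReal - P.real F ≠ 0 := sub_ne_zero.2 hne
    positivity
  obtain ⟨B, hB, hBf, hBU, hlt⟩ := hlarge (Real.toNNReal (1 / (c.toReal - P.real F) ^ 2))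
  have hle := hI.abs_sub_le hB hBf hF (c := c.toReal) ENNReal.toReal_nonneg
    (by rw [ENNReal.ofReal_toReal hct]; exact h B hB hBf hBU)
  have hlt' : 1 / (c.toReal - P.real F) ^ 2 < (μ B).toReal := by
    rw [← ENNReal.ofReal_lt_iff_lt_toReal (by positivity) hBf]
    exact hlt
  rw [div_lt_iff₀ hpos, mul_comm] at hlt'
  linarith

/-- A zero-one law: let `E` be an event that, for every `n`, is expressed by the counts of a family
`A n` of sets. If the sets that are measurable with respect to all these families, which are
assumed to be decreasing in `n`, are null or conull, and if the intensity is infinite, then `E` has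
probability zero or one. -/
theorem IsPoissonPointProcess.zero_one [IsProbabilityMeasure P]
    (hI : IsPoissonPointProcess μ P I) {ι : ℕ → Type*} {A : ∀ n, ι n → Set X}
    (hA : ∀ n i, MeasurableSet (A n i)) (hfin : ∀ n i, μ (A n i) ≠ ∞)
    (hanti : Antitone fun n => MeasurableSpace.comap (pointCounts (A n)) MeasurableSpace.pi)
    (htail : ∀ T, (∀ n, MeasurableSet[MeasurableSpace.comap (pointCounts (A n))
      MeasurableSpace.pi] T) → μ T = 0 ∨ μ Tᶜ = 0) {B : ℕ → Set X}
    (hB : ∀ m, MeasurableSet (B m)) (hBf : ∀ m, μ (B m) ≠ ∞) (hBu : ⋃ m, B m = univ)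
    (hBt : Filter.Tendsto (fun m => μ (B m)) Filter.atTop (nhds ∞)) {E : Set Ω}
    (hE : ∀ n, ∃ S : Set (ι n → ℕ∞), MeasurableSet S ∧ E = {ω | counts (A n) (I ω) ∈ S}) :
    P E = 0 ∨ P E = 1 := by
  classical
  have : SigmaFinite μ :=
    ⟨⟨{ set := B, set_mem := fun _ => trivial, finite := fun m => (hBf m).lt_top, spanning := hBu }⟩⟩
  choose S hS hES using hE
  have hEm : MeasurableSet E := by
    rw [hES 0]
    exact hI.measurable_counts (hA 0) (hS 0)
  -- The event is independent of the counts of any finite family of disjoint sets.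
  have hcell : ∀ (J : Type _) [Finite J] (C : J → Set X), (∀ j, MeasurableSet (C j)) →
      (∀ j, μ (C j) ≠ ∞) → (Pairwise fun i j => Disjoint (C i) (C j)) →
      (P.restrict E).map (fun ω => counts C (I ω)) = P E • P.map fun ω => counts C (I ω) := by
    intro J _ C hC hCf hd
    refine hI.map_counts_restrict_of_recurrence hC hCf hd fun k j => ?_
    obtain ⟨c, hc1, hc2⟩ := exists_const_of_tail hI hA hfin hanti htail hS hES hC hCf hd k
    have hF : MeasurableSet (E ∩ {ω | counts C (I ω) = k}) :=
      hEm.inter (hI.measurable_counts hC (MeasurableSet.singleton k))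
    have hU : μ (⋃ j, C j) ≠ ∞ := by
      have := Fintype.ofFinite J
      refine ne_top_of_le_ne_top ?_ (measure_iUnion_fintype_le μ C)
      exact ENNReal.sum_ne_top.2 fun j _ => hCf j
    have hcP := hI.eq_measure_of_lintegral_count hF (MeasurableSet.iUnion hC) hU hB hBf hBt
      fun B' hB' hBf' hd' => hc1 B' hB' hBf' (disjoint_iUnion_right.1 hd')
    rw [hc2 j, hcP, mul_comm]
  -- It is therefore independent of the counts of the family `A 0`, by which it is expressed.
  have hlaw : (P.restrict E).map (fun ω => counts (A 0) (I ω)) =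
      P E • P.map fun ω => counts (A 0) (I ω) := by
    have hm := hI.measurable_counts (hA 0)
    have : IsFiniteMeasure (P E • P.map fun ω => counts (A 0) (I ω)) :=
      Measure.smul_finite _ (measure_ne_top P E)
    refine IsProjectiveLimit.unique
      (P := fun s : Finset (ι 0) => (P E • P.map fun ω => counts (A 0) (I ω)).map s.restrict)
      (fun s => ?_) fun s => rfl
    have hr := Finset.measurable_restrict (X := fun _ : ι 0 => ℕ∞) s
    have hv : Measurable (vennSum (ι := s)) := .of_discrete
    have hcm := hI.measurable_counts (measurableSet_vennCell (A := fun i : s => A 0 i)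
      fun i => hA 0 i)
    have hc := hcell _ (vennCell fun i : s => A 0 i)
      (measurableSet_vennCell fun i => hA 0 i)
      (fun j => ne_top_of_le_ne_top (hfin 0 j.2.some) (measure_mono (vennCell_subset j.2.some_mem)))
      (vennCell_disjoint _)
    have e : s.restrict ∘ (fun ω => counts (A 0) (I ω)) =
        vennSum ∘ fun ω => counts (vennCell fun i : s => A 0 i) (I ω) := by
      funext ω
      exact counts_eq_vennSum (fun i : s => A 0 i) (I ω)
    beta_reduce
    rw [Measure.map_smul, Measure.map_map hr hm, Measure.map_map hr hm, e,
      ← Measure.map_map hv hcm, hc, Measure.map_smul, Measure.map_map hv hcm]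
  have h := congrArg (fun m => m (S 0)) hlaw
  simp only [Measure.smul_apply, smul_eq_mul] at h
  rw [Measure.map_apply (hI.measurable_counts (hA 0)) (hS 0),
    Measure.map_apply (hI.measurable_counts (hA 0)) (hS 0)] at h
  change P.restrict E {ω | counts (A 0) (I ω) ∈ S 0} = P E * P {ω | counts (A 0) (I ω) ∈ S 0} at h
  rw [← hES 0, Measure.restrict_apply_self] at h
  by_cases h0 : P E = 0
  · exact Or.inl h0
  · right
    exact ((ENNReal.mul_right_inj h0 (measure_ne_top P E)).1 (by rw [← h, mul_one])).symm

end Poisson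

/-! ### Noodles of a single trajectory -/

theorem measurableSet_segment_eq (s t : ℤ) (l : List Site) :
    MeasurableSet {w : ℤ → Site | segment w s t = l} := by
  simp_rw [List.ext_getElem?_iff, ofPred_forall]
  refine MeasurableSet.iInter fun i => ?_
  simp only [segment, List.getElem?_map]
  cases (List.range (t + 1 - s).toNat)[i]? with
  | none => simp
  | some j =>
    exact measurableSet_preimage (f := fun w : ℤ → Site => w (s + (j : ℤ))) (by fun_prop)
      (t := {x | some x = l[i]?}) .of_discrete

theorem measurableSet_mem_visits (K : Finset Site) (l : Noodle K) (p : ℤ × ℤ) :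
    MeasurableSet {w : ℤ → Site | p ∈ visits K l w} := by
  have : {w : ℤ → Site | p ∈ visits K l w} = {_w | p.1 ≤ p.2} ∩
      (⋂ k : ℤ, ⋂ _ : p.1 ≤ k, ⋂ _ : k ≤ p.2, {w | w k ∈ (K : Set Site)}) ∩
      {w | w (p.1 - 1) ∈ (K : Set Site)ᶜ} ∩ {w | w (p.2 + 1) ∈ (K : Set Site)ᶜ} ∩
      {w | segment w p.1 p.2 = l.1} := by
    ext w
    simp only [visits, IsVisit, mem_ofPred_eq, mem_inter_iff, mem_iInter, mem_compl_iff,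
      Finset.mem_coe]
    tauto
  rw [this]
  refine ((((MeasurableSet.const _).inter ?_).inter (measurableSet_coord_mem _ _)).inter
    (measurableSet_coord_mem _ _)).inter (measurableSet_segment_eq _ _ _)
  exact MeasurableSet.iInter fun k => MeasurableSet.iInter fun _ => MeasurableSet.iInter fun _ =>
    measurableSet_coord_mem _ _

/-- The trajectories that generate the noodle `l` on `K` more than `j` times. -/
def noodleSet (K : Finset Site) (l : Noodle K) (j : ℕ) : Set TrajMod :=
  {ρ | ((j + 1 : ℕ) : ℕ∞) ≤ ρ.noodleCount K l}

theorem measurableSet_noodleSet (K : Finset Site) (l : Noodle K) (j : ℕ) :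
    MeasurableSet (noodleSet K l j) := by
  change MeasurableSet (Quotient.mk shiftSetoid ⁻¹' noodleSet K l j)
  have : Quotient.mk shiftSetoid ⁻¹' noodleSet K l j = Subtype.val ⁻¹'
      (⋃ F : Finset (ℤ × ℤ), ⋃ _ : F.card = j + 1, ⋂ p ∈ F, {w | p ∈ visits K l w}) := by
    ext w
    simp only [mem_preimage, mem_iUnion, mem_iInter, mem_ofPred_eq]
    change ((j + 1 : ℕ) : ℕ∞) ≤ (visits K l w.1).encard ↔ _
    constructor
    · intro h
      obtain ⟨t, ht, hc⟩ := exists_subset_encard_eq h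
      have hfin : t.Finite := finite_of_encard_eq_coe hc
      refine ⟨hfin.toFinset, ?_, fun p hp => ht (hfin.mem_toFinset.1 hp)⟩
      rw [hfin.encard_eq_coe_toFinset_card] at hc
      exact_mod_cast hc
    · rintro ⟨F, hF, h⟩
      rw [← hF, ← encard_coe_eq_coe_finsetCard]
      exact encard_le_encard fun p hp => h p hp
  rw [this]
  exact measurable_subtype_coe (MeasurableSet.iUnion fun F => MeasurableSet.iUnion fun _ =>
    MeasurableSet.biInter (to_countable _) fun p _ => measurableSet_mem_visits K l p)

theorem noodleSet_subset_hitSet (K : Finset Site) (l : Noodle K) (j : ℕ) :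
    noodleSet K l j ⊆ hitSet K := by
  intro ρ hρ
  induction ρ using Quotient.inductionOn with
  | h w =>
    have h : ((j + 1 : ℕ) : ℕ∞) ≤ (visits K l w.1).encard := hρ
    have hne : (visits K l w.1).Nonempty := by
      rw [← encard_ne_zero]
      rintro h0
      rw [h0] at h
      simp at h
    obtain ⟨p, hp, -⟩ := hne
    exact ⟨w.1 p.1, hp.2.1 p.1 le_rfl hp.1, p.1, rfl⟩

/-- Two paths that differ only on a finite stretch outside of `K` generate the same noodles. -/
theorem encard_visits_le {K : Finset Site} (l : Noodle K) {w w' : ℤ → Site} {a b b' : ℤ}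
    (hb : a ≤ b) (hb' : a ≤ b') (hpast : ∀ k ≤ a, w k = w' k)
    (hfut : ∀ k : ℤ, b ≤ k → w k = w' (k + (b' - b))) (hw : ∀ k, a ≤ k → k ≤ b → w k ∉ K) :
    (visits K l w).encard ≤ (visits K l w').encard := by
  -- A visit takes place entirely before or entirely after the stretch; in the second case it is
  -- shifted.
  have hcase : ∀ p ∈ visits K l w, p.2 < a ∨ b < p.1 := by
    rintro ⟨s, t⟩ ⟨⟨hst, hK, -, -⟩, -⟩
    by_contra! h
    simp only at h hst hK
    rcases le_total a s with has | has
    · exact hw s has h.2 (hK s le_rfl hst)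
    · exact hw a le_rfl hb (hK a has h.1)
  refine encard_le_encard_of_injOn
    (f := fun p => if p.2 < a then p else (p.1 + (b' - b), p.2 + (b' - b))) ?_ ?_
  · rintro ⟨s, t⟩ hp
    have hc := hcase _ hp
    obtain ⟨⟨hst, hK, hs, ht⟩, hseg⟩ := hp
    simp only at hc hst hK hs ht hseg ⊢
    split_ifs with hta
    · refine ⟨⟨hst, fun k h1 h2 => ?_, ?_, ?_⟩, ?_⟩
      · simp only at h1 h2
        rw [← hpast k (by omega)]
        exact hK k h1 h2
      · simpa only [← hpast (s - 1) (by omega)] using hs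
      · simpa only [← hpast (t + 1) (by omega)] using ht
      · rw [← hseg]
        refine List.map_congr_left fun j hj => (hpast _ ?_).symm
        have := List.mem_range.1 hj
        simp only at this ⊢
        omega
    · have hbs := hc.resolve_left hta
      refine ⟨⟨by simp only; omega, fun k h1 h2 => ?_, ?_, ?_⟩, ?_⟩
      · simp only at h1 h2
        have e := hfut (k - (b' - b)) (by omega)
        rw [sub_add_cancel] at e
        rw [← e]
        exact hK _ (by omega) (by omega)
      · have e := hfut (s - 1) (by omega)
        rw [show s - 1 + (b' - b) = s + (b' - b) - 1 by ring] at e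
        simpa only [← e] using hs
      · have e := hfut (t + 1) (by omega)
        rw [show t + 1 + (b' - b) = t + (b' - b) + 1 by ring] at e
        simpa only [← e] using ht
      · rw [← hseg]
        simp only [segment]
        rw [show t + (b' - b) + 1 - (s + (b' - b)) = t + 1 - s by ring]
        refine List.map_congr_left fun j hj => ?_
        rw [hfut (s + j) (by omega)]
        congr 1
        ring
  · rintro ⟨s, t⟩ hp ⟨s', t'⟩ hp' h
    have hc := hcase _ hp
    have hc' := hcase _ hp'
    have h1 : s ≤ t := hp.1.1
    have h2 : s' ≤ t' := hp'.1.1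
    simp only at h hc hc'
    split_ifs at h with h3 h4 h4 <;> simp only [Prod.mk.injEq] at h ⊢ <;> omega

theorem finite_euclNorm_le (R : ℝ) : {x : Site | euclNorm x ≤ R}.Finite := by
  refine ((finite_Icc (-⌈R⌉) ⌈R⌉).prod (finite_Icc (-⌈R⌉) ⌈R⌉)).subset ?_
  rintro ⟨x, y⟩ (h : Real.sqrt ((x : ℝ) ^ 2 + (y : ℝ) ^ 2) ≤ R)
  have hx : |(x : ℝ)| ≤ ⌈R⌉ :=
    ((Real.abs_le_sqrt (by nlinarith [sq_nonneg (y : ℝ)])).trans h).trans (Int.le_ceil R)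
  have hy : |(y : ℝ)| ≤ ⌈R⌉ :=
    ((Real.abs_le_sqrt (by nlinarith [sq_nonneg (x : ℝ)])).trans h).trans (Int.le_ceil R)
  rw [abs_le] at hx hy
  simp only [mem_prod, mem_Icc]
  exact_mod_cast And.intro hx hy

theorem lt_euclNorm_of_mem_outer {n : ℕ} {x : Site} (h : x ∈ outer (n + 1)) : n < euclNorm x := by
  simp only [outer, mem_iUnion] at h
  obtain ⟨j, hj, hx, -⟩ := h
  have : ((n + 1 : ℕ) : ℝ) ≤ j := by exact_mod_cast hj
  push_cast at this
  linarith

theorem mem_outer_of_lt {n : ℕ} {x : Site} (h : n < euclNorm x) : x ∈ outer n := by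
  have h0 : 0 < euclNorm x := (Nat.cast_nonneg n).trans_lt h
  simp only [outer, mem_iUnion]
  refine ⟨⌈euclNorm x⌉₊, ?_, ?_, Nat.le_ceil _⟩
  · have := h.trans_le (Nat.le_ceil (euclNorm x))
    exact_mod_cast this.le
  · linarith [Nat.ceil_lt_add_one h0.le]

theorem outer_anti {n m : ℕ} (h : n ≤ m) : outer m ⊆ outer n :=
  biUnion_subset_biUnion_left fun _ hj => h.trans hj

theorem exists_outer_avoids (w : ℤ → Site) (a b : ℤ) :
    ∃ n : ℕ, ∀ m ≥ n, ∀ k, a ≤ k → k ≤ b → w k ∉ outer (m + 1) := by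
  obtain ⟨R, hR⟩ := ((finite_Icc a b).image fun k => euclNorm (w k)).bddAbove
  obtain ⟨n, hn⟩ := exists_nat_ge R
  refine ⟨n, fun m hm k h1 h2 h => ?_⟩
  have e1 := lt_euclNorm_of_mem_outer h
  have e2 := hR (mem_image_of_mem (fun k => euclNorm (w k)) (mem_Icc.2 ⟨h1, h2⟩))
  have e3 : (n : ℝ) ≤ m := by exact_mod_cast hm
  linarith

theorem TrajMod.noodleCount_shiftBy (K : Finset Site) (l : Noodle K) (m : ℤ) (w : ℤ → Site) :
    (visits K l (shiftBy m w)).encard = (visits K l w).encard := by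
  rw [visits_shift K l w (shiftBy m w) m fun _ => rfl]
  refine (Function.Injective.encard_image ?_ _).symm
  rintro ⟨a, b⟩ ⟨c, d⟩ h
  simpa using h

/-- Far away from the origin, tail-equivalent trajectories generate the same noodles. -/
theorem TailEq.exists_encard_visits_eq {w w' : ℤ → Site} (h : TailEq w w') :
    ∃ n : ℕ, ∀ K : Finset Site, (K : Set Site) ⊆ outer (n + 1) → ∀ l : Noodle K,
      (visits K l w).encard = (visits K l w').encard := by
  obtain ⟨⟨m, n, hf⟩, a, n₂, hp⟩ := h
  -- Align the pasts of the two paths.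
  set v := shiftBy (n₂ - a) w' with hv
  have hpast : ∀ k ≤ a, w k = v k := by
    intro k hk
    have := hp (a - k).toNat
    rw [show ((a - k).toNat : ℤ) = a - k by omega, sub_sub_cancel] at this
    rw [this]
    simp only [hv, shiftBy]
    congr 1
    ring
  -- Far enough in the future, the two paths agree up to a shift, at times after `a`.
  set r : ℤ := max (a - m) (a - (n - (n₂ - a))) with hr
  set r' : ℤ := max r 0 with hr'
  set b := m + r' with hb
  set b' := n - (n₂ - a) + r' with hb'
  have hab : a ≤ b := by omega
  have hab' : a ≤ b' := by omega
  have hfut : ∀ k, b ≤ k → w k = v (k + (b' - b)) := by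
    intro k hk
    have := hf (k - m).toNat
    rw [show ((k - m).toNat : ℤ) = k - m by omega, add_sub_cancel] at this
    rw [this]
    simp only [hv, shiftBy]
    congr 1
    omega
  have hfut' : ∀ k, b' ≤ k → v k = w (k + (b - b')) := by
    intro k hk
    rw [hfut _ (by omega)]
    congr 1
    ring
  obtain ⟨n1, hn1⟩ := exists_outer_avoids w a b
  obtain ⟨n2, hn2⟩ := exists_outer_avoids v a b'
  refine ⟨max n1 n2, fun K hK l => ?_⟩
  rw [← TrajMod.noodleCount_shiftBy K l (n₂ - a) w', ← hv]
  exact le_antisymm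
    (encard_visits_le l hab hab' hpast hfut fun k h1 h2 hk =>
      hn1 _ (le_max_left _ _) k h1 h2 (hK hk))
    (encard_visits_le l hab' hab (fun k hk => (hpast k hk).symm) hfut' fun k h1 h2 hk =>
      hn2 _ (le_max_right _ _) k h1 h2 (hK hk))

/-! ### Noodle configurations as counts -/

/-- Layer-cake representation of an extended natural number. -/
theorem toENNReal_eq_tsum (n : ℕ∞) :
    (n : ℝ≥0∞) = ∑' j : ℕ, {j : ℕ | ((j + 1 : ℕ) : ℕ∞) ≤ n}.indicator 1 j := by
  rw [← tsum_subtype]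
  have h : {j : ℕ | ((j + 1 : ℕ) : ℕ∞) ≤ n}.encard = n := by
    induction n with
    | top => simp
    | coe n =>
      have : {j : ℕ | ((j + 1 : ℕ) : ℕ∞) ≤ n} = (Finset.range n : Set ℕ) := by
        ext j
        simp only [Nat.cast_le, mem_ofPred_eq, Finset.coe_range, mem_Iio]
        omega
      rw [this, encard_coe_eq_coe_finsetCard, Finset.card_range]
  conv_lhs => rw [← h]
  exact (ENNReal.tsum_set_one _).symm

/-- The multiplicity of the noodle `l` is the sum over `j` of the numbers of trajectories that
generate `l` more than `j` times. -/
theorem noodleConfig_eq_tsum (I : Set TrajMod) (K : Finset Site) (l : Noodle K) :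
    noodleConfig I K l = ∑' j, (((I ∩ noodleSet K l j).encard : ℕ∞) : ℝ≥0∞) := by
  rw [noodleConfig, tsum_congr fun w : I => toENNReal_eq_tsum (w.1.noodleCount K l),
    ENNReal.tsum_comm]
  refine tsum_congr fun j => ?_
  rw [← ENNReal.tsum_set_one, tsum_subtype (I ∩ noodleSet K l j) fun _ => (1 : ℝ≥0∞),
    tsum_subtype I fun w => {j : ℕ | ((j + 1 : ℕ) : ℕ∞) ≤ w.noodleCount K l}.indicator 1 j]
  refine tsum_congr fun w => ?_
  by_cases h1 : w ∈ I <;> by_cases h2 : w ∈ noodleSet K l j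
  · rw [indicator_of_mem h1, indicator_of_mem (show w ∈ I ∩ noodleSet K l j from ⟨h1, h2⟩),
      indicator_of_mem (show j ∈ {j : ℕ | ((j + 1 : ℕ) : ℕ∞) ≤ w.noodleCount K l} from h2),
      Pi.one_apply]
  · rw [indicator_of_mem h1, indicator_of_notMem (fun h => h2 h.2 : w ∉ I ∩ noodleSet K l j),
      indicator_of_notMem (show j ∉ {j : ℕ | ((j + 1 : ℕ) : ℕ∞) ≤ w.noodleCount K l} from h2)]
  all_goals rw [indicator_of_notMem h1, indicator_of_notMem fun h => h1 h.1]

/-- Triples of a finite subset `K` of `Θ_{n + 1}`, a noodle on `K` and a number. -/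
abbrev NoodleIndex (n : ℕ) : Type :=
  Σ K : {K : Finset Site // (K : Set Site) ⊆ outer (n + 1)}, Noodle K.1 × ℕ

/-- The sets of trajectories whose counts express the noodle configurations on the finite subsets
of `Θ_{n + 1}`. -/
def noodleFamily (n : ℕ) (i : NoodleIndex n) : Set TrajMod := noodleSet i.1.1 i.2.1 i.2.2

theorem measurableSet_noodleFamily (n : ℕ) (i : NoodleIndex n) :
    MeasurableSet (noodleFamily n i) := measurableSet_noodleSet _ _ _

/-- The events of `ℱ_{n + 1}` are expressed by countably many counts. -/
theorem outerSigma_le_comap {Ω : Type*} (I : Ω → Set TrajMod) (n : ℕ) :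
    outerSigma I (n + 1) ≤
      MeasurableSpace.comap (fun ω => counts (noodleFamily n) (I ω)) MeasurableSpace.pi := by
  refine MeasurableSpace.generateFrom_le ?_
  rintro E ⟨K, hK, N, rfl⟩
  refine ⟨⋃ η ∈ N, ⋂ l : Noodle K, {v : NoodleIndex n → ℕ∞ |
    ∑' j, ((v ⟨⟨K, hK⟩, l, j⟩ : ℕ∞) : ℝ≥0∞) = (η.count l : ℝ≥0∞)}, ?_, ?_⟩
  · have : Countable (Multiset (Noodle K)) :=
      inferInstanceAs (Countable (Quotient (List.isSetoid (Noodle K))))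
    refine MeasurableSet.biUnion (to_countable _) fun η _ => MeasurableSet.iInter fun l => ?_
    refine measurableSet_eq_fun (Measurable.tsum fun j => ?_) measurable_const
    exact (Measurable.of_discrete (f := fun n : ℕ∞ => (n : ℝ≥0∞))).comp (measurable_pi_apply _)
  · ext ω
    simp only [cylinderEvent, mem_preimage, mem_iUnion, mem_iInter, mem_ofPred_eq,
      noodleConfig_eq_tsum, exists_prop]
    rfl

theorem exists_eq_counts_of_tail {Ω : Type*} {I : Ω → Set TrajMod} {E : Set Ω}
    (hE : MeasurableSet[tailSigma I] E) (n : ℕ) :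
    ∃ S : Set (NoodleIndex n → ℕ∞), MeasurableSet S ∧
      E = {ω | counts (noodleFamily n) (I ω) ∈ S} := by
  have hle : tailSigma I ≤ outerSigma I (n + 1) := (iInf_le _ (n + 1)).trans (iInf_le _ (by omega))
  obtain ⟨S, hS, h⟩ := (hle.trans (outerSigma_le_comap I n)) E hE
  exact ⟨S, hS, h.symm⟩

theorem antitone_comap_noodleFamily :
    Antitone fun n => MeasurableSpace.comap (pointCounts (noodleFamily n)) MeasurableSpace.pi := by
  intro n m h
  set r : (NoodleIndex n → ℕ∞) → (NoodleIndex m → ℕ∞) := fun v i =>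
    v ⟨⟨i.1.1, i.1.2.trans (outer_anti (Nat.succ_le_succ h))⟩, i.2⟩ with hr
  have hrm : Measurable r := measurable_pi_lambda _ fun i => measurable_pi_apply _
  have e : pointCounts (noodleFamily m) = r ∘ pointCounts (noodleFamily n) := rfl
  simp only
  rw [e, ← MeasurableSpace.comap_comp]
  exact MeasurableSpace.comap_mono hrm.comap_le

/-- Tail sets of trajectories do not separate tail-equivalent trajectories, hence they are null or
conull for the intensity. -/
theorem intensity_zero_one_of_tail {T : Set TrajMod}
    (hT : ∀ n, MeasurableSet[MeasurableSpace.comap (pointCounts (noodleFamily n))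
      MeasurableSpace.pi] T) : intensity T = 0 ∨ intensity Tᶜ = 0 := by
  have hm : MeasurableSet T :=
    (measurable_pointCounts (measurableSet_noodleFamily 0)).comap_le _ (hT 0)
  refine intensity_zero_one hm fun w hw w' hw' h => ?_
  obtain ⟨n, hn⟩ := h.exists_encard_visits_eq
  obtain ⟨S, -, rfl⟩ := hT n
  have e : pointCounts (noodleFamily n) (Quotient.mk shiftSetoid ⟨w, hw⟩) =
      pointCounts (noodleFamily n) (Quotient.mk shiftSetoid ⟨w', hw'⟩) := by
    funext ⟨K, l, j⟩
    have hiff : (Quotient.mk shiftSetoid ⟨w, hw⟩ : TrajMod) ∈ noodleFamily n ⟨K, l, j⟩ ↔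
        (Quotient.mk shiftSetoid ⟨w', hw'⟩ : TrajMod) ∈ noodleFamily n ⟨K, l, j⟩ := by
      change ((j + 1 : ℕ) : ℕ∞) ≤ (visits K.1 l w).encard ↔
        ((j + 1 : ℕ) : ℕ∞) ≤ (visits K.1 l w').encard
      rw [hn K.1 K.2 l]
    by_cases hmem : (Quotient.mk shiftSetoid ⟨w, hw⟩ : TrajMod) ∈ noodleFamily n ⟨K, l, j⟩
    · rw [pointCounts_of_mem hmem, pointCounts_of_mem (hiff.1 hmem)]
    · rw [pointCounts_of_notMem hmem, pointCounts_of_notMem (mt hiff.2 hmem)]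
  simp only [mem_pathsOf, hw, hw', exists_true_left, mem_preimage, e]

/-! ### The vacant set -/

/-- A nearest-neighbor path leaves a site immediately. -/
theorem visits_singleton {x : Site} {w : ℤ → Site} (hw : ∀ k, Adj (w k) (w (k + 1))) {k : ℤ}
    (hk : w k = x) : (k, k) ∈ visits {x} ⟨[x], by simp⟩ w := by
  have hne : ∀ y : Site, ¬ Adj y y := fun y h => by simp [Adj] at h
  refine ⟨⟨le_rfl, fun j h1 h2 => ?_, fun h => ?_, fun h => ?_⟩, ?_⟩
  · rw [le_antisymm h2 h1]
    simpa using hk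
  · have := hw (k - 1)
    rw [sub_add_cancel, hk, Finset.mem_singleton.1 h] at this
    exact hne x this
  · have := hw k
    rw [hk, Finset.mem_singleton.1 h] at this
    exact hne x this
  · simp [segment, hk]

theorem mem_vacantSet_iff (I : Set TrajMod) (x : Site) :
    x ∈ vacantSet I ↔ ∀ l : Noodle {x}, noodleConfig I {x} l = 0 := by
  simp only [noodleConfig, ENNReal.tsum_eq_zero, vacantSet, mem_ofPred_eq, Subtype.forall,
    ENat.toENNReal_eq_zero]
  constructor
  · intro h l hl ρ hρ
    have := h ρ hρ
    by_contra h0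
    have hmem : ρ ∈ noodleSet {x} ⟨l, hl⟩ 0 := by
      change ((0 + 1 : ℕ) : ℕ∞) ≤ _
      simpa using Order.one_le_iff_ne_zero.2 h0
    obtain ⟨y, hy, hys⟩ := noodleSet_subset_hitSet _ _ _ hmem
    rw [Finset.mem_singleton.1 hy] at hys
    exact this hys
  · intro h ρ hρ hx
    -- A path visits a single site for one unit of time, which generates the noodle `[x]`.
    have := h [x] (by simp) ρ hρ
    induction ρ using Quotient.inductionOn with
    | h w =>
      obtain ⟨k, hk⟩ := hx
      have hv := visits_singleton w.2.1 hk
      have h0 : (visits {x} ⟨[x], by simp⟩ w.1).encard = 0 := this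
      rw [encard_eq_zero] at h0
      rw [h0] at hv
      exact hv

theorem measurableSet_mem_vacantSet {Ω : Type*} (I : Ω → Set TrajMod) {n : ℕ} {x : Site}
    (hx : x ∈ outer n) : MeasurableSet[outerSigma I n] {ω | x ∈ vacantSet (I ω)} := by
  refine MeasurableSpace.measurableSet_generateFrom ⟨{x}, by simpa using hx, {0}, ?_⟩
  ext ω
  simp [cylinderEvent, mem_vacantSet_iff]

/-- Since the complement of `Θ_n` is finite, whether the vacant set is infinite is decided in
`Θ_n`. -/
theorem measurableSet_infinite_vacantSet {Ω : Type*} (I : Ω → Set TrajMod) :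
    MeasurableSet[tailSigma I] {ω | (vacantSet (I ω)).Infinite} := by
  rw [MeasurableSpace.measurableSet_iInf]
  intro n
  rw [MeasurableSpace.measurableSet_iInf]
  intro _
  have hset : {ω | (vacantSet (I ω)).Infinite} =
      ⋂ F : Finset Site, ⋃ x : Site, ⋃ _ : x ∈ outer n, ⋃ _ : x ∉ F, {ω | x ∈ vacantSet (I ω)} := by
    ext ω
    simp only [mem_ofPred_eq, mem_iInter, mem_iUnion, exists_prop]
    constructor
    · intro h F
      have hfin : ({x : Site | euclNorm x ≤ n} ∪ F).Finite :=
        (finite_euclNorm_le n).union F.finite_toSet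
      obtain ⟨x, hx, hxF⟩ := h.exists_notMem_finite hfin
      rw [mem_union, not_or] at hxF
      exact ⟨x, mem_outer_of_lt (not_le.1 hxF.1), hxF.2, hx⟩
    · intro h hfin
      obtain ⟨x, -, hxF, hx⟩ := h hfin.toFinset
      exact hxF (hfin.mem_toFinset.2 hx)
  rw [hset]
  exact MeasurableSet.iInter fun F => MeasurableSet.iUnion fun x => MeasurableSet.iUnion fun hx =>
    MeasurableSet.iUnion fun _ => measurableSet_mem_vacantSet I hx

/-! ### The zero-one law for tail events -/

theorem IsRandomInterlacement.tail_zero_one {Ω : Type*} [MeasurableSpace Ω] {P : Measure Ω}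
    [IsProbabilityMeasure P] {α : ℝ} (hα : 0 < α) {I : Ω → Set TrajMod}
    (hI : IsRandomInterlacement α P I) {E : Set Ω} (hE : MeasurableSet[tailSigma I] E) :
    P E = 0 ∨ P E = 1 := by
  have hc0 : ENNReal.ofReal (Real.pi * α) ≠ 0 := by
    rw [ENNReal.ofReal_ne_zero_iff]
    positivity
  have hfin : ∀ K : Finset Site, (ENNReal.ofReal (Real.pi * α) • intensity) (hitSet K) ≠ ∞ := by
    intro K
    rw [Measure.smul_apply, smul_eq_mul]
    exact ENNReal.mul_ne_top ENNReal.ofReal_ne_top (intensity_hitSet_ne_top K)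
  refine IsPoissonPointProcess.zero_one hI (A := noodleFamily) measurableSet_noodleFamily
    (fun n i => ne_top_of_le_ne_top (hfin i.1.1) (measure_mono (noodleSet_subset_hitSet _ _ _)))
    antitone_comap_noodleFamily (fun T hT => ?_) (B := fun m : ℕ => hitSet (level m))
    (fun m => measurableSet_hitSet _) (fun m => hfin _) iUnion_hitSet_level ?_
    (exists_eq_counts_of_tail hE)
  · rcases intensity_zero_one_of_tail hT with h | h
    · left
      rw [Measure.smul_apply, h, smul_zero]
    · right
      rw [Measure.smul_apply, h, smul_zero]
  · have h := ENNReal.Tendsto.const_mul (a := ENNReal.ofReal (Real.pi * α))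
      tendsto_intensity_level (Or.inl ENNReal.top_ne_zero)
    rw [ENNReal.mul_top hc0] at h
    exact h

end Interlacement

theorem mainTheorem3 {Ω : Type*} [MeasurableSpace Ω] (P : Measure Ω) [IsProbabilityMeasure P]
    (α : ℝ) (hα : 0 < α) (I : Ω → Set Interlacement.TrajMod)
    (hI : Interlacement.IsRandomInterlacement α P I) :
    (∀ E : Set Ω, MeasurableSet[Interlacement.tailSigma I] E → P E = 0 ∨ P E = 1) ∧
      (P {ω | (Interlacement.vacantSet (I ω)).Infinite} = 0 ∨
        P {ω | (Interlacement.vacantSet (I ω)).Infinite} = 1) := by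
  exact ⟨fun E hE => hI.tail_zero_one hα hE,
    hI.tail_zero_one hα (Interlacement.measurableSet_infinite_vacantSet I)⟩
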